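/- Let $d\ge 1$ and write points of $\mathbb R^{d+1}$ as $(t,x)$, $t\in\mathbb R$, $x\in\mathbb R^d$. For $\rho\in(0,\infty]$ put $$C_\rho(t,x)=\{(s,y)\in\mathbb R^{d+1}:|x-y|<\rho,\ t\le s<t+\rho^2\},\qquad C_\rho=C_\rho(0,0),$$ so that $C_\infty=[0,\infty)\times\mathbb R^d$. For $p_1,p_2\in(1,\infty)$ and a measurable function $f$ on $\mathbb R^{d+1}$ let $$\|f\|_{L_{p_1,p_2}}=\Big(\int_{\mathbb R}\Big(\int_{\mathbb R^d}|f(t,x)|^{p_1}\,dx\Big)^{p_2/p_1}dt\Big)^{1/p_2},$$ and for $0<\gamma\le d/p_1+2/p_2$ and $Q\subset\mathbb R^{d+1}$ let $$\|f\|_{E_{p_1,p_2,\gamma}(Q)}=\sup_{0<\rho<\infty,\ (t,x)\in Q}\rho^{\gamma}\,\frac{\|f\,I_Q I_{C_\rho(t,x)}\|_{L_{p_1,p_2}}}{\|I_{C_\rho(t,x)}\|_{L_{p_1,p_2}}}.$$ Let $Du$ and $D^2u$ be the gradient and the Hessian of $u$ with respect to $x$, with Euclidean norms $|Du|$ and $|D^2u|=(\sum_{i,j}|D_{ij}u|^2)^{1/2}$.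 **Theorem.** Let $q_1,q_2\in(1,\infty)$, $1<\beta\le d/q_1+2/q_2$, and let $r_1,r_2$ be defined by $r_i(\beta-1)=q_i\beta$, $i=1,2$. Then there is a constant $N<\infty$, depending only on $d,q_1,q_2,\beta$, such that for every $R\in(0,\infty]$ and every $u\in C_0^\infty(\mathbb R^{d+1})$ $$\|Du\|_{E_{r_1,r_2,\beta-1}(C_R)}\le N\,\big\||\partial_tu|+|D^2u|\big\|_{E_{q_1,q_2,\beta}(C_R)}+N R^{-2}\|u\|_{E_{q_1,q_2,\beta}(C_R)},$$ where $R^{-2}=0$ if $R=\infty$. -/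

import Mathlib

open MeasureTheory
open scoped ENNReal NNReal

noncomputable section

namespace ParabolicMorrey

/-- `ℝ^{d+1}`, the space of points `z = (t, x)`, `t ∈ ℝ`, `x ∈ ℝ^d` (Euclidean). -/
abbrev SpaceTime (d : ℕ) : Type := ℝ × EuclideanSpace ℝ (Fin d)

variable {d : ℕ} {F : Type*} [NormedAddCommGroup F]

/-- The parabolic cylinder `C_ρ(t, x) = {(s, y) : |x - y| < ρ, t ≤ s < t + ρ²}`. The radius may be
infinite, and then the cylinder is `[t, ∞) × ℝ^d`. -/
def cylinder (ρ : ℝ≥0∞) (z : SpaceTime d) : Set (SpaceTime d) :=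
  {w | edist z.2 w.2 < ρ ∧ z.1 ≤ w.1 ∧ ENNReal.ofReal (w.1 - z.1) < ρ ^ 2}

theorem mem_cylinder_coe (ρ : ℝ≥0) (z w : SpaceTime d) :
    w ∈ cylinder (ρ : ℝ≥0∞) z ↔ dist z.2 w.2 < ρ ∧ z.1 ≤ w.1 ∧ w.1 < z.1 + (ρ : ℝ) ^ 2 := by
  have h1 : edist z.2 w.2 < (ρ : ℝ≥0∞) ↔ dist z.2 w.2 < ρ := by
    rw [edist_nndist, ENNReal.coe_lt_coe, ← NNReal.coe_lt_coe, coe_nndist]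
  have h2 : z.1 ≤ w.1 → (ENNReal.ofReal (w.1 - z.1) < (ρ : ℝ≥0∞) ^ 2 ↔
      w.1 < z.1 + (ρ : ℝ) ^ 2) := by
    intro h
    rw [← ENNReal.coe_pow, ← ENNReal.ofReal_coe_nnreal,
      ENNReal.ofReal_lt_ofReal_iff_of_nonneg (by linarith)]
    push_cast
    constructor <;> intro h <;> linarith
  simp only [cylinder, Set.mem_ofPred_eq]
  rw [h1]
  constructor
  · rintro ⟨a, b, c⟩
    exact ⟨a, b, (h2 b).1 c⟩
  · rintro ⟨a, b, c⟩
    exact ⟨a, b, (h2 b).2 c⟩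

theorem mem_cylinder_top (z w : SpaceTime d) : w ∈ cylinder ⊤ z ↔ z.1 ≤ w.1 := by
  simp [cylinder, edist_lt_top]

/-- The mixed norm
`‖f‖_{L_{q₁,q₂}} = (∫_ℝ (∫_{ℝ^d} |f(t, x)|^{q₁} dx)^{q₂/q₁} dt)^{1/q₂} ∈ [0, ∞]`. -/
def mixedNorm (q₁ q₂ : ℝ) (f : SpaceTime d → F) : ℝ≥0∞ :=
  (∫⁻ t : ℝ, (∫⁻ x : EuclideanSpace ℝ (Fin d), ‖f (t, x)‖ₑ ^ q₁) ^ (q₂ / q₁)) ^ (1 / q₂)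

/-- The normalized mixed norm `‖I_Γ‖_{L_{q₁,q₂}}⁻¹ ‖f I_Γ‖_{L_{q₁,q₂}}` over a set `Γ`. -/
def mixedNormAvg (q₁ q₂ : ℝ) (Γ : Set (SpaceTime d)) (f : SpaceTime d → F) : ℝ≥0∞ :=
  (mixedNorm q₁ q₂ (Γ.indicator fun _ => (1 : ℝ)))⁻¹ * mixedNorm q₁ q₂ (Γ.indicator f)

/-- The mixed-norm parabolic Morrey norm `‖f‖_{E_{q₁,q₂,β}(Q)}`: the supremum over
`0 < ρ < ∞` and `z ∈ Q` of `ρ^β` times the normalized norm of `I_Q f` over `C_ρ(z)`. -/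
def morreyNorm (q₁ q₂ β : ℝ) (Q : Set (SpaceTime d)) (f : SpaceTime d → F) : ℝ≥0∞ :=
  ⨆ (ρ : ℝ≥0) (_ : 0 < ρ) (z : SpaceTime d) (_ : z ∈ Q),
    (ρ : ℝ≥0∞) ^ β * mixedNormAvg q₁ q₂ (cylinder ρ z) (Q.indicator f)

/-- The time derivative `∂_t u`. -/
def timeDeriv (u : SpaceTime d → ℝ) (z : SpaceTime d) : ℝ :=
  deriv (fun s => u (s, z.2)) z.1

/-- The spatial partial derivative `D_i u = ∂u/∂x^i`. -/
def spaceDeriv (i : Fin d) (u : SpaceTime d → ℝ) (z : SpaceTime d) : ℝ :=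
  fderiv ℝ (fun y => u (z.1, y)) z.2 (EuclideanSpace.single i 1)

/-- The spatial gradient `Du = (D_1 u, …, D_d u)`, with the Euclidean norm. -/
def spaceGrad (u : SpaceTime d → ℝ) (z : SpaceTime d) : EuclideanSpace ℝ (Fin d) :=
  WithLp.toLp 2 fun i => spaceDeriv i u z

/-- The spatial Hessian `D²u = (D_i D_j u)`, with the Euclidean (Hilbert–Schmidt) norm. -/
def spaceHess (u : SpaceTime d → ℝ) (z : SpaceTime d) : EuclideanSpace ℝ (Fin d × Fin d) :=
  WithLp.toLp 2 fun p => spaceDeriv p.1 (spaceDeriv p.2 u) z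

end ParabolicMorrey

end

/-! The gradient is dominated by a parabolic potential of order one of f = |∂_t u| + |D²u|, and the
potential is estimated by the argument of Hedberg and Adams.

Potential bound. Follow u along the curves l ↦ (t + l²a, x + l(ξ + e)) and average D_i u over ξ
against a bump ψ of unit mass. Since x moves by lξ, the operator l D_i is a derivative in ξ and can
be moved onto ψ; in the term with ∂_t D_i u the factor l comes from differentiating l²a. A further
average over a unit range of a yields |Du(z)| ≲ L⁻¹ A_L|u|(z) + ∫_0^L A_l f(z) dl, where A_l is
l^{-d-2} times the integral over a parabolic box of size 2l (`spaceDeriv_eq_integral`,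
`enorm_spaceDeriv_le_potAvg`). The parameters a, e are free, and are chosen so that the curves from
a point of C_R stay in C_R up to L = R/2, or for all L if R = ∞, when the u-term vanishes as L → ∞
(`enorm_spaceGrad_le_potential`).

Hedberg's trick. A_l f is at most a multiple of the maximal function Mf, and by Hölder at most a
multiple of Φ l^{-β}, Φ being the Morrey norm of f. Balancing the two bounds gives ∫ A_l f dl ≲
(Mf)^κ Φ^{1/β} with κ = 1 - 1/β. On a cylinder of radius ρ only l ≤ ρ is treated so, with f cut off
to a comparable box; the scales l > ρ contribute Φ ρ^{1-β} (`lintegral_potAvg_le`). As κ r_i = q_i,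
the L_{r₁,r₂} norm of (Mg)^κ is the κ-th power of the L_{q₁,q₂} norm of Mg, and κβ = β - 1 makes the
powers of ρ and Φ match.

Maximal theorem. Boundedness of M in mixed norms (`lmixed_parMax_le`) is obtained by extrapolation.
For an A₁ weight v(t), the maximal function of the doubling measure v dt dx controls M on L_p(v) and
on L_p(v^{1-p}); the Rubio de Francia algorithm produces the weights that turn these inequalities
into mixed ones, by Hölder if q ≤ p and by duality if q > p. -/

noncomputable section

namespace ParabolicMorrey

/-! ### Maximal functions over abstract systems of balls. -/

section Maximal

variable {X : Type*} [MeasurableSpace X]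

/-- The layer cake formula for the power `a ^ s` of an extended nonnegative number. -/
theorem lintegral_indicator_lt_rpow {s : ℝ} (hs : 0 < s) (a : ℝ≥0∞) :
    ∫⁻ l in Set.Ioi (0 : ℝ), {l : ℝ | ENNReal.ofReal l < a}.indicator
      (fun l => ENNReal.ofReal l ^ (s - 1)) l = a ^ s / ENNReal.ofReal s := by
  have fin : ∀ x : ℝ, 0 ≤ x →
      ∫⁻ l in Set.Ioi (0 : ℝ), {l : ℝ | ENNReal.ofReal l < ENNReal.ofReal x}.indicator
      (fun l => ENNReal.ofReal l ^ (s - 1)) l = ENNReal.ofReal x ^ s / ENNReal.ofReal s := by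
    intro x hx
    have h1 : ∫⁻ l in Set.Ioi (0 : ℝ), {l : ℝ | ENNReal.ofReal l < ENNReal.ofReal x}.indicator
        (fun l => ENNReal.ofReal l ^ (s - 1)) l
        = ∫⁻ l in Set.Ioi (0 : ℝ), (Set.Iio x).indicator
          (fun l => ENNReal.ofReal (l ^ (s - 1))) l := by
      refine setLIntegral_congr_fun measurableSet_Ioi fun l hl => ?_
      have hl : 0 < l := hl
      by_cases h : l < x
      · rw [Set.indicator_of_mem (by simpa using (ENNReal.ofReal_lt_ofReal_iff_of_nonneg hl.le).2 h),
          Set.indicator_of_mem (by simpa using h), ENNReal.ofReal_rpow_of_pos hl]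
      · rw [Set.indicator_of_notMem, Set.indicator_of_notMem (by simpa using h)]
        rw [Set.mem_ofPred_eq, ENNReal.ofReal_lt_ofReal_iff_of_nonneg hl.le]
        exact h
    rw [h1, lintegral_indicator measurableSet_Iio, Measure.restrict_restrict measurableSet_Iio,
      Set.inter_comm, Set.Ioi_inter_Iio, setLIntegral_congr Ioo_ae_eq_Ioc,
      ← ofReal_integral_eq_lintegral_ofReal, ← intervalIntegral.integral_of_le hx,
      integral_rpow (Or.inl (by linarith))]
    · rw [sub_add_cancel, Real.zero_rpow hs.ne', sub_zero, ENNReal.ofReal_div_of_pos hs,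
        ENNReal.ofReal_rpow_of_nonneg hx hs.le]
    · rw [← IntegrableOn, ← intervalIntegrable_iff_integrableOn_Ioc_of_le hx]
      exact intervalIntegral.intervalIntegrable_rpow' (by linarith)
    · filter_upwards [ae_restrict_mem measurableSet_Ioc] with l hl
      exact Real.rpow_nonneg hl.1.le _
  rcases eq_or_ne a ⊤ with rfl | ha
  · rw [ENNReal.top_rpow_of_pos hs, ENNReal.top_div_of_ne_top ENNReal.ofReal_ne_top]
    refine ENNReal.eq_top_of_forall_nnreal_le fun r => ?_
    -- The number x = (rs)^{1/s} solves x^s / s = r, so the integral for a = ∞ exceeds every finite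
    -- r.
    have := fin (((r : ℝ) * s) ^ (1 / s)) (by positivity)
    have h2 : ENNReal.ofReal (((r : ℝ) * s) ^ (1 / s)) ^ s / ENNReal.ofReal s = r := by
      rw [ENNReal.ofReal_rpow_of_nonneg (by positivity) hs.le, ← Real.rpow_mul (by positivity),
        one_div_mul_cancel hs.ne', Real.rpow_one, ← ENNReal.ofReal_div_of_pos hs,
        mul_div_cancel_right₀ _ hs.ne', ENNReal.ofReal_coe_nnreal]
    rw [← h2, ← this]
    refine lintegral_mono fun l => Set.indicator_le_indicator_of_subset ?_ (fun _ => zero_le) l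
    intro l hl
    simp
  · have := fin a.toReal ENNReal.toReal_nonneg
    rwa [ENNReal.ofReal_toReal ha] at this

/-- The properties of a system of balls `B z k` of radius `2 ^ k` centred at `z`. -/
structure IsBallSystem (B : X → ℤ → Set X) : Prop where
  mem : ∀ z k, z ∈ B z k
  engulf : ∀ z w k l, k ≤ l → (B z k ∩ B w l).Nonempty → B z k ⊆ B w (l + 3)
  measurable : ∀ k, MeasurableSet {p : X × X | p.2 ∈ B p.1 k}

theorem IsBallSystem.measurableSet {B : X → ℤ → Set X} (hB : IsBallSystem B) (z : X) (k : ℤ) :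
    MeasurableSet (B z k) :=
  (measurable_prodMk_left (x := z)) (hB.measurable k)

/-- The average of `f` over a set with respect to `μ`. -/
def lavg (μ : Measure X) (s : Set X) (f : X → ℝ≥0∞) : ℝ≥0∞ :=
  (μ s)⁻¹ * ∫⁻ w in s, f w ∂μ

/-- The centred maximal function with respect to the measure `μ` and the balls `B`. -/
def maximalFn (μ : Measure X) (B : X → ℤ → Set X) (f : X → ℝ≥0∞) (z : X) : ℝ≥0∞ :=
  ⨆ k, lavg μ (B z k) f

variable {μ : Measure X} {B : X → ℤ → Set X} {f g : X → ℝ≥0∞}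

theorem lavg_mono (s : Set X) (h : f ≤ g) : lavg μ s f ≤ lavg μ s g := by
  unfold lavg; gcongr; exact h _

theorem lavg_const_le (s : Set X) (c : ℝ≥0∞) : lavg μ s (fun _ => c) ≤ c := by
  unfold lavg
  rw [setLIntegral_const, mul_left_comm]
  exact mul_le_of_le_one_right' (ENNReal.inv_mul_le_one _)

theorem lavg_le_maximalFn (z : X) (k : ℤ) : lavg μ (B z k) f ≤ maximalFn μ B f z :=
  le_iSup (fun k => lavg μ (B z k) f) k

theorem maximalFn_le_of_le {c : ℝ≥0∞} (h : ∀ z, f z ≤ c) (z : X) : maximalFn μ B f z ≤ c :=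
  iSup_le fun _ => (lavg_mono _ h).trans (lavg_const_le _ c)

theorem measurable_maximalFn [SFinite μ] (hB : IsBallSystem B) (hf : Measurable f) :
    Measurable (maximalFn μ B f) := by
  refine Measurable.iSup fun k => ?_
  unfold lavg
  refine Measurable.mul (measurable_measure_prodMk_left (hB.measurable k)).inv ?_
  have : ∀ z, ∫⁻ w in B z k, f w ∂μ =
      ∫⁻ w, {p : X × X | p.2 ∈ B p.1 k}.indicator (fun p => f p.2) (z, w) ∂μ := by
    intro z
    rw [← lintegral_indicator (hB.measurableSet z k)]
    rfl
  simp_rw [this]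
  exact ((hf.comp measurable_snd).indicator (hB.measurable k)).lintegral_prod_right'

theorem maximalFn_add_le (c : ℝ≥0∞) (hf : Measurable f) (h : ∀ z, g z ≤ f z + c) (z : X) :
    maximalFn μ B g z ≤ maximalFn μ B f z + c := by
  refine iSup_le fun k => (lavg_mono _ h).trans ?_
  have : lavg μ (B z k) (fun z => f z + c) = lavg μ (B z k) f + lavg μ (B z k) fun _ => c := by
    unfold lavg
    rw [lintegral_add_left hf, mul_add]
  rw [this]
  gcongr
  · exact lavg_le_maximalFn z k
  · exact lavg_const_le _ c

theorem mul_measure_lt_setLIntegral_of_lt_lavg {s : Set X} {l : ℝ≥0∞} (h : l < lavg μ s f) :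
    l * μ s < ∫⁻ w in s, f w ∂μ := by
  unfold lavg at h
  have h0 : μ s ≠ 0 := by
    intro h0
    rw [setLIntegral_measure_zero _ _ h0, mul_zero] at h
    exact not_lt_zero h
  have ht : μ s ≠ ⊤ := by
    intro ht
    rw [ht, ENNReal.inv_top, zero_mul] at h
    exact not_lt_zero h
  rw [mul_comm, ← div_eq_mul_inv] at h
  exact (ENNReal.lt_div_iff_mul_lt (Or.inl h0) (Or.inl ht)).1 h

/-- The weak type `(1, 1)` inequality. -/
theorem mul_meas_lt_maximalFn_le (hB : IsBallSystem B) {D : ℝ≥0∞} (hD0 : D ≠ 0)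
    (hD : ∀ z k, μ (B z (k + 3)) ≤ D * μ (B z k)) (l : ℝ≥0∞) :
    l * μ {z | l < maximalFn μ B f z} ≤ D * ∫⁻ w, f w ∂μ := by
  rcases eq_or_ne (∫⁻ w, f w ∂μ) ⊤ with htop | hfin
  · rw [htop, ENNReal.mul_top hD0]; exact le_top
  -- Vitali's covering lemma needs bounded radii: only levels k ≤ n are used here, and n → ∞ by
  -- monotonicity afterwards.
  have key : ∀ n : ℕ, l * μ {z | ∃ k : ℤ, k ≤ n ∧ l * μ (B z k) < ∫⁻ w in B z k, f w ∂μ} ≤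
      D * ∫⁻ w, f w ∂μ := by
    intro n
    obtain ⟨u, hut, hdisj, hcov⟩ := Vitali.exists_disjoint_subfamily_covering_enlargement
      (fun p : X × ℤ => B p.1 p.2)
      {p : X × ℤ | p.2 ≤ n ∧ l * μ (B p.1 p.2) < ∫⁻ w in B p.1 p.2, f w ∂μ}
      (fun p => (2 : ℝ) ^ p.2) (3 / 2) (by norm_num) (fun p _ => by positivity) ((2 : ℝ) ^ (n : ℤ))
      (fun p hp => zpow_le_zpow_right₀ (by norm_num) hp.1)
      (fun p _ => ⟨p.1, hB.mem _ _⟩)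
    have hpos : ∀ p ∈ u, 0 < ∫⁻ w in B p.1 p.2, f w ∂μ :=
      fun p hp => lt_of_le_of_lt zero_le (hut hp).2
    -- The selected balls are disjoint and each has positive mass for the finite measure f dμ.
    have hcount : u.Countable := by
      have : IsFiniteMeasure (μ.withDensity f) := isFiniteMeasure_withDensity hfin
      have hc := Measure.countable_meas_pos_of_disjoint_iUnion (μ := μ.withDensity f)
        (As := fun p : u => B p.1.1 p.1.2) (fun p => hB.measurableSet _ _)
        (fun p q hpq => hdisj p.2 q.2 (fun h => hpq (Subtype.ext h)))
      have huniv : {i : u | 0 < (μ.withDensity f) (B i.1.1 i.1.2)} = Set.univ := by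
        ext p
        simp only [Set.mem_ofPred_eq, Set.mem_univ, iff_true]
        rw [withDensity_apply _ (hB.measurableSet _ _)]
        exact hpos p.1 p.2
      rw [huniv] at hc
      exact Set.countable_coe_iff.1 (Set.countable_univ_iff.1 hc)
    have hsub : {z | ∃ k : ℤ, k ≤ n ∧ l * μ (B z k) < ∫⁻ w in B z k, f w ∂μ} ⊆
        ⋃ p ∈ u, B p.1 (p.2 + 3) := by
      rintro z ⟨k, hk, hz⟩
      obtain ⟨p, hpu, hne, hle⟩ := hcov (z, k) ⟨hk, hz⟩
      -- The Vitali factor 3/2 is smaller than the ratio 2 of consecutive radii, so it permits no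
      -- loss of a level.
      have hkp : k ≤ p.2 := by
        by_contra! hlt
        have h1 : (2 : ℝ) ^ (p.2 + 1) ≤ 2 ^ k := zpow_le_zpow_right₀ (by norm_num) hlt
        rw [zpow_add_one₀ (by norm_num)] at h1
        have h2 : (0 : ℝ) < 2 ^ p.2 := by positivity
        linarith
      exact Set.mem_biUnion hpu (hB.engulf z p.1 k p.2 hkp hne (hB.mem z k))
    calc l * μ {z | ∃ k : ℤ, k ≤ n ∧ l * μ (B z k) < ∫⁻ w in B z k, f w ∂μ}
        ≤ l * ∑' p : u, μ (B p.1.1 (p.1.2 + 3)) := by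
          gcongr
          exact (measure_mono hsub).trans (measure_biUnion_le μ hcount _)
      _ ≤ l * ∑' p : u, D * μ (B p.1.1 p.1.2) := by
          gcongr
          exact hD _ _
      _ = D * ∑' p : u, l * μ (B p.1.1 p.1.2) := by
          rw [ENNReal.tsum_mul_left, ENNReal.tsum_mul_left, mul_left_comm]
      _ ≤ D * ∑' p : u, ∫⁻ w in B p.1.1 p.1.2, f w ∂μ := by
          gcongr with p
          exact (hut p.2).2.le
      _ = D * ∫⁻ w in ⋃ p ∈ u, B p.1 p.2, f w ∂μ := by
          rw [lintegral_biUnion hcount (fun p _ => hB.measurableSet _ _) hdisj]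
      _ ≤ D * ∫⁻ w, f w ∂μ := by
          gcongr
          exact Measure.restrict_le_self
  have hmono : Monotone fun n : ℕ =>
      {z | ∃ k : ℤ, k ≤ n ∧ l * μ (B z k) < ∫⁻ w in B z k, f w ∂μ} := by
    intro m n hmn z ⟨k, hk, hz⟩
    exact ⟨k, hk.trans (by exact_mod_cast hmn), hz⟩
  have hsub : {z | l < maximalFn μ B f z} ⊆
      ⋃ n : ℕ, {z | ∃ k : ℤ, k ≤ n ∧ l * μ (B z k) < ∫⁻ w in B z k, f w ∂μ} := by
    intro z hz
    obtain ⟨k, hk⟩ := lt_iSup_iff.1 (show l < ⨆ k, lavg μ (B z k) f from hz)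
    exact Set.mem_iUnion.2 ⟨k.toNat, k, Int.self_le_toNat k,
      mul_measure_lt_setLIntegral_of_lt_lavg hk⟩
  calc l * μ {z | l < maximalFn μ B f z} ≤ l * μ (⋃ n : ℕ,
        {z | ∃ k : ℤ, k ≤ n ∧ l * μ (B z k) < ∫⁻ w in B z k, f w ∂μ}) := by gcongr
    _ = ⨆ n : ℕ, l * μ {z | ∃ k : ℤ, k ≤ n ∧ l * μ (B z k) < ∫⁻ w in B z k, f w ∂μ} := by
        rw [hmono.measure_iUnion, ENNReal.mul_iSup]
    _ ≤ D * ∫⁻ w, f w ∂μ := iSup_le key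

/-- The strong type `(p, p)` inequality for the maximal function of a doubling measure. -/
theorem lintegral_maximalFn_rpow_le [SFinite μ] (hB : IsBallSystem B) {D : ℝ≥0∞} (hD0 : D ≠ 0)
    (hD : ∀ z k, μ (B z (k + 3)) ≤ D * μ (B z k)) {p : ℝ} (hp : 1 < p) (hf : Measurable f) :
    ∫⁻ z, maximalFn μ B f z ^ p ∂μ ≤
      2 ^ p * ENNReal.ofReal (p / (p - 1)) * D * ∫⁻ z, f z ^ p ∂μ := by
  have hp0 : 0 < p := by linarith
  have hp1 : 0 < p - 1 := by linarith
  have hMm := measurable_maximalFn (μ := μ) hB hf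
  -- Layer cake with a density k, by Tonelli. It is used with k = 1 for the maximal function and
  -- with k = f and exponent p - 1 for f.
  have layer : ∀ {h : X → ℝ≥0∞} (_ : Measurable h) {s : ℝ} (_ : 0 < s) (k : X → ℝ≥0∞)
      (_ : Measurable k),
      ∫⁻ z, h z ^ s * k z ∂μ = ENNReal.ofReal s * ∫⁻ l in Set.Ioi (0 : ℝ),
        ENNReal.ofReal l ^ (s - 1) * ∫⁻ z in {z | ENNReal.ofReal l < h z}, k z ∂μ := by
    intro h hh s hs k hk
    have hms : MeasurableSet {q : ℝ × X | ENNReal.ofReal q.1 < h q.2} :=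
      measurableSet_lt (ENNReal.measurable_ofReal.comp measurable_fst) (hh.comp measurable_snd)
    have e1 : ∀ z, h z ^ s * k z = ENNReal.ofReal s * ∫⁻ l in Set.Ioi (0 : ℝ),
        {q : ℝ × X | ENNReal.ofReal q.1 < h q.2}.indicator
          (fun q => ENNReal.ofReal q.1 ^ (s - 1) * k q.2) (l, z) := by
      intro z
      have := lintegral_indicator_lt_rpow hs (h z)
      have e2 : h z ^ s = ENNReal.ofReal s * ∫⁻ l in Set.Ioi (0 : ℝ),
          {l : ℝ | ENNReal.ofReal l < h z}.indicator (fun l => ENNReal.ofReal l ^ (s - 1)) l := by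
        rw [this, ENNReal.mul_div_cancel (by simpa using hs) ENNReal.ofReal_ne_top]
      rw [e2, mul_assoc, ← lintegral_mul_const]
      · congr 1
        refine lintegral_congr fun l => ?_
        by_cases hl : ENNReal.ofReal l < h z
        · rw [Set.indicator_of_mem (by simpa using hl), Set.indicator_of_mem (by simpa using hl)]
        · rw [Set.indicator_of_notMem (by simpa using hl),
            Set.indicator_of_notMem (by simpa using hl), zero_mul]
      · refine Measurable.indicator (by fun_prop) ?_
        exact measurableSet_lt ENNReal.measurable_ofReal measurable_const
    have hmeas : Measurable ({q : ℝ × X | ENNReal.ofReal q.1 < h q.2}.indicator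
          (fun q => ENNReal.ofReal q.1 ^ (s - 1) * k q.2)) := by
      refine Measurable.indicator ?_ hms
      fun_prop
    simp_rw [e1]
    rw [lintegral_const_mul _ (hmeas.lintegral_prod_left'),
      lintegral_lintegral_swap (f := fun z l => {q : ℝ × X | ENNReal.ofReal q.1 < h q.2}.indicator
          (fun q => ENNReal.ofReal q.1 ^ (s - 1) * k q.2) (l, z))
        (hmeas.comp measurable_swap).aemeasurable]
    congr 1
    refine lintegral_congr fun l => ?_
    have hml : MeasurableSet {z | ENNReal.ofReal l < h z} := measurableSet_lt measurable_const hh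
    rw [← lintegral_const_mul _ hk, ← lintegral_indicator hml]
    rfl
  -- Marcinkiewicz truncation: f ≤ f 1_{f > l} + l, so Mf > 2l forces M(f 1_{f > l}) > l, and the
  -- weak type bound applies to the truncated function.
  have hweak : ∀ l : ℝ, 0 < l → ENNReal.ofReal l *
      μ {z | ENNReal.ofReal l < maximalFn μ B f z / 2} ≤
        D * ∫⁻ z in {z | ENNReal.ofReal l < f z}, f z ∂μ := by
    intro l hl
    have hml : MeasurableSet {z | ENNReal.ofReal l < f z} := measurableSet_lt measurable_const hf
    rw [← lintegral_indicator hml]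
    refine le_trans ?_ (mul_meas_lt_maximalFn_le hB hD0 hD (ENNReal.ofReal l))
    refine mul_le_mul' le_rfl (measure_mono fun z hz => ?_)
    rw [Set.mem_ofPred_eq, ENNReal.lt_div_iff_mul_lt (by simp) (by simp)] at hz
    have := maximalFn_add_le (μ := μ) (B := B) (g := f) (ENNReal.ofReal l) (hf.indicator hml)
      (fun z => by
        by_cases h : ENNReal.ofReal l < f z
        · rw [Set.indicator_of_mem (by simpa using h)]; exact le_self_add
        · rw [Set.indicator_of_notMem (by simpa using h), zero_add]; exact not_lt.1 h) z
    rw [Set.mem_ofPred_eq]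
    by_contra! hcon
    refine absurd (hz.trans_le (this.trans (add_le_add_left hcon _))) ?_
    rw [mul_two]
    exact lt_irrefl _
  have h1 := layer (hMm.div_const 2) hp0 (fun _ => 1) measurable_const
  have h2 := layer hf hp1 f hf
  simp only [mul_one, setLIntegral_one] at h1
  calc ∫⁻ z, maximalFn μ B f z ^ p ∂μ
      = 2 ^ p * ∫⁻ z, (maximalFn μ B f z / 2) ^ p ∂μ := by
        rw [← lintegral_const_mul _ ((hMm.div_const 2).pow_const p)]
        refine lintegral_congr fun z => ?_
        rw [← ENNReal.mul_rpow_of_nonneg _ _ hp0.le, ENNReal.mul_div_cancel (by simp) (by simp)]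
    _ = 2 ^ p * (ENNReal.ofReal p * ∫⁻ l in Set.Ioi (0 : ℝ), ENNReal.ofReal l ^ (p - 1) *
          μ {z | ENNReal.ofReal l < maximalFn μ B f z / 2}) := by rw [h1]
    _ ≤ 2 ^ p * (ENNReal.ofReal p * ∫⁻ l in Set.Ioi (0 : ℝ), D * (ENNReal.ofReal l ^ (p - 1 - 1) *
          ∫⁻ z in {z | ENNReal.ofReal l < f z}, f z ∂μ)) := by
        gcongr 2 ^ p * (ENNReal.ofReal p * ?_)
        refine setLIntegral_mono' measurableSet_Ioi fun l hl => ?_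
        have hl : 0 < l := hl
        have e : ENNReal.ofReal l ^ (p - 1) = ENNReal.ofReal l ^ (p - 1 - 1) * ENNReal.ofReal l := by
          conv_lhs => rw [show p - 1 = p - 1 - 1 + 1 by ring]
          rw [ENNReal.rpow_add _ _ (by simpa using hl) ENNReal.ofReal_ne_top, ENNReal.rpow_one]
        rw [e, mul_assoc, mul_left_comm D]
        exact mul_le_mul' le_rfl (hweak l hl)
    _ = 2 ^ p * ENNReal.ofReal (p / (p - 1)) * D * ∫⁻ z, f z ^ p ∂μ := by
        have hm : Measurable fun l : ℝ => ENNReal.ofReal l ^ (p - 1 - 1) *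
            ∫⁻ z in {z | ENNReal.ofReal l < f z}, f z ∂μ := by
          refine Measurable.mul (by fun_prop) ?_
          have hanti : Antitone fun l : ℝ => ∫⁻ z in {z | ENNReal.ofReal l < f z}, f z ∂μ := by
            intro a b hab
            refine lintegral_mono_set fun z hz => ?_
            exact lt_of_le_of_lt (ENNReal.ofReal_le_ofReal hab) hz
          exact hanti.measurable
        have e3 : ∫⁻ z, f z ^ p ∂μ = ∫⁻ z, f z ^ (p - 1) * f z ∂μ := by
          refine lintegral_congr fun z => ?_
          conv_lhs => rw [show p = p - 1 + 1 by ring, ENNReal.rpow_add_of_nonneg _ _ hp1.le zero_le_one,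
            ENNReal.rpow_one]
        rw [lintegral_const_mul _ hm, e3, h2, ENNReal.ofReal_div_of_pos hp1]
        have : ENNReal.ofReal p / ENNReal.ofReal (p - 1) * ENNReal.ofReal (p - 1) =
            ENNReal.ofReal p := ENNReal.div_mul_cancel (by simpa using hp1) ENNReal.ofReal_ne_top
        conv_lhs => rw [← this]
        simp only [mul_assoc, mul_left_comm _ D]

end Maximal

/-! ### Dyadic time intervals and parabolic cylinders. -/

theorem ball_subset_ball_of_inter {E : Type*} [PseudoMetricSpace E] {b : ℝ} (hb : 2 ≤ b) {z w : E}
    {k l : ℤ} (hkl : k ≤ l) (h : (Metric.ball z (b ^ k) ∩ Metric.ball w (b ^ l)).Nonempty) :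
    Metric.ball z (b ^ k) ⊆ Metric.ball w (b ^ (l + 3)) := by
  obtain ⟨y, hyz, hyw⟩ := h
  intro x hx
  rw [Metric.mem_ball] at *
  have h0 : 0 < b := by linarith
  have h1 : b ^ k ≤ b ^ l := zpow_le_zpow_right₀ (by linarith) hkl
  have h2 : b ^ (l + 3) = b ^ l * b ^ 3 := by rw [zpow_add₀ h0.ne']; norm_cast
  have h4 : 0 < b ^ l := by positivity
  have h5 : b ^ l * 2 ^ 3 ≤ b ^ l * b ^ 3 := by gcongr
  have := dist_triangle x z w
  have := dist_triangle_left z w y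
  linarith

theorem measurableSet_mem_ball {E : Type*} [PseudoMetricSpace E] [MeasurableSpace E]
    [OpensMeasurableSpace E] [SecondCountableTopology E] (r : ℝ) :
    MeasurableSet {p : E × E | p.2 ∈ Metric.ball p.1 r} := by
  simp only [Metric.mem_ball]
  exact measurableSet_lt (measurable_snd.dist measurable_fst) measurable_const

/-- The intervals `(t - 4 ^ k, t + 4 ^ k)`. -/
def timeBall (t : ℝ) (k : ℤ) : Set ℝ := Metric.ball t (4 ^ k)

/-- The two-sided parabolic cylinders of radius `2 ^ k`. -/
def parBall {d : ℕ} (z : SpaceTime d) (k : ℤ) : Set (SpaceTime d) :=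
  timeBall z.1 k ×ˢ Metric.ball z.2 (2 ^ k)

theorem isBallSystem_timeBall : IsBallSystem timeBall where
  mem z k := Metric.mem_ball_self (by positivity)
  engulf z w k l hkl h := ball_subset_ball_of_inter (by norm_num) hkl h
  measurable k := measurableSet_mem_ball _

variable {d : ℕ}

theorem isBallSystem_parBall : IsBallSystem (parBall (d := d)) where
  mem z k := ⟨Metric.mem_ball_self (by positivity), Metric.mem_ball_self (by positivity)⟩
  engulf z w k l hkl h := by
    obtain ⟨y, ⟨h1, h2⟩, h3, h4⟩ := h
    exact Set.prod_mono (ball_subset_ball_of_inter (by norm_num) hkl ⟨y.1, h1, h3⟩)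
      (ball_subset_ball_of_inter (by norm_num) hkl ⟨y.2, h2, h4⟩)
  measurable k := by
    have h1 := measurableSet_mem_ball (E := ℝ) ((4 : ℝ) ^ k)
    have h2 := measurableSet_mem_ball (E := EuclideanSpace ℝ (Fin d)) ((2 : ℝ) ^ k)
    have m1 : Measurable fun p : SpaceTime d × SpaceTime d => (p.1.1, p.2.1) := by fun_prop
    have m2 : Measurable fun p : SpaceTime d × SpaceTime d => (p.1.2, p.2.2) := by fun_prop
    exact (m1 h1).inter (m2 h2)

theorem volume_timeBall (t : ℝ) (k : ℤ) : volume (timeBall t k) = ENNReal.ofReal (2 * 4 ^ k) :=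
  Real.volume_ball _ _

theorem volume_timeBall_add (t : ℝ) (k : ℤ) (n : ℕ) :
    volume (timeBall t (k + n)) = 4 ^ n * volume (timeBall t k) := by
  rw [volume_timeBall, volume_timeBall, zpow_add₀ (by norm_num), zpow_natCast,
    show (2 : ℝ) * (4 ^ k * 4 ^ n) = 4 ^ n * (2 * 4 ^ k) by ring,
    ENNReal.ofReal_mul (by positivity), ENNReal.ofReal_pow (by norm_num)]
  norm_num

theorem volume_spaceBall (x : EuclideanSpace ℝ (Fin d)) {r : ℝ} (hr : 0 < r) :
    volume (Metric.ball x r) =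
      ENNReal.ofReal (r ^ d) * volume (Metric.ball (0 : EuclideanSpace ℝ (Fin d)) 1) := by
  rw [Measure.addHaar_ball_of_pos volume x hr, finrank_euclideanSpace_fin]

theorem volume_spaceBall_add (x : EuclideanSpace ℝ (Fin d)) (k : ℤ) (n : ℕ) :
    volume (Metric.ball x ((2 : ℝ) ^ (k + n))) = 2 ^ (n * d) * volume (Metric.ball x ((2 : ℝ) ^ k)) := by
  rw [volume_spaceBall x (by positivity), volume_spaceBall x (by positivity), ← mul_assoc]
  congr 1
  rw [zpow_add₀ (by norm_num), zpow_natCast, mul_pow, mul_comm, ← pow_mul,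
    ENNReal.ofReal_mul (by positivity), ENNReal.ofReal_pow (by norm_num)]
  norm_num

theorem volume_parBall (z : SpaceTime d) (k : ℤ) :
    volume (parBall z k) = volume (timeBall z.1 k) * volume (Metric.ball z.2 ((2 : ℝ) ^ k)) := by
  rw [parBall, Measure.volume_eq_prod, Measure.prod_prod]

theorem volume_parBall_add (z : SpaceTime d) (k : ℤ) (n : ℕ) :
    volume (parBall z (k + n)) = 2 ^ (n * (d + 2)) * volume (parBall z k) := by
  rw [volume_parBall, volume_parBall, volume_timeBall_add, volume_spaceBall_add,
    mul_mul_mul_comm]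
  congr 1
  rw [mul_add, pow_add, mul_comm n 2, pow_mul 2 2 n, mul_comm]
  norm_num

theorem volume_parBall_eq (z w : SpaceTime d) (k : ℤ) :
    volume (parBall z k) = volume (parBall w k) := by
  rw [volume_parBall, volume_parBall, volume_timeBall, volume_timeBall,
    volume_spaceBall z.2 (by positivity), volume_spaceBall w.2 (by positivity)]

theorem volume_parBall_ne_zero (z : SpaceTime d) (k : ℤ) : volume (parBall z k) ≠ 0 := by
  rw [volume_parBall, volume_timeBall]
  exact mul_ne_zero (by simp; positivity) (Metric.measure_ball_pos _ _ (by positivity)).ne'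

theorem volume_parBall_ne_top (z : SpaceTime d) (k : ℤ) : volume (parBall z k) ≠ ⊤ := by
  rw [volume_parBall, volume_timeBall]
  exact ENNReal.mul_ne_top ENNReal.ofReal_ne_top measure_ball_lt_top.ne

/-! ### A₁ weights in time and weighted maximal inequalities. -/

/-- The Muckenhoupt `A₁` condition on a weight of the time variable. -/
def IsA1 (K : ℝ≥0∞) (v : ℝ → ℝ≥0∞) : Prop := ∀ t, maximalFn volume timeBall v t ≤ K * v t

/-- The measure `v(t) dt dx`. -/
def timeWeighted (d : ℕ) (v : ℝ → ℝ≥0∞) : Measure (SpaceTime d) :=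
  volume.withDensity fun z => v z.1

instance (v : ℝ → ℝ≥0∞) : SFinite (timeWeighted d v) := by unfold timeWeighted; infer_instance

variable {v : ℝ → ℝ≥0∞} {K : ℝ≥0∞}

theorem measurable_comp_time (hv : Measurable v) : Measurable fun z : SpaceTime d => v z.1 :=
  hv.comp measurable_fst

theorem lintegral_timeWeighted (hv : Measurable v) {f : SpaceTime d → ℝ≥0∞} (hf : Measurable f) :
    ∫⁻ z, f z ∂(timeWeighted d v) = ∫⁻ z, v z.1 * f z := by
  rw [timeWeighted, lintegral_withDensity_eq_lintegral_mul _ (measurable_comp_time hv) hf]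
  rfl

theorem setLIntegral_timeWeighted (hv : Measurable v) {f : SpaceTime d → ℝ≥0∞} (hf : Measurable f)
    {s : Set (SpaceTime d)} (hs : MeasurableSet s) :
    ∫⁻ z in s, f z ∂(timeWeighted d v) = ∫⁻ z in s, v z.1 * f z := by
  rw [timeWeighted, setLIntegral_withDensity_eq_setLIntegral_mul _ (measurable_comp_time hv) hf hs]
  rfl

theorem timeWeighted_apply {s : Set (SpaceTime d)} (hs : MeasurableSet s) :
    timeWeighted d v s = ∫⁻ z in s, v z.1 := by
  rw [timeWeighted, withDensity_apply _ hs]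

/-- The weight depends on time only, so the spatial factor splits off and the A₁ condition is
applied at the centre of the time interval. -/
theorem timeWeighted_parBall_le (hv : Measurable v) (h : IsA1 K v) (z : SpaceTime d) (k : ℤ) :
    timeWeighted d v (parBall z k) ≤ K * v z.1 * volume (parBall z k) := by
  have h1 : timeWeighted d v (parBall z k) =
      (∫⁻ t in timeBall z.1 k, v t) * volume (Metric.ball z.2 ((2 : ℝ) ^ k)) := by
    rw [timeWeighted_apply (isBallSystem_parBall.measurableSet z k), parBall,
      Measure.volume_eq_prod, ← Measure.prod_restrict,
      lintegral_prod _ (measurable_comp_time hv).aemeasurable]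
    simp only [lintegral_const, Measure.restrict_apply_univ]
    rw [lintegral_mul_const _ hv]
  have h2 : (∫⁻ t in timeBall z.1 k, v t) ≤ K * v z.1 * volume (timeBall z.1 k) := by
    have h3 := (lavg_le_maximalFn (μ := volume) (f := v) (B := timeBall) z.1 k).trans (h z.1)
    have h0 : volume (timeBall z.1 k) ≠ 0 := by rw [volume_timeBall]; simp; positivity
    have ht : volume (timeBall z.1 k) ≠ ⊤ := by rw [volume_timeBall]; exact ENNReal.ofReal_ne_top
    rw [lavg, mul_comm, ← div_eq_mul_inv] at h3
    exact (ENNReal.div_le_iff h0 ht).1 h3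
  rw [h1, volume_parBall, ← mul_assoc]
  gcongr

theorem parBall_subset {z w : SpaceTime d} {k : ℤ} (h : w ∈ parBall z k) :
    parBall z (k + 3) ⊆ parBall w (k + 4) := by
  have aux : ∀ {E : Type} [PseudoMetricSpace E] {b : ℝ} (_ : 2 ≤ b) {z w : E}
      (_ : w ∈ Metric.ball z (b ^ k)), Metric.ball z (b ^ (k + 3)) ⊆ Metric.ball w (b ^ (k + 4)) := by
    intro E _ b hb z w hw x hx
    rw [Metric.mem_ball] at *
    have h0 : 0 < b := by linarith
    have h1 : b ^ (k + 4) = b ^ (k + 3) * b := by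
      rw [← zpow_add_one₀ h0.ne']; congr 1; ring
    have h2 : b ^ k ≤ b ^ (k + 3) := zpow_le_zpow_right₀ (by linarith) (by linarith)
    have h3 : b ^ (k + 3) * 2 ≤ b ^ (k + 3) * b := by gcongr
    have := dist_triangle x z w
    rw [dist_comm w z] at hw
    linarith
  exact Set.prod_mono (aux (by norm_num) h.1) (aux (by norm_num) h.2)

/-- Centred averages suffice for a bound by v at any point w of the ball: recentring at w costs one
further level, that is, a fixed power of 2 in volume. -/
theorem timeWeighted_parBall_le_of_mem (hv : Measurable v) (h : IsA1 K v) {z w : SpaceTime d} {k : ℤ}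
    (hw : w ∈ parBall z k) :
    timeWeighted d v (parBall z (k + 3)) ≤
      K * 2 ^ (4 * (d + 2)) * volume (parBall z k) * v w.1 := by
  refine (measure_mono (parBall_subset hw)).trans ((timeWeighted_parBall_le hv h w (k + 4)).trans ?_)
  have := volume_parBall_add w k 4
  rw [Nat.cast_ofNat] at this
  rw [this, volume_parBall_eq w z]
  exact le_of_eq (by ring)

/-- Integrating the pointwise bound by v(w) over w in the smaller ball turns its right side into the
weighted measure of that ball. -/
theorem timeWeighted_doubling (hv : Measurable v) (h : IsA1 K v) (z : SpaceTime d) (k : ℤ) :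
    timeWeighted d v (parBall z (k + 3)) ≤
      (K * 2 ^ (4 * (d + 2))) * timeWeighted d v (parBall z k) := by
  have hm := (isBallSystem_parBall (d := d)).measurableSet z k
  have h1 : volume (parBall z k) * timeWeighted d v (parBall z (k + 3)) ≤
      volume (parBall z k) * (K * 2 ^ (4 * (d + 2)) * timeWeighted d v (parBall z k)) := by
    calc volume (parBall z k) * timeWeighted d v (parBall z (k + 3))
        = ∫⁻ _ in parBall z k, timeWeighted d v (parBall z (k + 3)) := by
          rw [setLIntegral_const, mul_comm]
      _ ≤ ∫⁻ w in parBall z k, K * 2 ^ (4 * (d + 2)) * volume (parBall z k) * v w.1 :=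
          setLIntegral_mono' hm fun w hw => timeWeighted_parBall_le_of_mem hv h hw
      _ = _ := by
          rw [lintegral_const_mul _ (measurable_comp_time hv), timeWeighted_apply hm]
          ring
  exact (ENNReal.mul_le_mul_iff_right (volume_parBall_ne_zero z k) (volume_parBall_ne_top z k)).1 h1

/-- The parabolic maximal function. -/
abbrev parMax (f : SpaceTime d → ℝ≥0∞) : SpaceTime d → ℝ≥0∞ := maximalFn volume parBall f

theorem measurable_parMax {f : SpaceTime d → ℝ≥0∞} (hf : Measurable f) : Measurable (parMax f) :=
  measurable_maximalFn isBallSystem_parBall hf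

/-- The constant in the weighted maximal inequalities. -/
def weightedConst (d : ℕ) (p : ℝ) (K : ℝ≥0∞) : ℝ≥0∞ :=
  (K * 2 ^ (4 * (d + 2))) ^ p * (2 ^ p * ENNReal.ofReal (p / (p - 1)) * (K * 2 ^ (4 * (d + 2))))

theorem weightedConst_ne_top {p : ℝ} (hp : 1 < p) (hK : K ≠ ⊤) : weightedConst d p K ≠ ⊤ := by
  unfold weightedConst
  have h1 : (K * 2 ^ (4 * (d + 2))) ≠ ⊤ := ENNReal.mul_ne_top hK (by simp)
  have hp0 : 0 ≤ p := by linarith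
  refine ENNReal.mul_ne_top (ENNReal.rpow_ne_top_of_nonneg hp0 h1) (ENNReal.mul_ne_top
    (ENNReal.mul_ne_top (ENNReal.rpow_ne_top_of_nonneg hp0 (by simp)) ENNReal.ofReal_ne_top) h1)

/-- The A₁ inequality is imposed at every point, so one zero of v annihilates the averages over all
intervals centred there, and these exhaust the line. -/
theorem IsA1.pos_or_ae_eq_zero (hv : Measurable v) (h : IsA1 K v) :
    (∀ t, v t ≠ 0) ∨ v =ᵐ[volume] 0 := by
  by_cases h0 : ∀ t, v t ≠ 0
  · exact Or.inl h0
  right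
  push Not at h0
  obtain ⟨t, ht⟩ := h0
  have h1 : ∀ k : ℕ, ∫⁻ s in timeBall t k, v s = 0 := by
    intro k
    have h3 := (lavg_le_maximalFn (μ := volume) (f := v) (B := timeBall) t k).trans (h t)
    rw [ht, mul_zero, nonpos_iff_eq_zero, lavg, mul_eq_zero, ENNReal.inv_eq_zero,
      volume_timeBall] at h3
    exact h3.resolve_left ENNReal.ofReal_ne_top
  have h2 : ∀ k : ℕ, v =ᵐ[volume.restrict (timeBall t k)] 0 := fun k =>
    (lintegral_eq_zero_iff hv).1 (h1 k)
  have h3 : ⋃ k : ℕ, timeBall t k = Set.univ := by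
    refine Set.eq_univ_of_forall fun s => ?_
    obtain ⟨k, hk⟩ := pow_unbounded_of_one_lt (dist s t) (show (1 : ℝ) < 4 by norm_num)
    exact Set.mem_iUnion.2 ⟨k, by simpa [timeBall] using hk⟩
  have h4 := ae_restrict_iUnion_iff (μ := (volume : Measure ℝ)) (fun k : ℕ => timeBall t k) (fun s => v s = 0)
  rw [h3, Measure.restrict_univ] at h4
  exact h4.2 h2

theorem timeWeighted_parBall_ne_top (hv : Measurable v) (hvt : ∀ t, v t ≠ ⊤) (hKt : K ≠ ⊤)
    (h : IsA1 K v) (z : SpaceTime d) (k : ℤ) : timeWeighted d v (parBall z k) ≠ ⊤ :=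
  ne_top_of_le_ne_top (ENNReal.mul_ne_top (ENNReal.mul_ne_top hKt (hvt _))
    (volume_parBall_ne_top z k)) (timeWeighted_parBall_le hv h z k)

theorem timeWeighted_parBall_ne_zero (hv : Measurable v) (hpos : ∀ t, v t ≠ 0)
    (z : SpaceTime d) (k : ℤ) : timeWeighted d v (parBall z k) ≠ 0 := by
  rw [timeWeighted_apply (isBallSystem_parBall.measurableSet z k)]
  intro h0
  rw [lintegral_eq_zero_iff (measurable_comp_time hv)] at h0
  have : ∀ᵐ z ∂(volume.restrict (parBall z k)), False := by
    filter_upwards [h0] with w hw using hpos _ hw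
  rw [Filter.eventually_false_iff_eq_bot, ae_eq_bot, Measure.restrict_eq_zero] at this
  exact volume_parBall_ne_zero z k this

/-- The strong type inequality for the doubling measure v dt dx. The extra factor on the left is the
p-th power of the constant that compares `parMax` with the weighted maximal function, so that both
comparisons below end with the same constant. -/
theorem lintegral_maximalFn_timeWeighted_rpow_le (hv : Measurable v) (h : IsA1 K v) (hK : 1 ≤ K)
    {p : ℝ} (hp : 1 < p) {f : SpaceTime d → ℝ≥0∞} (hf : Measurable f) :
    (K * 2 ^ (4 * (d + 2))) ^ p * ∫⁻ z, v z.1 * maximalFn (timeWeighted d v) parBall f z ^ p ≤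
      weightedConst d p K * ∫⁻ z, v z.1 * f z ^ p := by
  have hC0 : K * 2 ^ (4 * (d + 2)) ≠ 0 :=
    mul_ne_zero (ne_of_gt (lt_of_lt_of_le zero_lt_one hK)) (by simp)
  have h1 := lintegral_maximalFn_rpow_le (μ := timeWeighted d v) isBallSystem_parBall hC0
    (timeWeighted_doubling hv h) hp hf
  rw [lintegral_timeWeighted hv (hf.pow_const p), lintegral_timeWeighted hv
    ((measurable_maximalFn isBallSystem_parBall hf).pow_const p)] at h1
  unfold weightedConst
  rw [mul_assoc ((K * 2 ^ (4 * (d + 2))) ^ p)]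
  gcongr

/-- The maximal function is bounded on `L_p(v)` for an `A₁` weight `v`. -/
theorem lintegral_parMax_rpow_mul_le (hv : Measurable v) (hvt : ∀ t, v t ≠ ⊤) (h : IsA1 K v)
    (hK : 1 ≤ K) (hKt : K ≠ ⊤) {p : ℝ} (hp : 1 < p) {f : SpaceTime d → ℝ≥0∞} (hf : Measurable f) :
    ∫⁻ z, v z.1 * parMax f z ^ p ≤ weightedConst d p K * ∫⁻ z, v z.1 * f z ^ p := by
  have hp0 : 0 ≤ p := by linarith
  rcases h.pos_or_ae_eq_zero hv with hpos | hzero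
  -- Lebesgue averages are dominated by weighted ones: v(B) ≤ C |B| v(w) for every w in B, and this
  -- may be integrated against f.
  · have hle : ∀ z, parMax f z ≤
        K * 2 ^ (4 * (d + 2)) * maximalFn (timeWeighted d v) parBall f z := by
      intro z
      refine iSup_le fun k => ?_
      refine le_trans ?_ (mul_le_mul' le_rfl (lavg_le_maximalFn (μ := timeWeighted d v) (f := f) z k))
      have hm := (isBallSystem_parBall (d := d)).measurableSet z k
      have hsub : timeWeighted d v (parBall z k) ≤ timeWeighted d v (parBall z (k + 3)) :=
        measure_mono (isBallSystem_parBall.engulf z z k k le_rfl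
          ⟨z, isBallSystem_parBall.mem z k, isBallSystem_parBall.mem z k⟩)
      have ht := timeWeighted_parBall_ne_top hv hvt hKt h z k
      have h0 := timeWeighted_parBall_ne_zero hv hpos z k
      have key : timeWeighted d v (parBall z k) * ∫⁻ w in parBall z k, f w ≤
          K * 2 ^ (4 * (d + 2)) * volume (parBall z k) *
            ∫⁻ w in parBall z k, f w ∂(timeWeighted d v) := by
        rw [setLIntegral_timeWeighted hv hf hm, ← lintegral_const_mul _ hf,
          ← lintegral_const_mul _ (f := fun w => v w.1 * f w) ((measurable_comp_time hv).mul hf)]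
        refine setLIntegral_mono' hm fun w hw => ?_
        rw [← mul_assoc]
        gcongr
        exact hsub.trans (timeWeighted_parBall_le_of_mem hv h hw)
      have hV0 := volume_parBall_ne_zero z k
      have hVt := volume_parBall_ne_top z k
      unfold lavg
      set m := timeWeighted d v (parBall z k)
      set V := volume (parBall z k)
      set C := K * 2 ^ (4 * (d + 2))
      set J := ∫⁻ w in parBall z k, f w ∂(timeWeighted d v)
      calc V⁻¹ * ∫⁻ w in parBall z k, f w
          = V⁻¹ * (m⁻¹ * (m * ∫⁻ w in parBall z k, f w)) := by
            rw [← mul_assoc m⁻¹, ENNReal.inv_mul_cancel h0 ht, one_mul]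
        _ ≤ V⁻¹ * (m⁻¹ * (C * V * J)) := by gcongr
        _ = V⁻¹ * V * (C * (m⁻¹ * J)) := by ring
        _ = C * (m⁻¹ * J) := by rw [ENNReal.inv_mul_cancel hV0 hVt, one_mul]
    refine le_trans ?_ (lintegral_maximalFn_timeWeighted_rpow_le hv h hK hp hf)
    have hmeas : Measurable fun z => v z.1 * maximalFn (timeWeighted d v) parBall f z ^ p :=
      (measurable_comp_time hv).mul ((measurable_maximalFn isBallSystem_parBall hf).pow_const p)
    rw [← lintegral_const_mul _ hmeas]
    refine lintegral_mono fun z => ?_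
    rw [mul_left_comm, ← ENNReal.mul_rpow_of_nonneg _ _ hp0]
    exact mul_le_mul' le_rfl (ENNReal.rpow_le_rpow (hle z) hp0)
  · have h1 : ∀ᵐ z : SpaceTime d, v z.1 = 0 := by
      rw [Measure.volume_eq_prod]
      exact Measure.quasiMeasurePreserving_fst.ae hzero
    have h2 : ∫⁻ z : SpaceTime d, v z.1 * parMax f z ^ p = 0 := by
      rw [lintegral_congr_ae (g := fun _ => 0), lintegral_zero]
      filter_upwards [h1] with z hz
      rw [hz, zero_mul]
    rw [h2]
    exact zero_le

/-- The maximal function is bounded on `L_p(v ^ (1 - p))` for an `A₁` weight `v`. -/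
theorem lintegral_parMax_rpow_mul_rpow_le (hv : Measurable v) (hvt : ∀ t, v t ≠ ⊤)
    (hv0 : ∀ t, v t ≠ 0) (h : IsA1 K v) (hK : 1 ≤ K) (hKt : K ≠ ⊤) {p : ℝ} (hp : 1 < p)
    {f : SpaceTime d → ℝ≥0∞} (hf : Measurable f) :
    ∫⁻ z, v z.1 ^ (1 - p) * parMax f z ^ p ≤
      weightedConst d p K * ∫⁻ z, v z.1 ^ (1 - p) * f z ^ p := by
  have hp0 : 0 ≤ p := by linarith
  have hvz := measurable_comp_time (d := d) hv
  have hg : Measurable fun z => f z / v z.1 := hf.div hvz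
  have hfg : ∀ z, v z.1 * (f z / v z.1) = f z := fun z => ENNReal.mul_div_cancel (hv0 _) (hvt _)
  -- Here f dz is written as (f / v) v dz, and the A₁ condition is needed only at the centre: v(B) ≤
  -- K |B| v(z).
  have hle : ∀ z, parMax f z ≤ K * 2 ^ (4 * (d + 2)) * (v z.1 *
      maximalFn (timeWeighted d v) parBall (fun z => f z / v z.1) z) := by
    intro z
    refine iSup_le fun k => ?_
    refine le_trans ?_ (mul_le_mul' le_rfl (mul_le_mul' le_rfl
      (lavg_le_maximalFn (μ := timeWeighted d v) (f := fun z => f z / v z.1) z k)))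
    have hm := (isBallSystem_parBall (d := d)).measurableSet z k
    have h1 : ∫⁻ w in parBall z k, f w =
        ∫⁻ w in parBall z k, f w / v w.1 ∂(timeWeighted d v) := by
      rw [setLIntegral_timeWeighted hv hg hm]
      simp_rw [hfg]
    have h2 : timeWeighted d v (parBall z k) ≤
        K * 2 ^ (4 * (d + 2)) * v z.1 * volume (parBall z k) := by
      refine (timeWeighted_parBall_le hv h z k).trans ?_
      gcongr
      exact le_mul_of_one_le_right' (one_le_pow₀ one_le_two)
    have hV0 := volume_parBall_ne_zero z k
    have hVt := volume_parBall_ne_top z k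
    have ht := timeWeighted_parBall_ne_top hv hvt hKt h z k
    have h0 := timeWeighted_parBall_ne_zero hv hv0 z k
    unfold lavg
    rw [h1]
    set m := timeWeighted d v (parBall z k)
    set V := volume (parBall z k)
    set C := K * 2 ^ (4 * (d + 2))
    set J := ∫⁻ w in parBall z k, f w / v w.1 ∂(timeWeighted d v)
    calc V⁻¹ * J = V⁻¹ * (m * (m⁻¹ * J)) := by
          rw [← mul_assoc m, ENNReal.mul_inv_cancel h0 ht, one_mul]
      _ ≤ V⁻¹ * (C * v z.1 * V * (m⁻¹ * J)) := by gcongr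
      _ = V⁻¹ * V * (C * (v z.1 * (m⁻¹ * J))) := by ring
      _ = C * (v z.1 * (m⁻¹ * J)) := by rw [ENNReal.inv_mul_cancel hV0 hVt, one_mul]
  -- The weight v^{1-p} absorbs the factor v^p from the comparison and leaves the measure v dt dx,
  -- on which the strong type bound acts.
  have hpow : ∀ t, v t ^ (1 - p) * v t ^ p = v t := fun t => by
    rw [← ENNReal.rpow_add _ _ (hv0 t) (hvt t), sub_add_cancel, ENNReal.rpow_one]
  have h3 := lintegral_maximalFn_timeWeighted_rpow_le hv h hK hp hg
  have h4 : ∀ z : SpaceTime d, v z.1 * (f z / v z.1) ^ p = v z.1 ^ (1 - p) * f z ^ p := by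
    intro z
    conv_rhs => rw [← hfg z, ENNReal.mul_rpow_of_nonneg _ _ hp0, ← mul_assoc, hpow]
  simp_rw [h4] at h3
  refine le_trans ?_ h3
  have hmeas : Measurable fun z => v z.1 *
      maximalFn (timeWeighted d v) parBall (fun z => f z / v z.1) z ^ p :=
    hvz.mul ((measurable_maximalFn isBallSystem_parBall hg).pow_const p)
  rw [← lintegral_const_mul _ hmeas]
  refine lintegral_mono fun z => ?_
  calc v z.1 ^ (1 - p) * parMax f z ^ p
      ≤ v z.1 ^ (1 - p) * (K * 2 ^ (4 * (d + 2)) * (v z.1 *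
          maximalFn (timeWeighted d v) parBall (fun z => f z / v z.1) z)) ^ p := by
        gcongr
        exact hle z
    _ = (K * 2 ^ (4 * (d + 2))) ^ p * (v z.1 ^ (1 - p) * v z.1 ^ p *
          maximalFn (timeWeighted d v) parBall (fun z => f z / v z.1) z ^ p) := by
        rw [ENNReal.mul_rpow_of_nonneg (_ * _) _ hp0, ENNReal.mul_rpow_of_nonneg (v z.1) _ hp0,
          mul_left_comm, mul_assoc (v z.1 ^ (1 - p))]
    _ = _ := by rw [hpow]

/-! ### The Rubio de Francia algorithm. -/

/-- Jensen's inequality for the probability measure on ℕ with masses c k, obtained from Hölder's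
inequality against the constant 1. -/
theorem rpow_tsum_mul_le {c g : ℕ → ℝ≥0∞} (hc : ∑' k, c k = 1) {s : ℝ} (hs : 1 ≤ s) :
    (∑' k, c k * g k) ^ s ≤ ∑' k, c k * g k ^ s := by
  have hs0 : 0 < s := by linarith
  set μ : Measure ℕ := Measure.sum fun k => c k • Measure.dirac k
  have hint : ∀ h : ℕ → ℝ≥0∞, ∫⁻ k, h k ∂μ = ∑' k, c k * h k := by
    intro h
    rw [lintegral_sum_measure]
    simp [lintegral_smul_measure, lintegral_dirac]
  have h1 := ENNReal.lintegral_mul_norm_pow_le (μ := μ) (f := fun k => g k ^ s) (g := fun _ => 1)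
    (Measurable.of_discrete).aemeasurable (Measurable.of_discrete).aemeasurable
    (p := 1 / s) (q := 1 - 1 / s) (by positivity) (by rw [sub_nonneg, div_le_one hs0]; exact hs)
    (by ring)
  rw [hint, hint, hint] at h1
  simp only [ENNReal.one_rpow, mul_one, hc] at h1
  have h2 : ∀ k, (g k ^ s) ^ (1 / s) = g k := fun k => by
    rw [← ENNReal.rpow_mul, mul_one_div_cancel hs0.ne', ENNReal.rpow_one]
  simp_rw [h2] at h1
  calc _ ≤ ((∑' k, c k * g k ^ s) ^ (1 / s)) ^ s := ENNReal.rpow_le_rpow h1 hs0.le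
    _ = _ := by rw [← ENNReal.rpow_mul, one_div_mul_cancel hs0.ne', ENNReal.rpow_one]

theorem maximalFn_tsum_le {X : Type*} [MeasurableSpace X] {μ : Measure X} {B : X → ℤ → Set X}
    {f : ℕ → X → ℝ≥0∞} (hf : ∀ k, Measurable (f k)) (z : X) :
    maximalFn μ B (fun z => ∑' k, f k z) z ≤ ∑' k, maximalFn μ B (f k) z := by
  refine iSup_le fun j => ?_
  unfold lavg
  rw [lintegral_tsum fun k => (hf k).aemeasurable, ← ENNReal.tsum_mul_left]
  exact ENNReal.tsum_le_tsum fun k => lavg_le_maximalFn z j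

theorem maximalFn_const_mul_le {X : Type*} [MeasurableSpace X] {μ : Measure X} {B : X → ℤ → Set X}
    {f : X → ℝ≥0∞} (hf : Measurable f) (c : ℝ≥0∞) (z : X) :
    maximalFn μ B (fun z => c * f z) z ≤ c * maximalFn μ B f z := by
  refine iSup_le fun j => ?_
  unfold lavg
  rw [lintegral_const_mul _ hf, mul_left_comm]
  exact mul_le_mul' le_rfl (lavg_le_maximalFn z j)

/-- The Rubio de Francia algorithm: a bounded function is dominated by an `A₁` weight with
comparable `L_s` norm. -/
theorem exists_isA1_majorant {s : ℝ} (hs : 1 < s) :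
    ∃ K : ℝ≥0∞, 1 ≤ K ∧ K ≠ ⊤ ∧ ∀ φ : ℝ → ℝ≥0∞, Measurable φ →
      (∃ L : ℝ≥0∞, L ≠ ⊤ ∧ ∀ t, φ t ≤ L) → ∃ w : ℝ → ℝ≥0∞, Measurable w ∧ (∀ t, φ t ≤ w t) ∧
        (∀ t, w t ≠ ⊤) ∧ IsA1 K w ∧ ∫⁻ t, w t ^ s ≤ K * ∫⁻ t, φ t ^ s := by
  have hs0 : 0 < s := by linarith
  have hdoub : ∀ (t : ℝ) (k : ℤ), volume (timeBall t (k + 3)) ≤ 4 ^ 3 * volume (timeBall t k) :=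
    fun t k => (volume_timeBall_add t k 3).le
  set C : ℝ≥0∞ := 2 ^ s * ENNReal.ofReal (s / (s - 1)) * 4 ^ 3 with hC
  have hCt : C ≠ ⊤ := ENNReal.mul_ne_top (ENNReal.mul_ne_top
    (ENNReal.rpow_ne_top_of_nonneg hs0.le (by simp)) ENNReal.ofReal_ne_top) (by simp)
  -- C bounds the s-th power of the operator norm of M. Taking A ≥ 1 gives C ≤ A ≤ A^s, so A bounds
  -- the norm without extracting a root.
  set A : ℝ≥0∞ := max 1 C with hA
  have hA1 : 1 ≤ A := le_max_left _ _
  have hA0 : A ≠ 0 := (lt_of_lt_of_le zero_lt_one hA1).ne'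
  have hAt : A ≠ ⊤ := by simp [hA, hCt]
  have hCA : C ≤ A ^ s := (le_max_right 1 C).trans (ENNReal.le_rpow_self_of_one_le hA1 hs.le)
  have h2s : (1 : ℝ≥0∞) ≤ 2 ^ s := ENNReal.one_le_rpow one_le_two hs0
  -- One constant serves twice: 2A is needed for the A₁ condition and 2^s for the norm of w = 2W.
  refine ⟨2 * A * 2 ^ s, ?_, ?_, ?_⟩
  · calc (1 : ℝ≥0∞) = 1 * 1 * 1 := by simp
      _ ≤ 2 * A * 2 ^ s := by gcongr; exact one_le_two
  · exact ENNReal.mul_ne_top (ENNReal.mul_ne_top (by simp) hAt)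
      (ENNReal.rpow_ne_top_of_nonneg hs0.le (by simp))
  intro φ hφ ⟨L, hLt, hL⟩
  set M : (ℝ → ℝ≥0∞) → ℝ → ℝ≥0∞ := maximalFn volume timeBall with hM
  set it : ℕ → ℝ → ℝ≥0∞ := fun k => M^[k] φ with hit
  have it_succ : ∀ k, it (k + 1) = M (it k) := fun k => Function.iterate_succ_apply' M k φ
  have itm : ∀ k, Measurable (it k) := by
    intro k
    induction k with
    | zero => exact hφ
    | succ k ih => rw [it_succ]; exact measurable_maximalFn isBallSystem_timeBall ih
  have itL : ∀ k t, it k t ≤ L := by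
    intro k
    induction k with
    | zero => exact hL
    | succ k ih => intro t; rw [it_succ]; exact maximalFn_le_of_le ih t
  have itI : ∀ k, ∫⁻ t, it k t ^ s ≤ (A ^ s) ^ k * ∫⁻ t, φ t ^ s := by
    intro k
    induction k with
    | zero => simp [hit]
    | succ k ih =>
      rw [it_succ]
      calc _ ≤ C * ∫⁻ t, it k t ^ s :=
            lintegral_maximalFn_rpow_le isBallSystem_timeBall (by simp) hdoub hs (itm k)
        _ ≤ A ^ s * ((A ^ s) ^ k * ∫⁻ t, φ t ^ s) := by gcongr
        _ = _ := by rw [pow_succ]; ring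
  set c : ℕ → ℝ≥0∞ := fun k => 2⁻¹ ^ (k + 1) with hc
  have hc1 : ∑' k, c k = 1 := by
    rw [ENNReal.tsum_geometric_add_one, ENNReal.one_sub_inv_two, inv_inv,
      ENNReal.inv_mul_cancel (by simp) (by simp)]
  -- The series Σ 2^{-k-1} A^{-k} M^k φ: since M^k has norm at most A^k, W is a convex combination
  -- of functions whose L_s norms do not exceed that of φ.
  set W : ℝ → ℝ≥0∞ := fun t => ∑' k, c k * (A⁻¹ ^ k * it k t) with hW
  have hWm : Measurable W := Measurable.tsum fun k => ((itm k).const_mul _).const_mul _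
  have hWint : ∫⁻ t, W t ^ s ≤ ∫⁻ t, φ t ^ s := by
    calc ∫⁻ t, W t ^ s ≤ ∫⁻ t, ∑' k, c k * (A⁻¹ ^ k * it k t) ^ s :=
          lintegral_mono fun t => rpow_tsum_mul_le hc1 hs.le
      _ = ∑' k, c k * ((A⁻¹ ^ k) ^ s * ∫⁻ t, it k t ^ s) := by
          rw [lintegral_tsum fun k => ((((itm k).const_mul _).pow_const s).const_mul _).aemeasurable]
          congr 1; ext k
          rw [lintegral_const_mul _ (((itm k).const_mul _).pow_const s)]
          simp_rw [ENNReal.mul_rpow_of_nonneg _ _ hs0.le]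
          rw [lintegral_const_mul _ ((itm k).pow_const s)]
      _ ≤ ∑' k, c k * ∫⁻ t, φ t ^ s := by
          refine ENNReal.tsum_le_tsum fun k => mul_le_mul' le_rfl ?_
          calc (A⁻¹ ^ k) ^ s * ∫⁻ t, it k t ^ s
              ≤ (A⁻¹ ^ k) ^ s * ((A ^ s) ^ k * ∫⁻ t, φ t ^ s) := by gcongr; exact itI k
            _ = ∫⁻ t, φ t ^ s := by
                have : (A ^ s) ^ k = (A ^ k) ^ s := by
                  rw [← ENNReal.rpow_natCast, ← ENNReal.rpow_natCast, ← ENNReal.rpow_mul,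
                    ← ENNReal.rpow_mul, mul_comm]
                rw [this, ← mul_assoc, ← ENNReal.mul_rpow_of_nonneg _ _ hs0.le, ← mul_pow,
                  ENNReal.inv_mul_cancel hA0 hAt, one_pow, ENNReal.one_rpow, one_mul]
      _ = _ := by rw [ENNReal.tsum_mul_right, hc1, one_mul]
  -- The term k = 0 of W is φ / 2; doubling makes the weight a majorant of φ.
  refine ⟨fun t => 2 * W t, hWm.const_mul _, ?_, ?_, ?_, ?_⟩
  · intro t
    calc φ t = 2 * (c 0 * (A⁻¹ ^ 0 * it 0 t)) := by
          simp [hc, hit, ← mul_assoc, ENNReal.mul_inv_cancel]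
      _ ≤ 2 * W t := by gcongr; exact ENNReal.le_tsum 0
  · intro t
    refine ENNReal.mul_ne_top (by simp) (ne_top_of_le_ne_top hLt ?_)
    calc W t ≤ ∑' k, c k * L := by
          refine ENNReal.tsum_le_tsum fun k => mul_le_mul' le_rfl ?_
          calc A⁻¹ ^ k * it k t ≤ 1 * L := by
                gcongr
                · exact pow_le_one₀ zero_le (ENNReal.inv_le_one.2 hA1)
                · exact itL k t
            _ = L := one_mul _
      _ = L := by rw [ENNReal.tsum_mul_right, hc1, one_mul]
  · intro t
    -- Applying M shifts the series by one index, and each shifted coefficient is 2A times the next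
    -- one.
    have h1 : M W t ≤ 2 * A * W t := by
      calc M W t ≤ ∑' k, M (fun t => c k * (A⁻¹ ^ k * it k t)) t :=
            maximalFn_tsum_le (fun k => ((itm k).const_mul _).const_mul _) t
        _ ≤ ∑' k, 2 * A * (c (k + 1) * (A⁻¹ ^ (k + 1) * it (k + 1) t)) := by
            refine ENNReal.tsum_le_tsum fun k => ?_
            refine (maximalFn_const_mul_le ((itm k).const_mul _) _ t).trans ?_
            refine (mul_le_mul' le_rfl (maximalFn_const_mul_le (itm k) _ t)).trans ?_
            rw [it_succ]
            refine le_of_eq ?_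
            simp only [hc]
            rw [pow_succ _ (k + 1), pow_succ (A⁻¹)]
            calc _ = (2 * 2⁻¹) * (A * A⁻¹) * (2⁻¹ ^ (k + 1) * (A⁻¹ ^ k * M (it k) t)) := by
                  rw [ENNReal.mul_inv_cancel hA0 hAt, ENNReal.mul_inv_cancel (by simp) (by simp),
                    one_mul, one_mul]
              _ = _ := by ring
        _ ≤ 2 * A * W t := by
            rw [ENNReal.tsum_mul_left]
            gcongr
            exact ENNReal.tsum_comp_le_tsum_of_injective (add_left_injective 1)
              fun k => c k * (A⁻¹ ^ k * it k t)
    calc M (fun t => 2 * W t) t ≤ 2 * M W t := maximalFn_const_mul_le hWm _ t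
      _ ≤ 2 * (2 * A * W t) := by gcongr
      _ = 2 * A * 1 * (2 * W t) := by ring
      _ ≤ 2 * A * 2 ^ s * (2 * W t) := by gcongr
  · simp_rw [ENNReal.mul_rpow_of_nonneg _ _ hs0.le]
    rw [lintegral_const_mul _ (hWm.pow_const s)]
    calc 2 ^ s * ∫⁻ t, W t ^ s ≤ 1 * 1 * 2 ^ s * ∫⁻ t, φ t ^ s := by
          rw [one_mul, one_mul]; gcongr
      _ ≤ 2 * A * 2 ^ s * ∫⁻ t, φ t ^ s := by gcongr; exact one_le_two

/-! ### The maximal inequality in mixed norms. -/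

variable {d : ℕ}

theorem lintegral_time_mul {w : ℝ → ℝ≥0∞} (hw : Measurable w) {f : SpaceTime d → ℝ≥0∞}
    (hf : Measurable f) : ∫⁻ z : SpaceTime d, w z.1 * f z = ∫⁻ t, w t * ∫⁻ x, f (t, x) := by
  have hm : Measurable fun z : SpaceTime d => w z.1 * f z := (measurable_comp_time hw).mul hf
  rw [Measure.volume_eq_prod, lintegral_prod _ hm.aemeasurable]
  refine lintegral_congr fun t => ?_
  have hft : Measurable fun x => f (t, x) := hf.comp measurable_prodMk_left
  exact lintegral_const_mul (μ := volume) (w t) hft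

/-- Jensen's inequality for the concave power θ; the constant K^θ is at most K because K ≥ 1. -/
theorem IsA1.rpow {w : ℝ → ℝ≥0∞} (hw : Measurable w) {K : ℝ≥0∞} (hK : 1 ≤ K) (h : IsA1 K w)
    {θ : ℝ} (h0 : 0 ≤ θ) (h1 : θ ≤ 1) : IsA1 K fun t => w t ^ θ := by
  intro t
  refine iSup_le fun k => ?_
  have hV0 : volume (timeBall t k) ≠ 0 := by rw [volume_timeBall]; simp; positivity
  have hVt : volume (timeBall t k) ≠ ⊤ := by rw [volume_timeBall]; exact ENNReal.ofReal_ne_top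
  have h2 := ENNReal.lintegral_mul_norm_pow_le (μ := volume.restrict (timeBall t k))
    hw.aemeasurable (g := fun _ => 1) aemeasurable_const h0 (sub_nonneg.2 h1) (by ring)
  simp only [ENNReal.one_rpow, mul_one, lintegral_const, Measure.restrict_apply_univ,
    one_mul] at h2
  have h3 : lavg volume (timeBall t k) w ≤ K * w t := (lavg_le_maximalFn t k).trans (h t)
  calc lavg volume (timeBall t k) (fun t => w t ^ θ)
      ≤ (volume (timeBall t k))⁻¹ * ((∫⁻ a in timeBall t k, w a) ^ θ *
          volume (timeBall t k) ^ (1 - θ)) := by unfold lavg; gcongr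
    _ = lavg volume (timeBall t k) w ^ θ := by
        unfold lavg
        rw [ENNReal.mul_rpow_of_nonneg _ _ h0, ENNReal.rpow_sub _ _ hV0 hVt, ENNReal.rpow_one,
          ENNReal.inv_rpow]
        rw [mul_comm (_ ^ θ) (_ / _), ← mul_assoc, ENNReal.div_eq_inv_mul, mul_comm _ (volume _),
          ← mul_assoc, ENNReal.inv_mul_cancel hV0 hVt, one_mul]
    _ ≤ (K * w t) ^ θ := ENNReal.rpow_le_rpow h3 h0
    _ = K ^ θ * w t ^ θ := ENNReal.mul_rpow_of_nonneg _ _ h0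
    _ ≤ K * w t ^ θ := by
        gcongr
        calc K ^ θ ≤ K ^ (1 : ℝ) := ENNReal.rpow_le_rpow_of_exponent_le hK h1
          _ = K := ENNReal.rpow_one K

theorem parMax_eq_zero {f : SpaceTime d → ℝ≥0∞} (h : f =ᵐ[volume] 0) (z : SpaceTime d) :
    parMax f z = 0 := by
  refine le_antisymm (iSup_le fun k => ?_) zero_le
  unfold lavg
  rw [lintegral_congr_ae (ae_restrict_of_ae h)]
  simp

theorem measurable_lintegral_space {f : SpaceTime d → ℝ≥0∞} (hf : Measurable f) (p : ℝ) :
    Measurable fun t => ∫⁻ x, f (t, x) ^ p :=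
  (hf.pow_const p).lintegral_prod_right'

/-- The mixed norm maximal inequality when the exponent in time is not larger. -/
theorem lintegral_parMax_mixed_le_of_le (d : ℕ) {p q : ℝ} (hq : 1 < q) (hqp : q ≤ p) :
    ∃ C : ℝ≥0∞, C ≠ ⊤ ∧ ∀ f : SpaceTime d → ℝ≥0∞, Measurable f →
      (∃ L : ℝ≥0∞, L ≠ ⊤ ∧ ∀ t, ∫⁻ x, f (t, x) ^ p ≤ L) →
      ∫⁻ t, (∫⁻ x, parMax f (t, x) ^ p) ^ (q / p) ≤ C * ∫⁻ t, (∫⁻ x, f (t, x) ^ p) ^ (q / p) := by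
  have hp : 1 < p := by linarith
  have hp0 : 0 < p := by linarith
  have hq0 : 0 < q := by linarith
  obtain ⟨K, hK1, hKt, hK⟩ := exists_isA1_majorant hq
  have hqp0 : 0 ≤ q / p := by positivity
  have hqp1 : 0 ≤ 1 - q / p := by rw [sub_nonneg, div_le_one hp0]; exact hqp
  refine ⟨weightedConst d p K ^ (q / p) * K, ENNReal.mul_ne_top
    (ENNReal.rpow_ne_top_of_nonneg hqp0 (weightedConst_ne_top hp hKt)) hKt, ?_⟩
  intro f hf ⟨L, hLt, hL⟩
  have hHm := measurable_lintegral_space hf p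
  have hGm := measurable_lintegral_space (measurable_parMax hf) p
  -- An A₁ majorant w of F(t) = ‖f(t, ·)‖_p with comparable L_q norm. The uniform bound L is what
  -- the algorithm needs to keep w finite.
  obtain ⟨w, hwm, hFw, hwt, hA, hwI⟩ := hK (fun t => (∫⁻ x, f (t, x) ^ p) ^ (1 / p))
    (hHm.pow_const _) ⟨L ^ (1 / p), ENNReal.rpow_ne_top_of_nonneg (by positivity) hLt,
      fun t => ENNReal.rpow_le_rpow (hL t) (by positivity)⟩
  have hFq : ∀ t, ((∫⁻ x, f (t, x) ^ p) ^ (1 / p)) ^ q = (∫⁻ x, f (t, x) ^ p) ^ (q / p) := by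
    intro t; rw [← ENNReal.rpow_mul]; congr 1; ring
  simp_rw [hFq] at hwI
  have hHw : ∀ t, ∫⁻ x, f (t, x) ^ p ≤ w t ^ p := by
    intro t
    calc ∫⁻ x, f (t, x) ^ p = ((∫⁻ x, f (t, x) ^ p) ^ (1 / p)) ^ p := by
          rw [← ENNReal.rpow_mul, one_div_mul_cancel hp0.ne', ENNReal.rpow_one]
      _ ≤ w t ^ p := ENNReal.rpow_le_rpow (hFw t) hp0.le
  rcases hA.pos_or_ae_eq_zero hwm with hw0 | hw0
  -- The exponent θ is determined by θ(1 - p) = q - p, so w^{q-p} is the (1 - p)-th power of the A₁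
  -- weight w^θ.
  · set θ := (p - q) / (p - 1) with hθ
    have hθ0 : 0 ≤ θ := div_nonneg (by linarith) (by linarith)
    have hθ1 : θ ≤ 1 := by rw [hθ, div_le_one (by linarith)]; linarith
    have hexp : ∀ t, (w t ^ θ) ^ (1 - p) = w t ^ (q - p) := by
      intro t
      rw [← ENNReal.rpow_mul]
      congr 1
      rw [hθ]
      have : p - 1 ≠ 0 := by linarith
      field_simp
      ring
    have key := lintegral_parMax_rpow_mul_rpow_le (d := d) (v := fun t => w t ^ θ)
      (hwm.pow_const θ) (fun t => ENNReal.rpow_ne_top_of_nonneg hθ0 (hwt t))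
      (fun t => (ENNReal.rpow_pos (pos_iff_ne_zero.2 (hw0 t)) (hwt t)).ne')
      (hA.rpow hwm hK1 hθ0 hθ1) hK1 hKt hp hf
    simp only [hexp] at key
    rw [lintegral_time_mul (hwm.pow_const _) ((measurable_parMax hf).pow_const p),
      lintegral_time_mul (hwm.pow_const _) (hf.pow_const p)] at key
    have h1 : ∫⁻ t, w t ^ (q - p) * ∫⁻ x, f (t, x) ^ p ≤ ∫⁻ t, w t ^ q := by
      refine lintegral_mono fun t => ?_
      calc w t ^ (q - p) * ∫⁻ x, f (t, x) ^ p ≤ w t ^ (q - p) * w t ^ p := by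
            gcongr; exact hHw t
        _ = w t ^ q := by rw [← ENNReal.rpow_add _ _ (hw0 t) (hwt t), sub_add_cancel]
    -- Splitting for Hölder's inequality with exponents q/p and 1 - q/p; the powers of w cancel.
    -- Both resulting integrals are controlled by ∫ w^q, the first one because F ≤ w.
    have h2 : ∀ t, (∫⁻ x, parMax f (t, x) ^ p) ^ (q / p) =
        (w t ^ (q - p) * ∫⁻ x, parMax f (t, x) ^ p) ^ (q / p) * (w t ^ q) ^ (1 - q / p) := by
      intro t
      rw [ENNReal.mul_rpow_of_nonneg _ _ hqp0, ← ENNReal.rpow_mul, ← ENNReal.rpow_mul,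
        mul_right_comm, ← ENNReal.rpow_add _ _ (hw0 t) (hwt t)]
      have : (q - p) * (q / p) + q * (1 - q / p) = 0 := by field_simp; ring
      rw [this, ENNReal.rpow_zero, one_mul]
    simp_rw [h2]
    calc _ ≤ (∫⁻ t, w t ^ (q - p) * ∫⁻ x, parMax f (t, x) ^ p) ^ (q / p) *
          (∫⁻ t, w t ^ q) ^ (1 - q / p) :=
          ENNReal.lintegral_mul_norm_pow_le ((hwm.pow_const _).mul hGm).aemeasurable
            (hwm.pow_const _).aemeasurable hqp0 hqp1 (by ring)
      _ ≤ (weightedConst d p K * ∫⁻ t, w t ^ q) ^ (q / p) * (∫⁻ t, w t ^ q) ^ (1 - q / p) := by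
          gcongr
          exact key.trans (mul_le_mul' le_rfl h1)
      _ = weightedConst d p K ^ (q / p) * ∫⁻ t, w t ^ q := by
          rw [ENNReal.mul_rpow_of_nonneg _ _ hqp0, mul_assoc,
            ← ENNReal.rpow_add_of_nonneg _ _ hqp0 hqp1, add_sub_cancel, ENNReal.rpow_one]
      _ ≤ _ := by
          rw [mul_assoc]
          gcongr
  -- If w vanishes almost everywhere, so does its minorant F, hence f, and the maximal function is
  -- identically zero.
  · have hf0 : f =ᵐ[volume] 0 := by
      have h1 : ∫⁻ z, f z ^ p = 0 := by
        rw [Measure.volume_eq_prod, lintegral_prod _ (hf.pow_const p).aemeasurable,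
          lintegral_congr_ae (g := fun _ => 0), lintegral_zero]
        filter_upwards [hw0] with t ht
        have := hHw t
        rw [ht, Pi.zero_apply, ENNReal.zero_rpow_of_pos hp0] at this
        exact le_antisymm this zero_le
      rw [lintegral_eq_zero_iff (hf.pow_const p)] at h1
      filter_upwards [h1] with z hz
      simpa [hp0, hp0.not_gt] using hz
    have h2 : ∀ z, parMax f z = 0 := parMax_eq_zero hf0
    simp only [h2, ENNReal.zero_rpow_of_pos hp0, lintegral_zero,
      ENNReal.zero_rpow_of_pos (div_pos hq0 hp0)]
    exact zero_le

/-- The mixed norm maximal inequality when the exponent in time is larger. -/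
theorem lintegral_parMax_mixed_le_of_lt (d : ℕ) {p q : ℝ} (hp : 1 < p) (hpq : p < q) :
    ∃ C : ℝ≥0∞, C ≠ ⊤ ∧ ∀ f : SpaceTime d → ℝ≥0∞, Measurable f →
      ∫⁻ t, (∫⁻ x, parMax f (t, x) ^ p) ^ (q / p) ≤ C * ∫⁻ t, (∫⁻ x, f (t, x) ^ p) ^ (q / p) := by
  have hp0 : 0 < p := by linarith
  set a := q / p with ha
  have ha1 : 1 < a := by rw [ha, one_lt_div hp0]; exact hpq
  have ha0 : 0 < a := by linarith
  have hconj : a.HolderConjugate (a / (a - 1)) := Real.HolderConjugate.conjExponent ha1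
  set b := a / (a - 1) with hb
  have hb1 : 1 < b := hconj.symm.lt
  have hab : (a - 1) * b = a := by rw [hb]; have : a - 1 ≠ 0 := by linarith
                                   field_simp
  obtain ⟨K, hK1, hKt, hK⟩ := exists_isA1_majorant hb1
  set Cw := weightedConst d p K with hCw
  have hCwt : Cw ≠ ⊤ := weightedConst_ne_top hp hKt
  have hC1 : Cw * K ^ (1 / b) ≠ ⊤ :=
    ENNReal.mul_ne_top hCwt (ENNReal.rpow_ne_top_of_nonneg (by positivity) hKt)
  refine ⟨(Cw * K ^ (1 / b)) ^ a, ENNReal.rpow_ne_top_of_nonneg ha0.le hC1, ?_⟩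
  intro f hf
  have hHm := measurable_lintegral_space hf p
  have hGm := measurable_lintegral_space (measurable_parMax hf) p
  set G : ℝ → ℝ≥0∞ := fun t => ∫⁻ x, parMax f (t, x) ^ p with hG
  set H : ℝ → ℝ≥0∞ := fun t => ∫⁻ x, f (t, x) ^ p with hH
  -- Truncation in height and in time makes ∫ g^a finite, which is needed to divide by a power of
  -- it; it also makes g^{a-1} bounded, as the algorithm requires.
  set g : ℕ → ℝ → ℝ≥0∞ := fun n => (Set.Icc (-(n : ℝ)) n).indicator fun t => min (G t) n with hg
  have hgm : ∀ n, Measurable (g n) := fun n =>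
    (hGm.min measurable_const).indicator measurableSet_Icc
  have hgn : ∀ n t, g n t ≤ n := fun n t =>
    Set.indicator_le' (fun t _ => min_le_right _ _) (fun t _ => zero_le) t
  have hgG : ∀ n t, g n t ≤ G t := fun n t =>
    Set.indicator_le' (fun t _ => min_le_left _ _) (fun t _ => zero_le) t
  have step : ∀ n, ∫⁻ t, g n t ^ a ≤ (Cw * K ^ (1 / b)) ^ a * ∫⁻ t, H t ^ a := by
    intro n
    have hfin : ∫⁻ t, g n t ^ a ≠ ⊤ := by
      have : ∫⁻ t, g n t ^ a ≤ (n : ℝ≥0∞) ^ a * volume (Set.Icc (-(n : ℝ)) n) := by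
        rw [← setLIntegral_const, ← lintegral_indicator measurableSet_Icc]
        refine lintegral_mono fun t => ?_
        by_cases ht : t ∈ Set.Icc (-(n : ℝ)) n
        · rw [Set.indicator_of_mem ht]
          exact ENNReal.rpow_le_rpow (hgn n t) ha0.le
        · simp [hg, Set.indicator_of_notMem ht, ENNReal.zero_rpow_of_pos ha0]
      refine ne_top_of_le_ne_top (ENNReal.mul_ne_top
        (ENNReal.rpow_ne_top_of_nonneg ha0.le (by simp)) ?_) this
      rw [Real.volume_Icc]; exact ENNReal.ofReal_ne_top
    -- Duality: g^{a-1} is the extremal test function in the dual space L_b. Its A₁ majorant w has ∫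
    -- w^b ≤ K ∫ g^a, since (a - 1)b = a.
    obtain ⟨w, hwm, hφw, hwt, hA, hwI⟩ := hK (fun t => g n t ^ (a - 1)) ((hgm n).pow_const _)
      ⟨(n : ℝ≥0∞) ^ (a - 1), ENNReal.rpow_ne_top_of_nonneg (by linarith) (by simp),
        fun t => ENNReal.rpow_le_rpow (hgn n t) (by linarith)⟩
    simp_rw [← ENNReal.rpow_mul, hab] at hwI
    have key := lintegral_parMax_rpow_mul_le (d := d) hwm hwt hA hK1 hKt hp hf
    rw [lintegral_time_mul hwm ((measurable_parMax hf).pow_const p),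
      lintegral_time_mul hwm (hf.pow_const p)] at key
    set S := ∫⁻ t, g n t ^ a with hS
    have h1 : S ≤ Cw * K ^ (1 / b) * (∫⁻ t, H t ^ a) ^ (1 / a) * S ^ (1 / b) := by
      calc S = ∫⁻ t, g n t ^ (a - 1) * g n t := by
            refine lintegral_congr fun t => ?_
            conv_lhs => rw [show a = a - 1 + 1 by ring]
            rw [ENNReal.rpow_add_of_nonneg _ _ (by linarith) zero_le_one, ENNReal.rpow_one]
        _ ≤ ∫⁻ t, w t * G t := by
            refine lintegral_mono fun t => ?_
            exact mul_le_mul' (hφw t) (hgG n t)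
        _ ≤ Cw * ∫⁻ t, w t * H t := key
        _ ≤ Cw * ((∫⁻ t, H t ^ a) ^ (1 / a) * (∫⁻ t, w t ^ b) ^ (1 / b)) := by
            gcongr
            have := ENNReal.lintegral_mul_le_Lp_mul_Lq volume hconj hHm.aemeasurable
              hwm.aemeasurable
            simpa only [Pi.mul_apply, mul_comm] using this
        _ ≤ Cw * ((∫⁻ t, H t ^ a) ^ (1 / a) * (K * S) ^ (1 / b)) := by gcongr
        _ = _ := by
            rw [ENNReal.mul_rpow_of_nonneg _ _ (by positivity)]; ring
    rcases eq_or_ne S 0 with hS0 | hS0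
    · rw [hS0]; exact zero_le
    have hab1 : 1 / a + 1 / b = 1 := by simpa using hconj.inv_add_inv_eq_one
    -- Division by S^{1/b}, which is legitimate because 0 < S < ∞.
    have h2 : S ^ (1 / a) ≤ Cw * K ^ (1 / b) * (∫⁻ t, H t ^ a) ^ (1 / a) := by
      have h3 : S = S ^ (1 / a) * S ^ (1 / b) := by
        rw [← ENNReal.rpow_add _ _ hS0 hfin, hab1, ENNReal.rpow_one]
      have hb' : S ^ (1 / b) ≠ 0 := (ENNReal.rpow_pos (pos_iff_ne_zero.2 hS0) hfin).ne'
      have hb'' : S ^ (1 / b) ≠ ⊤ := ENNReal.rpow_ne_top_of_nonneg (by positivity) hfin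
      refine (ENNReal.mul_le_mul_iff_left hb' hb'').1 ?_
      rw [← h3]; exact h1
    calc S = (S ^ (1 / a)) ^ a := by
          rw [← ENNReal.rpow_mul, one_div_mul_cancel ha0.ne', ENNReal.rpow_one]
      _ ≤ (Cw * K ^ (1 / b) * (∫⁻ t, H t ^ a) ^ (1 / a)) ^ a := ENNReal.rpow_le_rpow h2 ha0.le
      _ = _ := by
          rw [ENNReal.mul_rpow_of_nonneg _ _ ha0.le, ← ENNReal.rpow_mul,
            one_div_mul_cancel ha0.ne', ENNReal.rpow_one]
  have hsup : ∀ t, G t ^ a ≤ ⨆ n, g n t ^ a := by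
    intro t
    have h1 : ∀ n : ℕ, |t| ≤ n → (min (G t) n) ^ a ≤ ⨆ n, g n t ^ a := by
      intro n hn
      refine le_trans (le_of_eq ?_) (le_iSup (fun n => g n t ^ a) n)
      simp only [hg]
      rw [Set.indicator_of_mem (show t ∈ Set.Icc (-(n : ℝ)) n from abs_le.1 hn)]
    obtain ⟨m, hm⟩ := exists_nat_ge |t|
    have h2 : Filter.Tendsto (fun n : ℕ => (min (G t) (n : ℝ≥0∞)) ^ a) Filter.atTop
        (nhds ((min (G t) ⊤) ^ a)) :=
      ((ENNReal.continuous_rpow_const.tendsto _).comp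
        ((tendsto_const_nhds).min ENNReal.tendsto_nat_nhds_top))
    rw [min_top_right] at h2
    refine le_of_tendsto h2 ?_
    filter_upwards [Filter.eventually_ge_atTop m] with n hn
    exact h1 n (hm.trans (by exact_mod_cast hn))
  have hmono : Monotone fun n t => g n t ^ a := by
    intro m n hmn t
    refine ENNReal.rpow_le_rpow ?_ ha0.le
    have hmn' : (m : ℝ) ≤ n := by exact_mod_cast hmn
    by_cases ht : t ∈ Set.Icc (-(m : ℝ)) m
    · have ht' : t ∈ Set.Icc (-(n : ℝ)) n := ⟨by linarith [ht.1], by linarith [ht.2]⟩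
      simp only [hg]
      rw [Set.indicator_of_mem ht, Set.indicator_of_mem ht']
      gcongr
    · simp only [hg]
      rw [Set.indicator_of_notMem ht]; exact zero_le
  calc ∫⁻ t, G t ^ a ≤ ∫⁻ t, ⨆ n, g n t ^ a := lintegral_mono hsup
    _ = ⨆ n, ∫⁻ t, g n t ^ a := lintegral_iSup (fun n => (hgm n).pow_const a) hmono
    _ ≤ _ := iSup_le step

/-- The mixed norm of a function with values in `[0, ∞]`. -/
def lmixed (p q : ℝ) (f : SpaceTime d → ℝ≥0∞) : ℝ≥0∞ :=
  (∫⁻ t, (∫⁻ x, f (t, x) ^ p) ^ (q / p)) ^ (1 / q)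

/-- The maximal function is bounded in spaces with mixed norms. -/
theorem lmixed_parMax_le (d : ℕ) {p q : ℝ} (hp : 1 < p) (hq : 1 < q) :
    ∃ C : ℝ≥0∞, C ≠ ⊤ ∧ ∀ f : SpaceTime d → ℝ≥0∞, Measurable f →
      (∃ L : ℝ≥0∞, L ≠ ⊤ ∧ ∀ t, ∫⁻ x, f (t, x) ^ p ≤ L) →
      lmixed p q (parMax f) ≤ C * lmixed p q f := by
  have hq0 : 0 ≤ 1 / q := by positivity
  have main : ∃ C : ℝ≥0∞, C ≠ ⊤ ∧ ∀ f : SpaceTime d → ℝ≥0∞, Measurable f →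
      (∃ L : ℝ≥0∞, L ≠ ⊤ ∧ ∀ t, ∫⁻ x, f (t, x) ^ p ≤ L) →
      ∫⁻ t, (∫⁻ x, parMax f (t, x) ^ p) ^ (q / p) ≤
        C * ∫⁻ t, (∫⁻ x, f (t, x) ^ p) ^ (q / p) := by
    rcases le_or_gt q p with h | h
    · exact lintegral_parMax_mixed_le_of_le d hq h
    · obtain ⟨C, hC, hf⟩ := lintegral_parMax_mixed_le_of_lt d hp h
      exact ⟨C, hC, fun f hm _ => hf f hm⟩
  obtain ⟨C, hC, h⟩ := main
  refine ⟨C ^ (1 / q), ENNReal.rpow_ne_top_of_nonneg hq0 hC, fun f hf hL => ?_⟩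
  unfold lmixed
  rw [← ENNReal.mul_rpow_of_nonneg _ _ hq0]
  exact ENNReal.rpow_le_rpow (h f hf hL) hq0

/-! ### Calculus of mixed norms. -/

variable {d : ℕ} {p q : ℝ} {f g : SpaceTime d → ℝ≥0∞}

theorem lmixed_mono (hp : 0 ≤ p) (hq : 0 ≤ q) (h : ∀ z, f z ≤ g z) :
    lmixed p q f ≤ lmixed p q g := by
  unfold lmixed
  gcongr with t x
  exact h _

theorem lmixed_const_mul (hp : 0 < p) (hq : 0 < q) (hf : Measurable f) (c : ℝ≥0∞) :
    lmixed p q (fun z => c * f z) = c * lmixed p q f := by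
  unfold lmixed
  have h1 : ∀ t, (∫⁻ x, (c * f (t, x)) ^ p) ^ (q / p) = c ^ q * (∫⁻ x, f (t, x) ^ p) ^ (q / p) := by
    intro t
    have hft : Measurable fun x => f (t, x) ^ p := (hf.comp measurable_prodMk_left).pow_const p
    simp_rw [ENNReal.mul_rpow_of_nonneg _ _ hp.le]
    rw [lintegral_const_mul _ hft,
      ENNReal.mul_rpow_of_nonneg _ _ (by positivity), ← ENNReal.rpow_mul, mul_div_cancel₀ _ hp.ne']
  simp_rw [h1]
  rw [lintegral_const_mul _ ((measurable_lintegral_space hf p).pow_const _),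
      ENNReal.mul_rpow_of_nonneg _ _ (by positivity), ← ENNReal.rpow_mul,
      mul_one_div_cancel hq.ne', ENNReal.rpow_one]

theorem lmixed_add_le (hp : 1 ≤ p) (hq : 1 ≤ q) (hf : Measurable f) (hg : Measurable g) :
    lmixed p q (fun z => f z + g z) ≤ lmixed p q f + lmixed p q g := by
  have hq0 : 0 < q := by linarith
  have e : ∀ h : SpaceTime d → ℝ≥0∞,
      lmixed p q h = (∫⁻ t, ((∫⁻ x, h (t, x) ^ p) ^ (1 / p)) ^ q) ^ (1 / q) := by
    intro h
    unfold lmixed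
    congr 1
    refine lintegral_congr fun t => ?_
    rw [← ENNReal.rpow_mul]
    congr 1
    ring
  rw [e, e, e]
  have h1 := ENNReal.lintegral_Lp_add_le (μ := volume)
    ((measurable_lintegral_space hf p).pow_const (1 / p)).aemeasurable
    ((measurable_lintegral_space hg p).pow_const (1 / p)).aemeasurable hq
  refine le_trans ?_ h1
  gcongr with t
  exact ENNReal.lintegral_Lp_add_le (hf.comp measurable_prodMk_left).aemeasurable
    (hg.comp measurable_prodMk_left).aemeasurable hp

/-- It passes from the target exponents r_i to q_i: with κ = 1 - 1/β one has κ r_i = q_i. -/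
theorem lmixed_rpow {r₁ r₂ κ : ℝ} (hκ : 0 < κ) (h1 : κ * r₁ = p) (h2 : κ * r₂ = q) :
    lmixed r₁ r₂ (fun z => f z ^ κ) = lmixed p q f ^ κ := by
  unfold lmixed
  simp_rw [← ENNReal.rpow_mul]
  subst h1 h2
  congr 2
  · ext t
    congr 1
    rw [mul_div_mul_left _ _ hκ.ne']
  · rcases eq_or_ne r₂ 0 with rfl | h
    · simp
    · field_simp

theorem lmixed_indicator_prod (hp : 0 < p) (hq : 0 < q) {I : Set ℝ}
    (hI : MeasurableSet I) {S : Set (EuclideanSpace ℝ (Fin d))} (hS : MeasurableSet S) :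
    lmixed p q ((I ×ˢ S).indicator fun _ => 1) = volume S ^ (1 / p) * volume I ^ (1 / q) := by
  have h1 : ∀ t, (∫⁻ x, ((I ×ˢ S).indicator (fun _ => (1 : ℝ≥0∞)) (t, x)) ^ p) ^ (q / p) =
      I.indicator (fun _ => volume S ^ (q / p)) t := by
    intro t
    by_cases ht : t ∈ I
    · have : ∀ x, ((I ×ˢ S).indicator (fun _ => (1 : ℝ≥0∞)) (t, x)) ^ p =
          S.indicator (fun _ => 1) x := by
        intro x
        by_cases hx : x ∈ S
        · rw [Set.indicator_of_mem (Set.mk_mem_prod ht hx), Set.indicator_of_mem hx,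
            ENNReal.one_rpow]
        · rw [Set.indicator_of_notMem (fun h => hx h.2), Set.indicator_of_notMem hx,
            ENNReal.zero_rpow_of_pos hp]
      simp_rw [this]
      rw [lintegral_indicator_const hS, one_mul, Set.indicator_of_mem ht]
    · have : ∀ x, ((I ×ˢ S).indicator (fun _ => (1 : ℝ≥0∞)) (t, x)) ^ p = 0 := by
        intro x
        rw [Set.indicator_of_notMem (fun h => ht h.1), ENNReal.zero_rpow_of_pos hp]
      simp_rw [this]
      rw [lintegral_zero, ENNReal.zero_rpow_of_pos (by positivity), Set.indicator_of_notMem ht]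
  unfold lmixed
  simp_rw [h1]
  rw [lintegral_indicator_const hI, ENNReal.mul_rpow_of_nonneg _ _ (by positivity),
    ← ENNReal.rpow_mul]
  congr 2
  field_simp

/-- Hölder's inequality in x for each t, then in t. -/
theorem setLIntegral_prod_le_lmixed (hp : 1 ≤ p) (hq : 1 ≤ q) {I : Set ℝ}
    (hI : MeasurableSet I) {S : Set (EuclideanSpace ℝ (Fin d))} (hS : MeasurableSet S)
    (hf : Measurable f) :
    ∫⁻ z in I ×ˢ S, f z ≤ lmixed p q ((I ×ˢ S).indicator f) *
      (volume S ^ (1 - 1 / p) * volume I ^ (1 - 1 / q)) := by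
  have hp0 : 0 < p := by linarith
  have holder : ∀ {X : Type} [MeasurableSpace X] (μ : Measure X) {s : ℝ} (_ : 1 ≤ s) {h : X → ℝ≥0∞}
      (_ : Measurable h), ∫⁻ a, h a ∂μ ≤ (∫⁻ a, h a ^ s ∂μ) ^ (1 / s) * μ Set.univ ^ (1 - 1 / s) := by
    intro X _ μ s hs h hh
    have hs0 : 0 < s := by linarith
    have := ENNReal.lintegral_mul_norm_pow_le (μ := μ) (f := fun a => h a ^ s) (g := fun _ => 1)
      (hh.pow_const s).aemeasurable aemeasurable_const (p := 1 / s) (q := 1 - 1 / s)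
      (by positivity) (by rw [sub_nonneg, div_le_one hs0]; exact hs) (by ring)
    simpa [← ENNReal.rpow_mul, mul_inv_cancel₀ hs0.ne'] using this
  have hfm : Measurable ((I ×ˢ S).indicator f) := hf.indicator (hI.prod hS)
  have e1 : ∀ t ∈ I, ∫⁻ x in S, f (t, x) ^ p = ∫⁻ x, (I ×ˢ S).indicator f (t, x) ^ p := by
    intro t ht
    rw [← lintegral_indicator hS]
    refine lintegral_congr fun x => ?_
    by_cases hx : x ∈ S
    · rw [Set.indicator_of_mem (Set.mk_mem_prod ht hx), Set.indicator_of_mem hx]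
    · rw [Set.indicator_of_notMem hx, Set.indicator_of_notMem (fun h => hx h.2),
        ENNReal.zero_rpow_of_pos hp0]
  set H : ℝ → ℝ≥0∞ := fun t => ∫⁻ x, (I ×ˢ S).indicator f (t, x) ^ p with hH
  have hHm : Measurable H := measurable_lintegral_space hfm p
  calc ∫⁻ z in I ×ˢ S, f z = ∫⁻ t in I, ∫⁻ x in S, f (t, x) := by
        rw [Measure.volume_eq_prod, ← Measure.prod_restrict, lintegral_prod _ hf.aemeasurable]
    _ ≤ ∫⁻ t in I, H t ^ (1 / p) * volume S ^ (1 - 1 / p) := by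
        refine setLIntegral_mono' hI fun t ht => ?_
        have := holder (volume.restrict S) hp (h := fun x => f (t, x))
          (hf.comp measurable_prodMk_left)
        rwa [e1 t ht, Measure.restrict_apply_univ] at this
    _ = (∫⁻ t in I, H t ^ (1 / p)) * volume S ^ (1 - 1 / p) :=
        lintegral_mul_const _ (hHm.pow_const _)
    _ ≤ ((∫⁻ t in I, H t ^ (q / p)) ^ (1 / q) * volume I ^ (1 - 1 / q)) *
          volume S ^ (1 - 1 / p) := by
        gcongr
        have := holder (volume.restrict I) hq (hHm.pow_const (1 / p))
        simp_rw [← ENNReal.rpow_mul] at this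
        rwa [Measure.restrict_apply_univ, one_div_mul_eq_div] at this
    _ ≤ ((∫⁻ t, H t ^ (q / p)) ^ (1 / q) * volume I ^ (1 - 1 / q)) *
          volume S ^ (1 - 1 / p) := by
        gcongr
        exact Measure.restrict_le_self
    _ = _ := by
        rw [lmixed, mul_assoc, mul_comm (volume I ^ _)]

/-! ### Cylinders, boxes and Morrey norms. -/

theorem cylinder_eq_prod (ρ : ℝ≥0) (z : SpaceTime d) :
    cylinder (ρ : ℝ≥0∞) z = Set.Ico z.1 (z.1 + (ρ : ℝ) ^ 2) ×ˢ Metric.ball z.2 ρ := by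
  ext w
  rw [mem_cylinder_coe, Set.mem_prod, Set.mem_Ico, Metric.mem_ball, dist_comm w.2]
  tauto

theorem measurableSet_cylinder_coe (ρ : ℝ≥0) (z : SpaceTime d) :
    MeasurableSet (cylinder (ρ : ℝ≥0∞) z) := by
  rw [cylinder_eq_prod]
  exact measurableSet_Ico.prod measurableSet_ball

theorem measurableSet_cylinder (R : ℝ≥0∞) (z : SpaceTime d) : MeasurableSet (cylinder R z) := by
  induction R with
  | top =>
    have : cylinder ⊤ z = {w : SpaceTime d | z.1 ≤ w.1} := by
      ext w; exact mem_cylinder_top z w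
    rw [this]
    exact measurableSet_le measurable_const measurable_fst
  | coe ρ => exact measurableSet_cylinder_coe ρ z

/-- The volume of the unit ball. -/
def unitVol (d : ℕ) : ℝ≥0∞ := volume (Metric.ball (0 : EuclideanSpace ℝ (Fin d)) 1)

theorem unitVol_ne_zero : unitVol d ≠ 0 := (Metric.measure_ball_pos _ _ one_pos).ne'

theorem unitVol_ne_top : unitVol d ≠ ⊤ := measure_ball_lt_top.ne

theorem volume_ball_coe (x : EuclideanSpace ℝ (Fin d)) {ρ : ℝ≥0} (hρ : 0 < ρ) :
    volume (Metric.ball x ρ) = (ρ : ℝ≥0∞) ^ (d : ℝ) * unitVol d := by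
  rw [volume_spaceBall x (by exact_mod_cast hρ), unitVol, ENNReal.ofReal_pow (NNReal.coe_nonneg ρ),
    ENNReal.ofReal_coe_nnreal, ENNReal.rpow_natCast]

theorem volume_Ico_coe (t : ℝ) (ρ : ℝ≥0) :
    volume (Set.Ico t (t + (ρ : ℝ) ^ 2)) = (ρ : ℝ≥0∞) ^ (2 : ℝ) := by
  rw [Real.volume_Ico, add_sub_cancel_left, ENNReal.ofReal_pow (NNReal.coe_nonneg ρ), ENNReal.ofReal_coe_nnreal]
  norm_cast

theorem lmixed_indicator_cylinder (hp : 0 < p) (hq : 0 < q) {ρ : ℝ≥0} (hρ : 0 < ρ)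
    (z : SpaceTime d) :
    lmixed p q ((cylinder (ρ : ℝ≥0∞) z).indicator fun _ => 1) =
      unitVol d ^ (1 / p) * (ρ : ℝ≥0∞) ^ (d / p + 2 / q) := by
  have h0 : (ρ : ℝ≥0∞) ≠ 0 := by simpa using hρ.ne'
  rw [cylinder_eq_prod, lmixed_indicator_prod hp hq measurableSet_Ico measurableSet_ball,
    volume_ball_coe _ hρ, volume_Ico_coe, ENNReal.mul_rpow_of_nonneg _ _ (by positivity),
    ← ENNReal.rpow_mul, ← ENNReal.rpow_mul, mul_comm (_ ^ _) (unitVol d ^ _), mul_assoc,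
    ← ENNReal.rpow_add _ _ h0 ENNReal.coe_ne_top, mul_one_div, mul_one_div]

/-- The Morrey norm of a function with values in `[0, ∞]`. -/
def lmorrey (p q β : ℝ) (Q : Set (SpaceTime d)) (f : SpaceTime d → ℝ≥0∞) : ℝ≥0∞ :=
  ⨆ (ρ : ℝ≥0) (_ : 0 < ρ) (z : SpaceTime d) (_ : z ∈ Q),
    (ρ : ℝ≥0∞) ^ β * ((lmixed p q ((cylinder (ρ : ℝ≥0∞) z).indicator fun _ => 1))⁻¹ *
      lmixed p q ((cylinder (ρ : ℝ≥0∞) z).indicator (Q.indicator f)))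

theorem morreyNorm_eq_lmorrey {F : Type*} [NormedAddCommGroup F] (p q β : ℝ)
    (Q : Set (SpaceTime d)) (u : SpaceTime d → F) :
    morreyNorm p q β Q u = lmorrey p q β Q fun z => ‖u z‖ₑ := by
  have e : ∀ (S : Set (SpaceTime d)) (v : SpaceTime d → F),
      mixedNorm p q (S.indicator v) = lmixed p q (S.indicator fun z => ‖v z‖ₑ) := by
    intro S v
    unfold mixedNorm lmixed
    simp only [enorm_indicator_eq_indicator_enorm]
  have e1 : ∀ S : Set (SpaceTime d), mixedNorm p q (S.indicator fun _ => (1 : ℝ)) =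
      lmixed p q (S.indicator fun _ => 1) := by
    intro S
    unfold mixedNorm lmixed
    simp only [enorm_indicator_eq_indicator_enorm, enorm_one]
  unfold morreyNorm lmorrey mixedNormAvg
  simp only [e, e1, enorm_indicator_eq_indicator_enorm]

theorem lmixed_cylinder_ne_zero (hp : 0 < p) (hq : 0 < q) {ρ : ℝ≥0} (hρ : 0 < ρ)
    (z : SpaceTime d) : lmixed p q ((cylinder (ρ : ℝ≥0∞) z).indicator fun _ => 1) ≠ 0 := by
  rw [lmixed_indicator_cylinder hp hq hρ]
  exact mul_ne_zero (ENNReal.rpow_pos (pos_iff_ne_zero.2 unitVol_ne_zero) unitVol_ne_top).ne'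
    (ENNReal.rpow_pos (by simpa using hρ) ENNReal.coe_ne_top).ne'

theorem lmixed_cylinder_ne_top (hp : 0 < p) (hq : 0 < q) {ρ : ℝ≥0} (hρ : 0 < ρ)
    (z : SpaceTime d) : lmixed p q ((cylinder (ρ : ℝ≥0∞) z).indicator fun _ => 1) ≠ ⊤ := by
  rw [lmixed_indicator_cylinder hp hq hρ]
  exact ENNReal.mul_ne_top (ENNReal.rpow_ne_top_of_nonneg (by positivity) unitVol_ne_top)
    (ENNReal.rpow_ne_top_of_nonneg (by positivity) ENNReal.coe_ne_top)

theorem lmixed_cylinder_le_lmorrey (hp : 0 < p) (hq : 0 < q) (β : ℝ) {Q : Set (SpaceTime d)}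
    {ρ : ℝ≥0} (hρ : 0 < ρ) {z : SpaceTime d} (hz : z ∈ Q) :
    lmixed p q ((cylinder (ρ : ℝ≥0∞) z).indicator (Q.indicator f)) ≤
      (ρ : ℝ≥0∞) ^ (-β) * lmorrey p q β Q f *
        lmixed p q ((cylinder (ρ : ℝ≥0∞) z).indicator fun _ => 1) := by
  have h0 : (ρ : ℝ≥0∞) ≠ 0 := by simpa using hρ.ne'
  have hN0 := lmixed_cylinder_ne_zero (d := d) hp hq hρ z
  have hNt := lmixed_cylinder_ne_top (d := d) hp hq hρ z
  have h1 : (ρ : ℝ≥0∞) ^ β * ((lmixed p q ((cylinder (ρ : ℝ≥0∞) z).indicator fun _ => 1))⁻¹ *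
      lmixed p q ((cylinder (ρ : ℝ≥0∞) z).indicator (Q.indicator f))) ≤ lmorrey p q β Q f :=
    le_iSup₂_of_le ρ hρ (le_iSup₂_of_le z hz le_rfl)
  set N := lmixed p q ((cylinder (ρ : ℝ≥0∞) z).indicator fun _ => 1)
  set X := lmixed p q ((cylinder (ρ : ℝ≥0∞) z).indicator (Q.indicator f))
  calc X = ((ρ : ℝ≥0∞) ^ (-β) * (ρ : ℝ≥0∞) ^ β) * (N * N⁻¹) * X := by
        rw [← ENNReal.rpow_add _ _ h0 ENNReal.coe_ne_top, ENNReal.mul_inv_cancel hN0 hNt]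
        simp
    _ = (ρ : ℝ≥0∞) ^ (-β) * ((ρ : ℝ≥0∞) ^ β * (N⁻¹ * X)) * N := by ring
    _ ≤ _ := by gcongr

/-- Hölder's inequality on the cylinder. The powers of ρ add up to -β + (d/p + 2/q) + d(1 - 1/p) +
2(1 - 1/q) = d + 2 - β. -/
theorem setLIntegral_cylinder_le_lmorrey (hp : 1 ≤ p) (hq : 1 ≤ q) (β : ℝ) {Q : Set (SpaceTime d)}
    (hQ : MeasurableSet Q) (hf : Measurable f) {ρ : ℝ≥0} (hρ : 0 < ρ) {z : SpaceTime d}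
    (hz : z ∈ Q) :
    ∫⁻ w in cylinder (ρ : ℝ≥0∞) z, Q.indicator f w ≤
      (ρ : ℝ≥0∞) ^ (d + 2 - β) * unitVol d * lmorrey p q β Q f := by
  have hp0 : 0 < p := by linarith
  have hq0 : 0 < q := by linarith
  have h0 : (ρ : ℝ≥0∞) ≠ 0 := by simpa using hρ.ne'
  have h1 := setLIntegral_prod_le_lmixed hp hq
    (measurableSet_Ico (a := z.1) (b := z.1 + (ρ : ℝ) ^ 2))
    (measurableSet_ball (x := z.2) (ε := (ρ : ℝ))) (hf.indicator hQ)
  have hp1 : 0 ≤ 1 - 1 / p := by rw [sub_nonneg, div_le_one hp0]; exact hp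
  rw [← cylinder_eq_prod, volume_ball_coe _ hρ, volume_Ico_coe] at h1
  refine h1.trans ?_
  refine (mul_le_mul' (lmixed_cylinder_le_lmorrey hp0 hq0 β hρ hz) le_rfl).trans (le_of_eq ?_)
  rw [lmixed_indicator_cylinder hp0 hq0 hρ, ENNReal.mul_rpow_of_nonneg _ _ hp1]
  have e1 : unitVol d = unitVol d ^ (1 / p) * unitVol d ^ (1 - 1 / p) := by
    rw [← ENNReal.rpow_add _ _ unitVol_ne_zero unitVol_ne_top, add_sub_cancel, ENNReal.rpow_one]
  have e2 : (ρ : ℝ≥0∞) ^ (d + 2 - β) = (ρ : ℝ≥0∞) ^ (-β) * (ρ : ℝ≥0∞) ^ (d / p + 2 / q) *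
      ((ρ : ℝ≥0∞) ^ (d : ℝ)) ^ (1 - 1 / p) * ((ρ : ℝ≥0∞) ^ (2 : ℝ)) ^ (1 - 1 / q) := by
    rw [← ENNReal.rpow_mul, ← ENNReal.rpow_mul, ← ENNReal.rpow_add _ _ h0 ENNReal.coe_ne_top,
      ← ENNReal.rpow_add _ _ h0 ENNReal.coe_ne_top, ← ENNReal.rpow_add _ _ h0 ENNReal.coe_ne_top]
    congr 1
    ring
  rw [e2]
  conv_rhs => rw [e1]
  simp only [mul_assoc, mul_left_comm, mul_comm]

/-- The two-sided parabolic cylinder of radius `r`. -/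
def parBox (z : SpaceTime d) (r : ℝ) : Set (SpaceTime d) :=
  Metric.ball z.1 (r ^ 2) ×ˢ Metric.ball z.2 r

theorem measurableSet_parBox (z : SpaceTime d) (r : ℝ) : MeasurableSet (parBox z r) :=
  measurableSet_ball.prod measurableSet_ball

/-- The Morrey norm tests only one-sided cylinders with vertex in C_R, while maximal functions and
potentials use two-sided boxes. Moving the vertex back in time by r², but not below 0, stays in C_R;
the part of the box in C_R then has time length at most 2r² < (2r)². -/
theorem exists_cylinder_covering (R : ℝ≥0∞) {z : SpaceTime d} (hz : z ∈ cylinder R 0) {r : ℝ≥0}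
    (hr : 0 < r) : ∃ w ∈ cylinder R (0 : SpaceTime d),
      parBox z r ∩ cylinder R 0 ⊆ cylinder ((2 * r : ℝ≥0) : ℝ≥0∞) w := by
  obtain ⟨h1, h2, h3⟩ := hz
  simp only [Prod.fst_zero, Prod.snd_zero, sub_zero] at h1 h2 h3
  refine ⟨(max 0 (z.1 - (r : ℝ) ^ 2), z.2), ⟨h1, by simp, ?_⟩, ?_⟩
  · refine lt_of_le_of_lt (ENNReal.ofReal_le_ofReal ?_) h3
    simp only [Prod.fst_zero, sub_zero]
    exact max_le h2 (by nlinarith [sq_nonneg (r : ℝ)])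
  · rintro w ⟨⟨hw1, hw2⟩, -, hw4, -⟩
    rw [Metric.mem_ball] at hw1 hw2
    rw [Real.dist_eq, abs_lt] at hw1
    simp only [Prod.fst_zero] at hw4
    rw [mem_cylinder_coe]
    push_cast
    refine ⟨?_, max_le hw4 (by linarith), ?_⟩
    · rw [dist_comm]; linarith
    · have := le_max_right 0 (z.1 - (r : ℝ) ^ 2)
      nlinarith

theorem setLIntegral_parBox_le_lmorrey (hp : 1 ≤ p) (hq : 1 ≤ q) (β : ℝ) (R : ℝ≥0∞)
    (hf : Measurable f) {r : ℝ≥0} (hr : 0 < r) {z : SpaceTime d} (hz : z ∈ cylinder R 0) :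
    ∫⁻ w in parBox z r, (cylinder R 0).indicator f w ≤
      ((2 * r : ℝ≥0) : ℝ≥0∞) ^ (d + 2 - β) * unitVol d * lmorrey p q β (cylinder R 0) f := by
  have hQ := measurableSet_cylinder (d := d) R 0
  obtain ⟨w, hw, hsub⟩ := exists_cylinder_covering R hz hr
  refine le_trans ?_ (setLIntegral_cylinder_le_lmorrey hp hq β hQ hf (by positivity) hw)
  rw [setLIntegral_indicator hQ, setLIntegral_indicator hQ]
  exact lintegral_mono_set fun x hx => ⟨hx.1, hsub ⟨hx.2, hx.1⟩⟩

theorem lmixed_parBox_le_lmorrey (hp : 0 < p) (hq : 0 < q) (β : ℝ) (R : ℝ≥0∞)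
    {r : ℝ≥0} (hr : 0 < r) {z : SpaceTime d} (hz : z ∈ cylinder R 0) :
    lmixed p q ((parBox z r).indicator ((cylinder R 0).indicator f)) ≤
      ((2 * r : ℝ≥0) : ℝ≥0∞) ^ (-β) * lmorrey p q β (cylinder R 0) f *
        (unitVol d ^ (1 / p) * ((2 * r : ℝ≥0) : ℝ≥0∞) ^ (d / p + 2 / q)) := by
  obtain ⟨w, hw, hsub⟩ := exists_cylinder_covering R hz hr
  have h2r : 0 < 2 * r := by positivity
  rw [← lmixed_indicator_cylinder hp hq h2r w]
  refine le_trans (lmixed_mono hp.le hq.le fun x => ?_)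
    (lmixed_cylinder_le_lmorrey hp hq β h2r hw)
  rw [Set.indicator_indicator, Set.indicator_indicator]
  refine Set.indicator_le_indicator_of_subset ?_ (fun _ => zero_le) x
  exact fun y hy => ⟨hsub hy, hy.2⟩

/-! ### Hedberg's optimization. -/

theorem lintegral_Ioi_rpow_neg {β : ℝ} (hβ : 1 < β) {m : ℝ} (hm : 0 < m) :
    ∫⁻ l in Set.Ioi m, ENNReal.ofReal l ^ (-β) = ENNReal.ofReal (m ^ (1 - β) / (β - 1)) := by
  have h1 : ∫⁻ l in Set.Ioi m, ENNReal.ofReal l ^ (-β) =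
      ∫⁻ l in Set.Ioi m, ENNReal.ofReal (l ^ (-β)) :=
    setLIntegral_congr_fun measurableSet_Ioi fun l hl =>
      ENNReal.ofReal_rpow_of_pos (hm.trans hl)
  rw [h1, ← ofReal_integral_eq_lintegral_ofReal
    (integrableOn_Ioi_rpow_of_lt (by linarith) hm), integral_Ioi_rpow_of_lt (by linarith) hm]
  · congr 1
    rw [show -β + 1 = -(β - 1) by ring, neg_div_neg_eq, show -(β - 1) = 1 - β by ring]
  · filter_upwards [ae_restrict_mem measurableSet_Ioi] with l hl
    exact Real.rpow_nonneg (hm.trans hl).le _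

/-- Optimization over the truncation radius in a potential. -/
theorem lintegral_Ioi_le_of_le_of_le {β : ℝ} (hβ : 1 < β) {A B : ℝ≥0∞} {h : ℝ → ℝ≥0∞}
    (hA : ∀ l, 0 < l → h l ≤ A) (hB : ∀ l, 0 < l → h l ≤ B * ENNReal.ofReal l ^ (-β)) :
    ∫⁻ l in Set.Ioi (0 : ℝ), h l ≤
      ENNReal.ofReal (1 + 1 / (β - 1)) * (A ^ (1 - 1 / β) * B ^ (1 / β)) := by
  have hβ0 : 0 < β := by linarith
  have hκ : 0 < 1 - 1 / β := by rw [sub_pos, div_lt_one hβ0]; exact hβ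
  have hC0 : ENNReal.ofReal (1 + 1 / (β - 1)) ≠ 0 := by simp; positivity
  have zero : (∀ l, 0 < l → h l = 0) → ∫⁻ l in Set.Ioi (0 : ℝ), h l ≤
      ENNReal.ofReal (1 + 1 / (β - 1)) * (A ^ (1 - 1 / β) * B ^ (1 / β)) := by
    intro h0
    rw [setLIntegral_congr_fun (g := fun _ => 0) measurableSet_Ioi fun l hl => h0 l hl]
    simp
  rcases eq_or_ne A 0 with rfl | hA0
  · exact zero fun l hl => le_antisymm (hA l hl) zero_le
  rcases eq_or_ne B 0 with rfl | hB0
  · exact zero fun l hl => le_antisymm ((hB l hl).trans (by simp)) zero_le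
  have hA1 : A ^ (1 - 1 / β) ≠ 0 := by
    intro h0
    rcases ENNReal.rpow_eq_zero_iff.1 h0 with h0 | h0
    · exact hA0 h0.1
    · linarith [h0.2]
  have hB1 : B ^ (1 / β) ≠ 0 := by
    intro h0
    rcases ENNReal.rpow_eq_zero_iff.1 h0 with h0 | h0
    · exact hB0 h0.1
    · linarith [h0.2, one_div_pos.2 hβ0]
  rcases eq_or_ne A ⊤ with rfl | hAt
  · rw [ENNReal.top_rpow_of_pos hκ, ENNReal.top_mul hB1, ENNReal.mul_top hC0]; exact le_top
  rcases eq_or_ne B ⊤ with rfl | hBt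
  · rw [ENNReal.top_rpow_of_pos (by positivity), ENNReal.mul_top hA1, ENNReal.mul_top hC0]
    exact le_top
  lift A to ℝ≥0 using hAt
  lift B to ℝ≥0 using hBt
  have ha : (0 : ℝ) < A := by
    rw [NNReal.coe_pos]; exact pos_iff_ne_zero.2 (by simpa using hA0)
  have hb : (0 : ℝ) < B := by
    rw [NNReal.coe_pos]; exact pos_iff_ne_zero.2 (by simpa using hB0)
  -- The radius where the two bounds agree: A = B m^{-β}.
  set m : ℝ := ((B : ℝ) / A) ^ (1 / β) with hm
  have hm0 : 0 < m := by positivity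
  have e1 : (A : ℝ) * m = (A : ℝ) ^ (1 - 1 / β) * (B : ℝ) ^ (1 / β) := by
    rw [hm, Real.div_rpow hb.le ha.le, Real.rpow_sub ha, Real.rpow_one]
    field_simp
  have e2 : (B : ℝ) * m ^ (1 - β) = (A : ℝ) ^ (1 - 1 / β) * (B : ℝ) ^ (1 / β) := by
    rw [← e1, Real.rpow_sub hm0, Real.rpow_one, hm, ← Real.rpow_mul (by positivity),
      one_div_mul_cancel hβ0.ne', Real.rpow_one]
    field_simp
  calc ∫⁻ l in Set.Ioi (0 : ℝ), h l
      ≤ (∫⁻ l in Set.Ioc 0 m, h l) + ∫⁻ l in Set.Ioi m, h l := by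
        rw [← Set.Ioc_union_Ioi_eq_Ioi hm0.le]
        exact lintegral_union_le _ _ _
    _ ≤ (∫⁻ _ in Set.Ioc 0 m, (A : ℝ≥0∞)) +
          ∫⁻ l in Set.Ioi m, B * ENNReal.ofReal l ^ (-β) := by
        refine add_le_add (setLIntegral_mono' measurableSet_Ioc fun l hl => hA l hl.1)
          (setLIntegral_mono' measurableSet_Ioi fun l hl => hB l (hm0.trans hl))
    _ = ENNReal.ofReal (A * m) + ENNReal.ofReal (B * m ^ (1 - β) * (1 / (β - 1))) := by
        rw [setLIntegral_const, Real.volume_Ioc, sub_zero,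
          lintegral_const_mul' _ _ ENNReal.coe_ne_top, lintegral_Ioi_rpow_neg hβ hm0,
          ENNReal.ofReal_mul ha.le, mul_assoc, ENNReal.ofReal_mul hb.le,
          ENNReal.ofReal_coe_nnreal, ENNReal.ofReal_coe_nnreal, mul_one_div]
    _ = _ := by
        rw [e2, e1, ← ENNReal.ofReal_add (by positivity) (by positivity), ← ENNReal.ofReal_coe_nnreal,
          ← ENNReal.ofReal_coe_nnreal (p := B), ENNReal.ofReal_rpow_of_pos ha,
          ENNReal.ofReal_rpow_of_pos hb, ← ENNReal.ofReal_mul (by positivity),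
          ← ENNReal.ofReal_mul (by positivity)]
        congr 1
        ring

/-! ### Derivatives along parabolic paths. -/

variable {d : ℕ} {u : SpaceTime d → ℝ}

theorem timeDeriv_eq_fderiv (hu : ContDiff ℝ (⊤ : ℕ∞) u) (z : SpaceTime d) :
    timeDeriv u z = fderiv ℝ u z (1, 0) := by
  have h1 : HasFDerivAt u (fderiv ℝ u z) (z.1, z.2) :=
    (hu.differentiable (by simp)).differentiableAt.hasFDerivAt
  have h2 : HasDerivAt (fun s : ℝ => (s, z.2)) ((1 : ℝ), (0 : EuclideanSpace ℝ (Fin d))) z.1 :=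
    (hasDerivAt_id z.1).prodMk (hasDerivAt_const _ _)
  exact (h1.comp_hasDerivAt z.1 h2).deriv

theorem spaceDeriv_eq_fderiv (hu : ContDiff ℝ (⊤ : ℕ∞) u) (i : Fin d) (z : SpaceTime d) :
    spaceDeriv i u z = fderiv ℝ u z (0, EuclideanSpace.single i 1) := by
  have h1 : HasFDerivAt u (fderiv ℝ u z) (z.1, z.2) :=
    (hu.differentiable (by simp)).differentiableAt.hasFDerivAt
  have h2 : HasFDerivAt (fun y : EuclideanSpace ℝ (Fin d) => (z.1, y))
      ((0 : EuclideanSpace ℝ (Fin d) →L[ℝ] ℝ).prod (ContinuousLinearMap.id ℝ _)) z.2 :=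
    (hasFDerivAt_const z.1 z.2).prodMk (hasFDerivAt_id z.2)
  have h3 := (h1.comp z.2 h2).fderiv
  unfold spaceDeriv
  have h4 : (fun y => u (z.1, y)) = u ∘ fun y => (z.1, y) := rfl
  rw [h4, h3]
  rfl

theorem contDiff_fderiv_apply (hu : ContDiff ℝ (⊤ : ℕ∞) u) (w : SpaceTime d) :
    ContDiff ℝ (⊤ : ℕ∞) fun z => fderiv ℝ u z w :=
  (hu.fderiv_right (m := (⊤ : ℕ∞)) (by simp)).clm_apply contDiff_const

theorem contDiff_timeDeriv (hu : ContDiff ℝ (⊤ : ℕ∞) u) : ContDiff ℝ (⊤ : ℕ∞) (timeDeriv u) := by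
  rw [funext (timeDeriv_eq_fderiv hu)]
  exact contDiff_fderiv_apply hu _

theorem contDiff_spaceDeriv (hu : ContDiff ℝ (⊤ : ℕ∞) u) (i : Fin d) :
    ContDiff ℝ (⊤ : ℕ∞) (spaceDeriv i u) := by
  rw [funext (spaceDeriv_eq_fderiv hu i)]
  exact contDiff_fderiv_apply hu _

theorem continuous_spaceHess (hu : ContDiff ℝ (⊤ : ℕ∞) u) : Continuous (spaceHess u) := by
  unfold spaceHess
  refine (PiLp.continuous_toLp 2 _).comp (continuous_pi fun p => ?_)
  exact (contDiff_spaceDeriv (contDiff_spaceDeriv hu p.2) p.1).continuous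

theorem timeDeriv_spaceDeriv (hu : ContDiff ℝ (⊤ : ℕ∞) u) (i : Fin d) (z : SpaceTime d) :
    timeDeriv (spaceDeriv i u) z = spaceDeriv i (timeDeriv u) z := by
  rw [timeDeriv_eq_fderiv (contDiff_spaceDeriv hu i), spaceDeriv_eq_fderiv (contDiff_timeDeriv hu),
    funext (timeDeriv_eq_fderiv hu), funext (spaceDeriv_eq_fderiv hu i)]
  have hd : DifferentiableAt ℝ (fderiv ℝ u) z :=
    (hu.fderiv_right (m := (⊤ : ℕ∞)) (by simp)).differentiable (by simp) |>.differentiableAt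
  rw [fderiv_clm_apply hd (differentiableAt_const _), fderiv_clm_apply hd (differentiableAt_const _)]
  simp only [fderiv_fun_const, Pi.zero_apply, ContinuousLinearMap.comp_zero, zero_add,
    ContinuousLinearMap.flip_apply]
  exact (hu.contDiffAt.isSymmSndFDerivAt (by simpa using WithTop.coe_le_coe.2 (le_top (a := (2 : ℕ∞))))) _ _

/-- The point of the parabolic path that starts at `z` at time zero. -/
def parPath (z : SpaceTime d) (a : ℝ) (e ξ : EuclideanSpace ℝ (Fin d)) (l : ℝ) : SpaceTime d :=
  (z.1 + l ^ 2 * a, z.2 + l • (ξ + e))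

theorem parPath_zero (z : SpaceTime d) (a : ℝ) (e ξ : EuclideanSpace ℝ (Fin d)) :
    parPath z a e ξ 0 = z := by
  simp [parPath]

theorem continuous_parPath (z : SpaceTime d) (e : EuclideanSpace ℝ (Fin d)) :
    Continuous fun p : ℝ × EuclideanSpace ℝ (Fin d) × ℝ => parPath z p.1 e p.2.1 p.2.2 := by
  unfold parPath
  fun_prop

theorem hasDerivAt_parPath (hu : ContDiff ℝ (⊤ : ℕ∞) u) (z : SpaceTime d) (a : ℝ)
    (e ξ : EuclideanSpace ℝ (Fin d)) (l : ℝ) :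
    HasDerivAt (fun l => u (parPath z a e ξ l))
      (2 * l * a * timeDeriv u (parPath z a e ξ l) +
        ∑ j, (ξ + e) j * spaceDeriv j u (parPath z a e ξ l)) l := by
  have h1 : HasFDerivAt u (fderiv ℝ u (parPath z a e ξ l)) (parPath z a e ξ l) :=
    (hu.differentiable (by simp)).differentiableAt.hasFDerivAt
  have h2 : HasDerivAt (parPath z a e ξ) (2 * l * a, ξ + e) l := by
    unfold parPath
    refine HasDerivAt.prodMk ?_ ?_
    · have := (((hasDerivAt_id l).pow 2).mul_const a).const_add z.1
      simpa using this
    · have := ((hasDerivAt_id l).smul_const (ξ + e)).const_add z.2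
      simpa using this
  have h3 := h1.comp_hasDerivAt l h2
  suffices heq : 2 * l * a * timeDeriv u (parPath z a e ξ l) +
      ∑ j, (ξ + e) j * spaceDeriv j u (parPath z a e ξ l) =
        fderiv ℝ u (parPath z a e ξ l) (2 * l * a, ξ + e) by
    rw [heq]; exact h3
  rw [timeDeriv_eq_fderiv hu]
  simp_rw [spaceDeriv_eq_fderiv hu]
  have h4 : ((2 * l * a, ξ + e) : SpaceTime d) = (2 * l * a) • ((1 : ℝ), (0 : EuclideanSpace ℝ (Fin d))) +
      ∑ j, (ξ + e) j • ((0 : ℝ), EuclideanSpace.single j (1 : ℝ)) := by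
    ext k
    · simp [Prod.fst_sum]
    · simp [Prod.snd_sum, Finset.sum_apply, Pi.single_apply]
  rw [h4, map_add, map_smul, map_sum]
  simp only [smul_eq_mul, map_smul]

theorem hasFDerivAt_parPath (hu : ContDiff ℝ (⊤ : ℕ∞) u) (z : SpaceTime d) (a : ℝ)
    (e ξ : EuclideanSpace ℝ (Fin d)) (l : ℝ) (i : Fin d) :
    DifferentiableAt ℝ (fun ξ => u (parPath z a e ξ l)) ξ ∧
      fderiv ℝ (fun ξ => u (parPath z a e ξ l)) ξ (EuclideanSpace.single i 1) =
        l * spaceDeriv i u (parPath z a e ξ l) := by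
  have h1 : HasFDerivAt u (fderiv ℝ u (parPath z a e ξ l)) (parPath z a e ξ l) :=
    (hu.differentiable (by simp)).differentiableAt.hasFDerivAt
  have h2 : HasFDerivAt (fun ξ => parPath z a e ξ l)
      ((0 : EuclideanSpace ℝ (Fin d) →L[ℝ] ℝ).prod (l • ContinuousLinearMap.id ℝ _)) ξ := by
    unfold parPath
    refine HasFDerivAt.prodMk (hasFDerivAt_const _ _) ?_
    exact (((hasFDerivAt_id ξ).add_const e).const_smul l).const_add z.2
  have h3 := h1.comp ξ h2
  refine ⟨h3.differentiableAt, ?_⟩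
  have h4 : (fun ξ => u (parPath z a e ξ l)) = u ∘ fun ξ => parPath z a e ξ l := rfl
  rw [h4, h3.fderiv, spaceDeriv_eq_fderiv hu, ← smul_eq_mul, ← map_smul]
  simp

/-- The path is shifted in space by lξ, so l D_i u is the ξ_i-derivative of u along it and the
derivative can be thrown on ψ. -/
theorem integral_mul_spaceDeriv_parPath (hu : ContDiff ℝ (⊤ : ℕ∞) u) (z : SpaceTime d) (a : ℝ)
    (e : EuclideanSpace ℝ (Fin d)) (l : ℝ) (i : Fin d) {ψ : EuclideanSpace ℝ (Fin d) → ℝ}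
    (hψ : ContDiff ℝ (⊤ : ℕ∞) ψ) (hψc : HasCompactSupport ψ) :
    ∫ ξ, ψ ξ * (l * spaceDeriv i u (parPath z a e ξ l)) =
      -∫ ξ, fderiv ℝ ψ ξ (EuclideanSpace.single i 1) * u (parPath z a e ξ l) := by
  have hpc : Continuous fun ξ => parPath z a e ξ l :=
    (continuous_parPath z e).comp (f := fun ξ => (a, ξ, l)) (by fun_prop)
  have huc : Continuous fun ξ => u (parPath z a e ξ l) := hu.continuous.comp hpc
  have hdc : Continuous fun ξ => l * spaceDeriv i u (parPath z a e ξ l) :=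
    continuous_const.mul ((contDiff_spaceDeriv hu i).continuous.comp hpc)
  have hψ' : Continuous fun ξ => fderiv ℝ ψ ξ (EuclideanSpace.single i 1) :=
    (hψ.continuous_fderiv (by simp)).clm_apply continuous_const
  have hψ'c : HasCompactSupport fun ξ => fderiv ℝ ψ ξ (EuclideanSpace.single i 1) :=
    hψc.fderiv_apply (𝕜 := ℝ) _
  simp_rw [← fun ξ => (hasFDerivAt_parPath hu z a e ξ l i).2] at hdc ⊢
  refine integral_mul_fderiv_eq_neg_fderiv_mul_of_integrable ?_ ?_ ?_ ?_ ?_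
  · exact (hψ'.mul huc).integrable_of_hasCompactSupport hψ'c.mul_right
  · exact (hψ.continuous.mul hdc).integrable_of_hasCompactSupport hψc.mul_right
  · exact (hψ.continuous.mul huc).integrable_of_hasCompactSupport hψc.mul_right
  · exact fun ξ _ => (hψ.differentiable (by simp)).differentiableAt
  · exact fun ξ _ => (hasFDerivAt_parPath hu z a e ξ l i).1

theorem exists_bump (d : ℕ) : ∃ (ψ : EuclideanSpace ℝ (Fin d) → ℝ) (C : ℝ≥0),
    ContDiff ℝ (⊤ : ℕ∞) ψ ∧ HasCompactSupport ψ ∧ tsupport ψ ⊆ Metric.ball 0 1 ∧ ∫ ξ, ψ ξ = 1 ∧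
      (∀ ξ, |ψ ξ| ≤ C) ∧ ∀ ξ, ‖fderiv ℝ ψ ξ‖ ≤ C := by
  let b : ContDiffBump (0 : EuclideanSpace ℝ (Fin d)) := ⟨1 / 4, 1 / 2, by norm_num, by norm_num⟩
  set ψ := b.normed volume with hψdef
  have hψ : ContDiff ℝ (⊤ : ℕ∞) ψ := b.contDiff_normed
  have hc : HasCompactSupport ψ := b.hasCompactSupport_normed
  obtain ⟨C1, h1⟩ := hc.exists_bound_of_continuous hψ.continuous
  obtain ⟨C2, h2⟩ := (hc.fderiv (𝕜 := ℝ)).exists_bound_of_continuous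
    (hψ.continuous_fderiv (by simp))
  refine ⟨ψ, (max C1 C2).toNNReal, hψ, hc, ?_, b.integral_normed, fun ξ => ?_, fun ξ => ?_⟩
  · rw [hψdef, b.tsupport_normed_eq]
    exact Metric.closedBall_subset_ball (by norm_num)
  · exact (h1 ξ).trans ((le_max_left _ _).trans (Real.le_coe_toNNReal _))
  · exact (h2 ξ).trans ((le_max_right _ _).trans (Real.le_coe_toNNReal _))

theorem abs_spaceDeriv_spaceDeriv_le (u : SpaceTime d → ℝ) (z : SpaceTime d) (i j : Fin d) :
    |spaceDeriv j (spaceDeriv i u) z| ≤ ‖spaceHess u z‖ :=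
  PiLp.norm_apply_le (spaceHess u z) (j, i)

/-! ### Representation of the gradient and its bound by potentials. -/

variable {d : ℕ} {u : SpaceTime d → ℝ}

/-- The sum `|∂_t u| + |D²u|`. -/
abbrev heatSize (u : SpaceTime d → ℝ) (z : SpaceTime d) : ℝ := |timeDeriv u z| + ‖spaceHess u z‖

theorem continuous_heatSize (hu : ContDiff ℝ (⊤ : ℕ∞) u) : Continuous (heatSize u) :=
  (contDiff_timeDeriv hu).continuous.abs.add (continuous_spaceHess hu).norm

/-- A representation of the spatial derivatives by means along a parabolic path. -/
theorem spaceDeriv_eq_integral (hu : ContDiff ℝ (⊤ : ℕ∞) u) (z : SpaceTime d) (a : ℝ)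
    (e : EuclideanSpace ℝ (Fin d)) {L : ℝ} (hL : 0 < L) (i : Fin d)
    {ψ : EuclideanSpace ℝ (Fin d) → ℝ}
    (hψ : ContDiff ℝ (⊤ : ℕ∞) ψ) (hψc : HasCompactSupport ψ) (hψ1 : ∫ ξ, ψ ξ = 1) :
    spaceDeriv i u z =
      -(L⁻¹ * ∫ ξ, fderiv ℝ ψ ξ (EuclideanSpace.single i 1) * u (parPath z a e ξ L)) -
      ∫ l in (0 : ℝ)..L, ∫ ξ, (-(2 * a * (fderiv ℝ ψ ξ (EuclideanSpace.single i 1) *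
          timeDeriv u (parPath z a e ξ l))) + ψ ξ * ∑ j, (ξ + e) j *
            spaceDeriv j (spaceDeriv i u) (parPath z a e ξ l)) := by
  set v := spaceDeriv i u with hv
  have hvs : ContDiff ℝ (⊤ : ℕ∞) v := contDiff_spaceDeriv hu i
  set V : ℝ → EuclideanSpace ℝ (Fin d) → ℝ := fun l ξ =>
    2 * l * a * timeDeriv v (parPath z a e ξ l) +
      ∑ j, (ξ + e) j * spaceDeriv j v (parPath z a e ξ l) with hV
  have hpath : Continuous fun p : ℝ × EuclideanSpace ℝ (Fin d) => parPath z a e p.2 p.1 :=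
    (continuous_parPath z e).comp (f := fun p : ℝ × EuclideanSpace ℝ (Fin d) => (a, p.2, p.1))
      (by fun_prop)
  have hVc : Continuous (Function.uncurry V) := by
    refine Continuous.add (Continuous.mul (by fun_prop)
      ((contDiff_timeDeriv hvs).continuous.comp hpath)) ?_
    refine continuous_finsetSum _ fun j _ => Continuous.mul ?_
      ((contDiff_spaceDeriv hvs j).continuous.comp hpath)
    fun_prop
  have hftc : ∀ ξ, v z = v (parPath z a e ξ L) - ∫ l in (0 : ℝ)..L, V l ξ := by
    intro ξ
    rw [intervalIntegral.integral_eq_sub_of_hasDerivAt (f := fun l => v (parPath z a e ξ l))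
      (fun l _ => hasDerivAt_parPath hvs z a e ξ l)]
    · rw [parPath_zero]; ring
    · exact (hVc.comp (Continuous.prodMk_left ξ)).intervalIntegrable _ _
  have hint1 : Integrable fun ξ => ψ ξ * v (parPath z a e ξ L) :=
    (hψ.continuous.mul (hvs.continuous.comp (hpath.comp (Continuous.prodMk_right L)))).integrable_of_hasCompactSupport
      hψc.mul_right
  -- The integrand is continuous and vanishes for ξ outside the compact support of ψ, so Fubini's
  -- theorem applies on (0, L] × ℝ^d.
  have hprod : Integrable (Function.uncurry fun l ξ => ψ ξ * V l ξ)
      ((volume.restrict (Set.uIoc 0 L)).prod volume) := by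
    have hcont : Continuous (Function.uncurry fun l ξ => ψ ξ * V l ξ) :=
      (hψ.continuous.comp continuous_snd).mul hVc
    have h1 : IntegrableOn (Function.uncurry fun l ξ => ψ ξ * V l ξ)
        (Set.Icc 0 L ×ˢ tsupport ψ) (volume.prod volume) :=
      hcont.continuousOn.integrableOn_compact (isCompact_Icc.prod hψc)
    have h2 : IntegrableOn (Function.uncurry fun l ξ => ψ ξ * V l ξ)
        (Set.uIoc 0 L ×ˢ Set.univ) (volume.prod volume) := by
      refine h1.of_forall_sdiff_eq_zero (measurableSet_uIoc.prod MeasurableSet.univ) ?_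
      rintro ⟨l, ξ⟩ ⟨hl, hn⟩
      have hl1 : l ∈ Set.Icc 0 L := by
        have := hl.1
        rw [Set.uIoc_of_le hL.le] at this
        exact Set.Ioc_subset_Icc_self this
      have hξ : ξ ∉ tsupport ψ := fun h => hn ⟨hl1, h⟩
      simp [Function.uncurry, image_eq_zero_of_notMem_tsupport hξ]
    rw [IntegrableOn, ← Measure.prod_restrict, Measure.restrict_univ] at h2
    exact h2
  have hswap := intervalIntegral_integral_swap hprod
  have hint2 : Integrable fun ξ => ∫ l in (0 : ℝ)..L, ψ ξ * V l ξ := by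
    have := hprod.integral_prod_right
    simp_rw [intervalIntegral.integral_of_le hL.le]
    rw [Set.uIoc_of_le hL.le] at this
    exact this
  have hmain : v z = (∫ ξ, ψ ξ * v (parPath z a e ξ L)) -
      ∫ l in (0 : ℝ)..L, ∫ ξ, ψ ξ * V l ξ := by
    rw [hswap, ← integral_sub hint1 hint2]
    calc v z = ∫ ξ, ψ ξ * v z := by rw [integral_mul_const, hψ1, one_mul]
      _ = _ := by
        refine integral_congr_ae (Filter.Eventually.of_forall fun ξ => ?_)
        simp only
        rw [intervalIntegral.integral_const_mul, ← mul_sub, ← hftc ξ]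
  rw [hmain]
  congr 1
  -- End point of the path: integrating D_i u by parts costs the factor L⁻¹.
  · rw [← mul_neg, ← integral_mul_spaceDeriv_parPath hu z a e L i hψ hψc, ← integral_const_mul]
    refine integral_congr_ae (Filter.Eventually.of_forall fun ξ => ?_)
    simp only [← hv]
    field_simp
  · refine intervalIntegral.integral_congr fun l _ => ?_
    simp only
    have hpl : Continuous fun ξ => parPath z a e ξ l := hpath.comp (Continuous.prodMk_right l)
    have hψ' : Continuous fun ξ => fderiv ℝ ψ ξ (EuclideanSpace.single i 1) :=
      (hψ.continuous_fderiv (by simp)).clm_apply continuous_const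
    have hψ'c : HasCompactSupport fun ξ => fderiv ℝ ψ ξ (EuclideanSpace.single i 1) :=
      hψc.fderiv_apply (𝕜 := ℝ) _
    have i1 : Integrable fun ξ => ψ ξ * ∑ j, (ξ + e) j * spaceDeriv j v (parPath z a e ξ l) := by
      refine (hψ.continuous.mul (continuous_finsetSum _ fun j _ => Continuous.mul (by fun_prop)
        ((contDiff_spaceDeriv hvs j).continuous.comp hpl))).integrable_of_hasCompactSupport
        hψc.mul_right
    have i2 : Integrable fun ξ => ψ ξ * (2 * l * a * timeDeriv v (parPath z a e ξ l)) :=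
      (hψ.continuous.mul (continuous_const.mul
        ((contDiff_timeDeriv hvs).continuous.comp hpl))).integrable_of_hasCompactSupport
        hψc.mul_right
    have i3 : Integrable fun ξ => fderiv ℝ ψ ξ (EuclideanSpace.single i 1) *
        timeDeriv u (parPath z a e ξ l) :=
      (hψ'.mul ((contDiff_timeDeriv hu).continuous.comp hpl)).integrable_of_hasCompactSupport
        hψ'c.mul_right
    simp only [hV, mul_add]
    have i4 : Integrable fun ξ => -(2 * a * (fderiv ℝ ψ ξ (EuclideanSpace.single i 1) *
        timeDeriv u (parPath z a e ξ l))) := (i3.const_mul (2 * a)).neg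
    rw [integral_add i2 i1, integral_add i4 i1]
    congr 1
    -- The factor l in 2la ∂_t D_i u, which comes from the time motion l²a, is exactly what the
    -- integration by parts consumes, so ∂_t u appears without a singular factor.
    rw [integral_neg, integral_const_mul, ← mul_neg,
      ← integral_mul_spaceDeriv_parPath (contDiff_timeDeriv hu) z a e l i hψ hψc,
      ← integral_const_mul]
    refine integral_congr_ae (Filter.Eventually.of_forall fun ξ => ?_)
    simp only [hv, timeDeriv_spaceDeriv hu i]
    ring

/-- The bound of the spatial derivatives by means along a parabolic path. -/
theorem enorm_spaceDeriv_le_path (d : ℕ) : ∃ C : ℝ≥0, ∀ (u : SpaceTime d → ℝ)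
    (_ : ContDiff ℝ (⊤ : ℕ∞) u) (z : SpaceTime d) (a : ℝ) (_ : |a| ≤ 1)
    (e : EuclideanSpace ℝ (Fin d)) (_ : ‖e‖ ≤ 1) (L : ℝ) (_ : 0 < L) (i : Fin d),
    ‖spaceDeriv i u z‖ₑ ≤
      C * ((ENNReal.ofReal L)⁻¹ * ∫⁻ ξ in Metric.ball 0 1, ‖u (parPath z a e ξ L)‖ₑ) +
      C * ∫⁻ l in Set.Ioc 0 L, ∫⁻ ξ in Metric.ball 0 1, ‖heatSize u (parPath z a e ξ l)‖ₑ := by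
  obtain ⟨ψ, C, hψ, hψc, hψs, hψ1, hC1, hC2⟩ := exists_bump d
  -- The term with ∂_t u needs 2|a| ≤ 2; the Hessian term has d summands with |(ξ + e)_j| ≤ 2.
  refine ⟨C * (2 + 2 * d), ?_⟩
  intro u hu z a ha e he L hL i
  have hout : ∀ ξ ∉ Metric.ball (0 : EuclideanSpace ℝ (Fin d)) 1,
      ψ ξ = 0 ∧ fderiv ℝ ψ ξ (EuclideanSpace.single i 1) = 0 := by
    intro ξ hξ
    have h1 : ξ ∉ tsupport ψ := fun h => hξ (hψs h)
    have h2 : ξ ∉ tsupport (fderiv ℝ ψ) := fun h => h1 (tsupport_fderiv_subset ℝ h)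
    exact ⟨image_eq_zero_of_notMem_tsupport h1, by rw [image_eq_zero_of_notMem_tsupport h2]; rfl⟩
  have hD : ∀ ξ, |fderiv ℝ ψ ξ (EuclideanSpace.single i 1)| ≤ C := by
    intro ξ
    have := (fderiv ℝ ψ ξ).le_opNorm (EuclideanSpace.single i 1)
    rw [PiLp.norm_single, norm_one, mul_one] at this
    exact this.trans (hC2 ξ)
  have hCle : C ≤ C * (2 + 2 * d) := by
    refine le_mul_of_one_le_right zero_le ?_
    have : (0 : ℝ≥0) ≤ 2 * d := zero_le
    calc (1 : ℝ≥0) ≤ 2 + 0 := by norm_num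
      _ ≤ 2 + 2 * d := by gcongr
  have bound : ∀ (G : EuclideanSpace ℝ (Fin d) → ℝ) (H : EuclideanSpace ℝ (Fin d) → ℝ)
      (_ : ∀ ξ ∈ Metric.ball (0 : EuclideanSpace ℝ (Fin d)) 1, |G ξ| ≤ (C * (2 + 2 * d) : ℝ≥0) * |H ξ|)
      (_ : ∀ ξ ∉ Metric.ball (0 : EuclideanSpace ℝ (Fin d)) 1, G ξ = 0),
      ‖∫ ξ, G ξ‖ₑ ≤ (C * (2 + 2 * d) : ℝ≥0) * ∫⁻ ξ in Metric.ball 0 1, ‖H ξ‖ₑ := by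
    intro G H h1 h2
    refine (enorm_integral_le_lintegral_enorm _).trans ?_
    rw [← lintegral_const_mul' _ _ ENNReal.coe_ne_top, ← lintegral_indicator measurableSet_ball]
    refine lintegral_mono fun ξ => ?_
    by_cases hξ : ξ ∈ Metric.ball (0 : EuclideanSpace ℝ (Fin d)) 1
    · rw [Set.indicator_of_mem hξ, ← ofReal_norm, ← ofReal_norm, ← ENNReal.ofReal_coe_nnreal,
        ← ENNReal.ofReal_mul (NNReal.coe_nonneg _)]
      exact ENNReal.ofReal_le_ofReal (h1 ξ hξ)
    · rw [h2 ξ hξ]; simp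
  have hrep := spaceDeriv_eq_integral hu z a e hL i hψ hψc hψ1
  rw [hrep]
  refine enorm_sub_le.trans (add_le_add ?_ ?_)
  · rw [enorm_neg, enorm_mul, mul_left_comm]
    have hLi : ‖L⁻¹‖ₑ = (ENNReal.ofReal L)⁻¹ := by
      rw [← ofReal_norm, Real.norm_of_nonneg (by positivity), ENNReal.ofReal_inv_of_pos hL]
    rw [hLi]
    gcongr
    refine bound _ _ (fun ξ _ => ?_) fun ξ hξ => by rw [(hout ξ hξ).2, zero_mul]
    rw [abs_mul]
    gcongr
    exact (hD ξ).trans (by exact_mod_cast hCle)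
  · rw [intervalIntegral.integral_of_le hL.le, ← lintegral_const_mul' _ _ ENNReal.coe_ne_top]
    refine (enorm_integral_le_lintegral_enorm _).trans (lintegral_mono fun l => ?_)
    refine bound _ _ (fun ξ hξ => ?_) fun ξ hξ => by rw [(hout ξ hξ).1, (hout ξ hξ).2]; simp
    set y := parPath z a e ξ l
    have hsum : |∑ j, (ξ + e) j * spaceDeriv j (spaceDeriv i u) y| ≤ 2 * d * ‖spaceHess u y‖ := by
      calc |∑ j, (ξ + e) j * spaceDeriv j (spaceDeriv i u) y|
          ≤ ∑ j : Fin d, |(ξ + e) j * spaceDeriv j (spaceDeriv i u) y| :=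
            Finset.abs_sum_le_sum_abs _ _
        _ ≤ ∑ j : Fin d, 2 * ‖spaceHess u y‖ := by
            refine Finset.sum_le_sum fun j _ => ?_
            rw [abs_mul]
            refine mul_le_mul ?_ (abs_spaceDeriv_spaceDeriv_le u y i j) (abs_nonneg _) (by norm_num)
            have h1 : |(ξ + e) j| ≤ ‖ξ + e‖ := PiLp.norm_apply_le (ξ + e) j
            have h2 := norm_add_le ξ e
            have h3 : ‖ξ‖ < 1 := by simpa using hξ
            linarith
        _ = 2 * d * ‖spaceHess u y‖ := by
            rw [Finset.sum_const, Finset.card_univ, Fintype.card_fin, nsmul_eq_mul]; ring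
    have hCn : (0 : ℝ) ≤ C := C.coe_nonneg
    have hT : |-(2 * a * (fderiv ℝ ψ ξ (EuclideanSpace.single i 1) * timeDeriv u y))| ≤
        2 * C * |timeDeriv u y| := by
      rw [abs_neg, abs_mul, abs_mul, abs_mul, abs_two]
      calc 2 * |a| * (|fderiv ℝ ψ ξ (EuclideanSpace.single i 1)| * |timeDeriv u y|)
          ≤ 2 * 1 * (C * |timeDeriv u y|) := by gcongr; exact hD ξ
        _ = _ := by ring
    have hS : |ψ ξ * ∑ j, (ξ + e) j * spaceDeriv j (spaceDeriv i u) y| ≤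
        C * (2 * d * ‖spaceHess u y‖) := by
      rw [abs_mul]
      exact mul_le_mul (hC1 ξ) hsum (abs_nonneg _) hCn
    have hpos : |heatSize u y| = |timeDeriv u y| + ‖spaceHess u y‖ :=
      abs_of_nonneg (by positivity)
    rw [hpos]
    refine (abs_add_le _ _).trans ((add_le_add hT hS).trans ?_)
    push_cast
    have t0 : 0 ≤ (C : ℝ) * (2 * d) * |timeDeriv u y| := by positivity
    have t1 : 0 ≤ (C : ℝ) * 2 * ‖spaceHess u y‖ := by positivity
    nlinarith

/-- The potential `λ^{-d-2} ∫ g` over the two-sided cylinder of radius `2λ`. -/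
def potAvg (g : SpaceTime d → ℝ≥0∞) (z : SpaceTime d) (l : ℝ) : ℝ≥0∞ :=
  (ENNReal.ofReal (l ^ (d + 2)))⁻¹ * ∫⁻ w in parBox z (2 * l), g w

theorem lintegral_comp_add_smul {E : Type*} [NormedAddCommGroup E] [NormedSpace ℝ E]
    [FiniteDimensional ℝ E] [MeasurableSpace E] [BorelSpace E] (μ : Measure E)
    [μ.IsAddHaarMeasure] (c : E) {l : ℝ} (hl : 0 < l) {g : E → ℝ≥0∞} (hg : Measurable g) :
    ∫⁻ ξ, g (c + l • ξ) ∂μ = (ENNReal.ofReal (l ^ Module.finrank ℝ E))⁻¹ * ∫⁻ y, g y ∂μ := by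
  have h1 : ∫⁻ ξ, g (c + l • ξ) ∂μ = ∫⁻ y, g (c + y) ∂(μ.map (l • ·)) := by
    rw [lintegral_map (by fun_prop) (by fun_prop)]
  rw [h1, Measure.map_addHaar_smul μ hl.ne', lintegral_smul_measure, lintegral_add_left_eq_self,
    abs_of_pos (by positivity), ENNReal.ofReal_inv_of_pos (by positivity), smul_eq_mul]

/-- Averaging over τ as well makes the map (τ, ξ) ↦ path point an affine change of variables in
space-time with Jacobian l^{d+2}. Its image lies in the box of radius 2l because |τ + a| ≤ 2 < 4 and
‖ξ + e‖ < 2. -/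
theorem lintegral_parPath_le {g : SpaceTime d → ℝ≥0∞} (hg : Measurable g) (z : SpaceTime d)
    {a : ℝ} (ha : |a| ≤ 1) {e : EuclideanSpace ℝ (Fin d)} (he : ‖e‖ ≤ 1) {l : ℝ} (hl : 0 < l) :
    ∫⁻ τ in Set.Ioo (0 : ℝ) 1, ∫⁻ ξ in Metric.ball 0 1, g (parPath z (τ + a) e ξ l) ≤
      potAvg g z l := by
  set G := (parBox z (2 * l)).indicator g with hG
  have hGm : Measurable G := hg.indicator (measurableSet_parBox _ _)
  have hl2 : 0 < l ^ 2 := by positivity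
  have hpt : ∀ τ ∈ Set.Ioo (0 : ℝ) 1, ∀ ξ ∈ Metric.ball (0 : EuclideanSpace ℝ (Fin d)) 1,
      parPath z (τ + a) e ξ l ∈ parBox z (2 * l) := by
    intro τ hτ ξ hξ
    have hξ : ‖ξ‖ < 1 := by simpa using hξ
    rw [abs_le] at ha
    refine ⟨?_, ?_⟩
    · rw [Metric.mem_ball, Real.dist_eq, parPath, add_sub_cancel_left, abs_mul, abs_of_pos hl2]
      have : |τ + a| < 4 := by rw [abs_lt]; constructor <;> linarith [hτ.1, hτ.2]
      nlinarith
    · rw [Metric.mem_ball, parPath, dist_self_add_left, norm_smul, Real.norm_of_nonneg hl.le]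
      have := norm_add_le ξ e
      nlinarith
  calc ∫⁻ τ in Set.Ioo (0 : ℝ) 1, ∫⁻ ξ in Metric.ball 0 1, g (parPath z (τ + a) e ξ l)
      ≤ ∫⁻ τ in Set.Ioo (0 : ℝ) 1, ∫⁻ ξ in Metric.ball 0 1, G (parPath z (τ + a) e ξ l) := by
        refine setLIntegral_mono' measurableSet_Ioo fun τ hτ => ?_
        refine setLIntegral_mono' measurableSet_ball fun ξ hξ => ?_
        rw [hG, Set.indicator_of_mem (hpt τ hτ ξ hξ)]
    _ ≤ ∫⁻ τ : ℝ, ∫⁻ ξ, G (parPath z (τ + a) e ξ l) := by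
        refine (setLIntegral_le_lintegral _ _).trans ?_
        exact lintegral_mono fun τ => setLIntegral_le_lintegral _ _
    _ = ∫⁻ τ : ℝ, (ENNReal.ofReal (l ^ d))⁻¹ * ∫⁻ y, G (z.1 + l ^ 2 * (τ + a), y) := by
        refine lintegral_congr fun τ => ?_
        have := lintegral_comp_add_smul (volume : Measure (EuclideanSpace ℝ (Fin d)))
          (z.2 + l • e) hl (g := fun y => G (z.1 + l ^ 2 * (τ + a), y))
          (hGm.comp measurable_prodMk_left)
        rw [finrank_euclideanSpace_fin] at this
        rw [← this]
        refine lintegral_congr fun ξ => ?_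
        congr 1
        rw [parPath, smul_add, add_assoc, add_comm (l • e)]
    _ = (ENNReal.ofReal (l ^ d))⁻¹ * ∫⁻ τ : ℝ, ∫⁻ y, G (z.1 + l ^ 2 * (τ + a), y) := by
        refine lintegral_const_mul' _ _ (ENNReal.inv_ne_top.2 ?_)
        simp; positivity
    _ = (ENNReal.ofReal (l ^ d))⁻¹ * ((ENNReal.ofReal (l ^ 2))⁻¹ * ∫⁻ s : ℝ, ∫⁻ y, G (s, y)) := by
        have := lintegral_comp_add_smul (volume : Measure ℝ) (z.1 + l ^ 2 * a) hl2
          (g := fun s => ∫⁻ y, G (s, y)) hGm.lintegral_prod_right'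
        rw [Module.finrank_self, pow_one] at this
        rw [← this]
        congr 1
        refine lintegral_congr fun τ => ?_
        congr 1
        ext y
        congr 2
        rw [smul_eq_mul]; ring
    _ = potAvg g z l := by
        rw [potAvg, ← lintegral_indicator (measurableSet_parBox _ _), Measure.volume_eq_prod,
          lintegral_prod _ hGm.aemeasurable, ← mul_assoc, pow_add,
          ENNReal.ofReal_mul (by positivity), ENNReal.mul_inv (Or.inr ENNReal.ofReal_ne_top)
            (Or.inl ENNReal.ofReal_ne_top)]

/-- The pointwise bound of the spatial derivatives by potentials. -/
theorem enorm_spaceDeriv_le_potAvg (d : ℕ) : ∃ C : ℝ≥0, ∀ (u : SpaceTime d → ℝ)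
    (_ : ContDiff ℝ (⊤ : ℕ∞) u) (Q : Set (SpaceTime d)) (_ : MeasurableSet Q) (z : SpaceTime d)
    (a : ℝ) (_ : -1 ≤ a) (_ : a ≤ 0) (e : EuclideanSpace ℝ (Fin d)) (_ : ‖e‖ ≤ 1) (L : ℝ)
    (_ : 0 < L) (_ : ∀ l ∈ Set.Ioc 0 L, ∀ τ ∈ Set.Ioo (0 : ℝ) 1,
      ∀ ξ ∈ Metric.ball (0 : EuclideanSpace ℝ (Fin d)) 1, parPath z (τ + a) e ξ l ∈ Q) (i : Fin d),
    ‖spaceDeriv i u z‖ₑ ≤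
      C * ((ENNReal.ofReal L)⁻¹ * potAvg (Q.indicator fun w => ‖u w‖ₑ) z L) +
      C * ∫⁻ l in Set.Ioc 0 L, potAvg (Q.indicator fun w => ‖heatSize u w‖ₑ) z l := by
  obtain ⟨C, hC⟩ := enorm_spaceDeriv_le_path d
  refine ⟨C, fun u hu Q hQ z a ha1 ha0 e he L hL hpath i => ?_⟩
  have hum : Measurable (Q.indicator fun w => ‖u w‖ₑ) :=
    hu.continuous.enorm.measurable.indicator hQ
  have hfm : Measurable (Q.indicator fun w => ‖heatSize u w‖ₑ) :=
    (continuous_heatSize hu).enorm.measurable.indicator hQ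
  have ha : |a| ≤ 1 := by rw [abs_le]; constructor <;> linarith
  have hpm : Measurable fun p : (ℝ × ℝ) × EuclideanSpace ℝ (Fin d) =>
      parPath z (p.1.1 + a) e p.2 p.1.2 :=
    ((continuous_parPath z e).comp (f := fun p : (ℝ × ℝ) × EuclideanSpace ℝ (Fin d) =>
      (p.1.1 + a, p.2, p.1.2)) (by fun_prop)).measurable
  have hjoint : ∀ {G : SpaceTime d → ℝ≥0∞} (_ : Measurable G), Measurable fun p : ℝ × ℝ =>
      ∫⁻ ξ in Metric.ball 0 1, G (parPath z (p.1 + a) e ξ p.2) := by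
    intro G hG
    exact (hG.comp hpm).lintegral_prod_right'
  set U := Q.indicator fun w => ‖u w‖ₑ
  set F := Q.indicator fun w => ‖heatSize u w‖ₑ
  have hτ : ∀ τ ∈ Set.Ioo (0 : ℝ) 1, ‖spaceDeriv i u z‖ₑ ≤
      C * ((ENNReal.ofReal L)⁻¹ * ∫⁻ ξ in Metric.ball 0 1, U (parPath z (τ + a) e ξ L)) +
      C * ∫⁻ l in Set.Ioc 0 L, ∫⁻ ξ in Metric.ball 0 1, F (parPath z (τ + a) e ξ l) := by
    intro τ hτ
    refine (hC u hu z (τ + a) (by rw [abs_le]; constructor <;> linarith [hτ.1, hτ.2]) e he L hL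
      i).trans (le_of_eq ?_)
    have e1 : ∫⁻ ξ in Metric.ball 0 1, ‖u (parPath z (τ + a) e ξ L)‖ₑ =
        ∫⁻ ξ in Metric.ball 0 1, U (parPath z (τ + a) e ξ L) := by
      refine setLIntegral_congr_fun measurableSet_ball fun ξ hξ => ?_
      exact (Set.indicator_of_mem (hpath L ⟨hL, le_rfl⟩ τ hτ ξ hξ) fun w => ‖u w‖ₑ).symm
    have e2 : ∫⁻ l in Set.Ioc 0 L, ∫⁻ ξ in Metric.ball 0 1,
        ‖heatSize u (parPath z (τ + a) e ξ l)‖ₑ =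
          ∫⁻ l in Set.Ioc 0 L, ∫⁻ ξ in Metric.ball 0 1, F (parPath z (τ + a) e ξ l) := by
      refine setLIntegral_congr_fun measurableSet_Ioc fun l hl => ?_
      refine setLIntegral_congr_fun measurableSet_ball fun ξ hξ => ?_
      exact (Set.indicator_of_mem (hpath l hl τ hτ ξ hξ) fun w => ‖heatSize u w‖ₑ).symm
    rw [e1, e2]
  have hmU : Measurable fun τ : ℝ => ∫⁻ ξ in Metric.ball 0 1, U (parPath z (τ + a) e ξ L) :=
    (hjoint hum).comp (measurable_prodMk_right (y := L))
  -- The interval (0, 1) has length one, and the left side does not depend on τ.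
  calc ‖spaceDeriv i u z‖ₑ = ∫⁻ _ in Set.Ioo (0 : ℝ) 1, ‖spaceDeriv i u z‖ₑ := by simp
    _ ≤ ∫⁻ τ in Set.Ioo (0 : ℝ) 1,
          (C * ((ENNReal.ofReal L)⁻¹ * ∫⁻ ξ in Metric.ball 0 1, U (parPath z (τ + a) e ξ L)) +
          C * ∫⁻ l in Set.Ioc 0 L, ∫⁻ ξ in Metric.ball 0 1, F (parPath z (τ + a) e ξ l)) :=
        setLIntegral_mono' measurableSet_Ioo hτ
    _ = C * ((ENNReal.ofReal L)⁻¹ * ∫⁻ τ in Set.Ioo (0 : ℝ) 1,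
          ∫⁻ ξ in Metric.ball 0 1, U (parPath z (τ + a) e ξ L)) +
        C * ∫⁻ τ in Set.Ioo (0 : ℝ) 1, ∫⁻ l in Set.Ioc 0 L,
          ∫⁻ ξ in Metric.ball 0 1, F (parPath z (τ + a) e ξ l) := by
        rw [lintegral_add_left ((hmU.const_mul _).const_mul _),
          lintegral_const_mul _ (hmU.const_mul _), lintegral_const_mul _ hmU,
          lintegral_const_mul' _ _ ENNReal.coe_ne_top]
    _ = C * ((ENNReal.ofReal L)⁻¹ * ∫⁻ τ in Set.Ioo (0 : ℝ) 1,
          ∫⁻ ξ in Metric.ball 0 1, U (parPath z (τ + a) e ξ L)) +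
        C * ∫⁻ l in Set.Ioc 0 L, ∫⁻ τ in Set.Ioo (0 : ℝ) 1,
          ∫⁻ ξ in Metric.ball 0 1, F (parPath z (τ + a) e ξ l) := by
        congr 2
        exact lintegral_lintegral_swap (hjoint hfm).aemeasurable
    _ ≤ _ := by
        gcongr C * (_ * ?_) + C * ?_
        · exact lintegral_parPath_le hum z ha he hL
        · exact setLIntegral_mono' measurableSet_Ioc fun l hl =>
            lintegral_parPath_le hfm z ha he hl.1

/-! ### Potentials against the maximal function and the Morrey norm. -/

variable {d : ℕ} {u : SpaceTime d → ℝ}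

theorem potAvg_le_parMax (g : SpaceTime d → ℝ≥0∞) (z : SpaceTime d) {l : ℝ} (hl : 0 < l) :
    potAvg g z l ≤ ENNReal.ofReal (2 * 4 ^ (d + 2)) * unitVol d * parMax g z := by
  -- A dyadic radius with 2l ≤ 2^k ≤ 4l; the upper bound is the source of 4^{d+2}.
  obtain ⟨n, hn1, hn2⟩ := exists_mem_Ioc_zpow (show (0 : ℝ) < 2 * l by positivity)
    (show (1 : ℝ) < 2 by norm_num)
  set k := n + 1 with hk
  have hk2 : (2 : ℝ) ^ k ≤ 4 * l := by
    rw [hk, zpow_add_one₀ (by norm_num)]; linarith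
  have h4 : (4 : ℝ) ^ k = (2 ^ k) ^ 2 := by
    rw [show (4 : ℝ) = 2 ^ 2 by norm_num, ← zpow_natCast, ← zpow_natCast, ← zpow_mul, ← zpow_mul,
      mul_comm]
  have hsub : parBox z (2 * l) ⊆ parBall z k := by
    refine Set.prod_mono (Metric.ball_subset_ball ?_) (Metric.ball_subset_ball hn2)
    rw [h4]
    gcongr
  have hV : volume (parBall z k) ≤ ENNReal.ofReal (l ^ (d + 2)) *
      (ENNReal.ofReal (2 * 4 ^ (d + 2)) * unitVol d) := by
    rw [volume_parBall, volume_timeBall, volume_spaceBall _ (by positivity), ← mul_assoc,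
      ← mul_assoc, ← ENNReal.ofReal_mul (by positivity), ← ENNReal.ofReal_mul (by positivity)]
    refine mul_le_mul' (ENNReal.ofReal_le_ofReal ?_) le_rfl
    rw [h4]
    calc 2 * ((2 : ℝ) ^ k) ^ 2 * (2 ^ k) ^ d ≤ 2 * (4 * l) ^ 2 * (4 * l) ^ d := by gcongr
      _ = l ^ (d + 2) * (2 * 4 ^ (d + 2)) := by ring
  have hV0 := volume_parBall_ne_zero z k
  have hVt := volume_parBall_ne_top z k
  have hl0 : ENNReal.ofReal (l ^ (d + 2)) ≠ 0 := by simp; positivity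
  set C := ENNReal.ofReal (2 * 4 ^ (d + 2)) * unitVol d
  calc potAvg g z l ≤ (ENNReal.ofReal (l ^ (d + 2)))⁻¹ * ∫⁻ w in parBall z k, g w := by
        unfold potAvg
        gcongr
    _ = (ENNReal.ofReal (l ^ (d + 2)))⁻¹ * (volume (parBall z k) * lavg volume (parBall z k) g) := by
        rw [lavg, ← mul_assoc (volume _), ENNReal.mul_inv_cancel hV0 hVt, one_mul]
    _ ≤ (ENNReal.ofReal (l ^ (d + 2)))⁻¹ * (ENNReal.ofReal (l ^ (d + 2)) * C * parMax g z) := by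
        gcongr
        exact lavg_le_maximalFn z k
    _ = C * parMax g z := by
        rw [mul_assoc, ← mul_assoc, ENNReal.inv_mul_cancel hl0 ENNReal.ofReal_ne_top, one_mul]

/-- The constant in the bound of the potential by the Morrey norm. -/
def potConst (d : ℕ) (β : ℝ) : ℝ≥0∞ := 4 ^ (d + 2 - β) * unitVol d

theorem potConst_ne_top (d : ℕ) (β : ℝ) : potConst d β ≠ ⊤ :=
  ENNReal.mul_ne_top (ENNReal.rpow_ne_top_of_ne_zero (by simp) (by simp)) unitVol_ne_top

/-- The box of radius 2l is covered within C_R by a cylinder of radius 4l, whose integral is of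
order l^{d+2-β}; division by l^{d+2} leaves l^{-β}. -/
theorem potAvg_le_lmorrey {p q : ℝ} (hp : 1 ≤ p) (hq : 1 ≤ q) (β : ℝ) (R : ℝ≥0∞)
    {f : SpaceTime d → ℝ≥0∞} (hf : Measurable f) {z : SpaceTime d} (hz : z ∈ cylinder R 0)
    {l : ℝ} (hl : 0 < l) :
    potAvg ((cylinder R 0).indicator f) z l ≤
      potConst d β * lmorrey p q β (cylinder R 0) f * ENNReal.ofReal l ^ (-β) := by
  lift l to ℝ≥0 using hl.le
  have hl' : 0 < l := by exact_mod_cast hl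
  have h0 : (l : ℝ≥0∞) ≠ 0 := by simpa using hl'.ne'
  have h1 := setLIntegral_parBox_le_lmorrey hp hq β R hf (r := 2 * l) (by positivity) hz
  unfold potAvg
  rw [ENNReal.ofReal_pow hl.le, ENNReal.ofReal_coe_nnreal]
  refine (mul_le_mul' le_rfl (by simpa using h1)).trans (le_of_eq ?_)
  have e1 : ((l : ℝ≥0∞) ^ (d + 2))⁻¹ = (l : ℝ≥0∞) ^ (-((d : ℝ) + 2)) := by
    rw [ENNReal.rpow_neg, ← ENNReal.rpow_natCast]; push_cast; rfl
  have e2 : (2 * (2 * (l : ℝ≥0∞))) ^ ((d : ℝ) + 2 - β) =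
      4 ^ ((d : ℝ) + 2 - β) * (l : ℝ≥0∞) ^ ((d : ℝ) + 2 - β) := by
    rw [← mul_assoc, ENNReal.mul_rpow_of_ne_top (by norm_num) ENNReal.coe_ne_top]
    norm_num
  have e3 : (l : ℝ≥0∞) ^ (-β) = (l : ℝ≥0∞) ^ (-((d : ℝ) + 2)) * (l : ℝ≥0∞) ^ ((d : ℝ) + 2 - β) := by
    rw [← ENNReal.rpow_add _ _ h0 ENNReal.coe_ne_top]; congr 1; ring
  rw [e1, e2, e3, potConst]
  ring

theorem norm_le_sum_abs (x : EuclideanSpace ℝ (Fin d)) : ‖x‖ ≤ ∑ i, |x i| := by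
  rw [EuclideanSpace.norm_eq]
  refine Real.sqrt_le_iff.2 ⟨Finset.sum_nonneg fun i _ => abs_nonneg _, ?_⟩
  exact Finset.sum_sq_le_sq_sum_of_nonneg fun i _ => norm_nonneg _

theorem enorm_spaceGrad_le (u : SpaceTime d → ℝ) (z : SpaceTime d) :
    ‖spaceGrad u z‖ₑ ≤ ∑ i, ‖spaceDeriv i u z‖ₑ := by
  have := ENNReal.ofReal_le_ofReal (norm_le_sum_abs (spaceGrad u z))
  rw [ofReal_norm, ENNReal.ofReal_sum_of_nonneg fun i _ => abs_nonneg _] at this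
  simp only [← Real.norm_eq_abs, ofReal_norm] at this
  exact this

/-- The pointwise bound of the gradient in a cylinder. -/
theorem enorm_spaceGrad_le_potential (d : ℕ) {p q β : ℝ} (hp : 1 ≤ p) (hq : 1 ≤ q)
    (hβ : 1 < β) : ∃ C : ℝ≥0∞, C ≠ ⊤ ∧ ∀ (R : ℝ≥0∞) (_ : 0 < R)
      (u : SpaceTime d → ℝ) (_ : ContDiff ℝ (⊤ : ℕ∞) u) (_ : HasCompactSupport u)
      (z : SpaceTime d) (_ : z ∈ cylinder R 0),
      ‖spaceGrad u z‖ₑ ≤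
        C * (∫⁻ l in Set.Ioi (0 : ℝ),
          potAvg ((cylinder R 0).indicator fun w => ‖heatSize u w‖ₑ) z l) +
        C * ((R ^ (1 + β))⁻¹ * lmorrey p q β (cylinder R 0) fun w => ‖u w‖ₑ) := by
  obtain ⟨C, hC⟩ := enorm_spaceDeriv_le_potAvg d
  have h1β : 0 < 1 + β := by linarith
  set D : ℝ≥0∞ := max 1 (2 ^ (1 + β) * potConst d β) with hD
  have hDt : D ≠ ⊤ := by
    rw [hD, Ne, max_eq_top]
    simp only [ENNReal.one_ne_top, false_or]
    exact ENNReal.mul_ne_top (ENNReal.rpow_ne_top_of_nonneg h1β.le (by simp)) (potConst_ne_top d β)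
  refine ⟨d * (C * D), ENNReal.mul_ne_top (by simp) (ENNReal.mul_ne_top ENNReal.coe_ne_top hDt), ?_⟩
  intro R hR u hu huc z hz
  set P := ∫⁻ l in Set.Ioi (0 : ℝ),
    potAvg ((cylinder R 0).indicator fun w => ‖heatSize u w‖ₑ) z l with hP
  set Φ := lmorrey p q β (cylinder R 0) fun w => ‖u w‖ₑ with hΦ
  suffices h : ∀ i, ‖spaceDeriv i u z‖ₑ ≤ C * D * P + C * D * ((R ^ (1 + β))⁻¹ * Φ) by
    calc ‖spaceGrad u z‖ₑ ≤ ∑ i, ‖spaceDeriv i u z‖ₑ := enorm_spaceGrad_le u z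
      _ ≤ ∑ _i : Fin d, (C * D * P + C * D * ((R ^ (1 + β))⁻¹ * Φ)) :=
          Finset.sum_le_sum fun i _ => h i
      _ = _ := by
          rw [Finset.sum_const, Finset.card_univ, Fintype.card_fin, nsmul_eq_mul]; ring
  intro i
  have hum : Measurable fun w => ‖u w‖ₑ := hu.continuous.enorm.measurable
  have hPle : ∀ L : ℝ, ∫⁻ l in Set.Ioc 0 L,
      potAvg ((cylinder R 0).indicator fun w => ‖heatSize u w‖ₑ) z l ≤ P := fun L =>
    lintegral_mono_set fun l hl => hl.1
  have hCD : (C : ℝ≥0∞) * P ≤ C * D * P := by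
    rw [mul_assoc]
    gcongr
    exact le_mul_of_one_le_left' (le_max_left _ _)
  have hQ := measurableSet_cylinder (d := d) R 0
  induction R with
  | top =>
    have hz1 : 0 ≤ z.1 := by simpa using (mem_cylinder_top 0 z).1 hz
    obtain ⟨B, hB⟩ := huc.exists_bound_of_continuous hu.continuous
    set K : ℝ≥0∞ := ENNReal.ofReal (2 * 4 ^ (d + 2)) * unitVol d * ENNReal.ofReal B with hK
    have hKt : K ≠ ⊤ := ENNReal.mul_ne_top (ENNReal.mul_ne_top ENNReal.ofReal_ne_top unitVol_ne_top)
      ENNReal.ofReal_ne_top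
    -- For R = ∞ the paths with a = 0, e = 0 run forward in time and never leave the half-space. As
    -- u is bounded, the u-term is O(1/L) and disappears as L → ∞.
    have hL : ∀ L : ℝ, 0 < L →
        ‖spaceDeriv i u z‖ₑ ≤ C * ((ENNReal.ofReal L)⁻¹ * K) + C * P := by
      intro L hL
      refine (hC u hu (cylinder ⊤ 0) hQ z 0 (by norm_num) le_rfl 0 (by simp) L hL ?_ i).trans ?_
      · intro l hl τ hτ ξ hξ
        rw [mem_cylinder_top]
        have := hτ.1
        simp only [parPath, Prod.fst_zero, add_zero]
        positivity
      · gcongr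
        · refine (potAvg_le_parMax _ z hL).trans ?_
          rw [hK]
          gcongr
          refine maximalFn_le_of_le (fun w => ?_) z
          refine (Set.indicator_le_self _ _ w).trans ?_
          rw [← ofReal_norm]
          exact ENNReal.ofReal_le_ofReal (hB w)
        · exact hPle L
    have hlim : Filter.Tendsto (fun n : ℕ => C * ((ENNReal.ofReal ((n : ℝ) + 1))⁻¹ * K) + C * P)
        Filter.atTop (nhds (C * (0 * K) + C * P)) := by
      refine Filter.Tendsto.add (ENNReal.Tendsto.const_mul (ENNReal.Tendsto.mul_const ?_
        (Or.inr hKt)) (Or.inr ENNReal.coe_ne_top)) tendsto_const_nhds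
      rw [← ENNReal.inv_top]
      refine tendsto_inv_iff.2 (ENNReal.tendsto_ofReal_atTop.comp ?_)
      exact Filter.tendsto_atTop_add_const_right _ _ tendsto_natCast_atTop_atTop
    have := ge_of_tendsto' hlim fun n => hL ((n : ℝ) + 1) (by positivity)
    rw [zero_mul, mul_zero, zero_add] at this
    exact this.trans (hCD.trans le_self_add)
  | coe R =>
    have hR0 : 0 < R := by exact_mod_cast hR
    have hR' : (0 : ℝ) < R := by exact_mod_cast hR0
    obtain ⟨hz2, hz1, hz3⟩ := (mem_cylinder_coe R 0 z).1 hz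
    simp only [Prod.fst_zero, Prod.snd_zero, zero_add, dist_zero_left] at hz1 hz2 hz3
    have hR2 : (0 : ℝ) < (R : ℝ) ^ 2 := by positivity
    have hL : (0 : ℝ) < R / 2 := by positivity
    -- With a = -t/R² and e = -x/R the path becomes (t(1 - l²/R²) + l²τ, (1 - l/R)x + lξ). Up to l =
    -- R/2 < R its coordinates are convex combinations of t and R²τ, and of x and Rξ, so it stays in
    -- C_R.
    refine (hC u hu (cylinder R 0) hQ z (-(z.1 / (R : ℝ) ^ 2)) ?_ ?_ (-((R : ℝ)⁻¹ • z.2)) ?_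
      (R / 2) hL ?_ i).trans ?_
    · rw [neg_le_neg_iff, div_le_one hR2]; exact hz3.le
    · rw [neg_nonpos]; positivity
    · rw [norm_neg, norm_smul, Real.norm_of_nonneg (by positivity), inv_mul_le_one₀ hR']
      exact hz2.le
    · intro l hl τ hτ ξ hξ
      have hξ : ‖ξ‖ < 1 := by simpa using hξ
      have hlR : l < R := by linarith [hl.2]
      have hl0 := hl.1
      have hlR2 : l ^ 2 < (R : ℝ) ^ 2 := by gcongr
      have hfrac : l ^ 2 / (R : ℝ) ^ 2 < 1 := by rw [div_lt_one hR2]; exact hlR2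
      rw [mem_cylinder_coe]
      simp only [parPath, Prod.fst_zero, Prod.snd_zero, zero_add, dist_zero_left]
      have e1 : z.1 + l ^ 2 * (τ + -(z.1 / (R : ℝ) ^ 2)) =
          z.1 * (1 - l ^ 2 / (R : ℝ) ^ 2) + l ^ 2 * τ := by field_simp; ring
      have e2 : z.2 + l • (ξ + -((R : ℝ)⁻¹ • z.2)) = (1 - l / R) • z.2 + l • ξ := by
        rw [smul_add, smul_neg, smul_smul, sub_smul, one_smul, div_eq_mul_inv]; abel
      rw [e1, e2]
      refine ⟨?_, ?_, ?_⟩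
      · have hlR1 : 0 < 1 - l / R := by rw [sub_pos, div_lt_one hR']; exact hlR
        calc ‖(1 - l / R) • z.2 + l • ξ‖ ≤ (1 - l / R) * ‖z.2‖ + l * ‖ξ‖ := by
              refine (norm_add_le _ _).trans (le_of_eq ?_)
              rw [norm_smul, norm_smul, Real.norm_of_nonneg hlR1.le, Real.norm_of_nonneg hl0.le]
          _ < (1 - l / R) * R + l * 1 := by gcongr
          _ = R := by field_simp; ring
      · have := hτ.1
        have : 0 ≤ 1 - l ^ 2 / (R : ℝ) ^ 2 := by linarith
        positivity
      · have h1 : 0 < 1 - l ^ 2 / (R : ℝ) ^ 2 := by linarith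
        calc z.1 * (1 - l ^ 2 / (R : ℝ) ^ 2) + l ^ 2 * τ
            < (R : ℝ) ^ 2 * (1 - l ^ 2 / (R : ℝ) ^ 2) + l ^ 2 * 1 := by gcongr; exact hτ.2
          _ = (R : ℝ) ^ 2 := by field_simp; ring
    · rw [add_comm]
      refine add_le_add ((mul_le_mul' le_rfl (hPle _)).trans hCD) ?_
      rw [mul_assoc (C : ℝ≥0∞)]
      refine mul_le_mul' le_rfl ?_
      refine (mul_le_mul' le_rfl (potAvg_le_lmorrey hp hq β R hum hz hL)).trans ?_
      have hRn : (R : ℝ≥0∞) ≠ 0 := by simpa using hR0.ne'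
      have e3 : ENNReal.ofReal ((R : ℝ) / 2) = R / 2 := by
        rw [ENNReal.ofReal_div_of_pos (by norm_num), ENNReal.ofReal_coe_nnreal]; norm_num
      have hH0 : (R : ℝ≥0∞) / 2 ≠ 0 := ENNReal.div_ne_zero.2 ⟨hRn, by simp⟩
      have hHt : (R : ℝ≥0∞) / 2 ≠ ⊤ := ENNReal.div_ne_top ENNReal.coe_ne_top (by simp)
      have e4 : ((R : ℝ≥0∞) / 2)⁻¹ * ((R : ℝ≥0∞) / 2) ^ (-β) =
          2 ^ (1 + β) * ((R : ℝ≥0∞) ^ (1 + β))⁻¹ := by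
        rw [← ENNReal.rpow_neg_one, ← ENNReal.rpow_add _ _ hH0 hHt,
          show -1 + -β = -(1 + β) by ring, ENNReal.rpow_neg, ENNReal.div_rpow_of_nonneg _ _ h1β.le,
          ENNReal.inv_div (Or.inl (ENNReal.rpow_ne_top_of_nonneg h1β.le (by simp)))
            (Or.inl (ENNReal.rpow_pos (by simp) (by simp)).ne'), div_eq_mul_inv]
      rw [e3]
      calc ((R : ℝ≥0∞) / 2)⁻¹ * (potConst d β * Φ * ((R : ℝ≥0∞) / 2) ^ (-β))
          = potConst d β * Φ * (((R : ℝ≥0∞) / 2)⁻¹ * ((R : ℝ≥0∞) / 2) ^ (-β)) := by ring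
        _ = (2 ^ (1 + β) * potConst d β) * (((R : ℝ≥0∞) ^ (1 + β))⁻¹ * Φ) := by rw [e4]; ring
        _ ≤ D * (((R : ℝ≥0∞) ^ (1 + β))⁻¹ * Φ) := by
            gcongr
            exact le_max_right _ _

/-! ### Localization and the embedding theorem. -/

theorem parBox_subset_parBox {z₀ z : SpaceTime d} {ρ : ℝ≥0} (hz : z ∈ cylinder (ρ : ℝ≥0∞) z₀)
    {l : ℝ} (hl : 0 < l) (hlρ : l ≤ ρ) : parBox z (2 * l) ⊆ parBox z₀ (3 * ρ) := by
  obtain ⟨h1, h2, h3⟩ := (mem_cylinder_coe ρ z₀ z).1 hz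
  rintro w ⟨hw1, hw2⟩
  rw [Metric.mem_ball] at hw1 hw2
  refine ⟨?_, ?_⟩
  · rw [Metric.mem_ball]
    rw [Real.dist_eq, abs_lt] at *
    have : l ^ 2 ≤ (ρ : ℝ) ^ 2 := by gcongr
    constructor <;> nlinarith
  · rw [Metric.mem_ball]
    have := dist_triangle w.2 z.2 z₀.2
    rw [dist_comm z.2] at this
    linarith

/-- The scales l ≤ ρ see f only inside the box of radius 3ρ about z₀, so the maximal function of the
cut-off suffices there. The scales l > ρ are summed by the Morrey bound l^{-β} alone, convergent
since β > 1. -/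
theorem lintegral_potAvg_le {p q β : ℝ} (hp : 1 ≤ p) (hq : 1 ≤ q) (hβ : 1 < β) (R : ℝ≥0∞)
    {f : SpaceTime d → ℝ≥0∞} (hf : Measurable f) {ρ : ℝ≥0} (hρ : 0 < ρ) {z₀ z : SpaceTime d}
    (hz : z ∈ cylinder R 0) (hzρ : z ∈ cylinder (ρ : ℝ≥0∞) z₀) :
    ∫⁻ l in Set.Ioi (0 : ℝ), potAvg ((cylinder R 0).indicator f) z l ≤
      ENNReal.ofReal (1 + 1 / (β - 1)) * ((ENNReal.ofReal (2 * 4 ^ (d + 2)) * unitVol d *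
        parMax ((parBox z₀ (3 * ρ)).indicator ((cylinder R 0).indicator f)) z) ^ (1 - 1 / β) *
          (potConst d β * lmorrey p q β (cylinder R 0) f) ^ (1 / β)) +
      ENNReal.ofReal (1 / (β - 1)) * (potConst d β * lmorrey p q β (cylinder R 0) f) *
        (ρ : ℝ≥0∞) ^ (1 - β) := by
  have hρ' : (0 : ℝ) < ρ := by exact_mod_cast hρ
  set g := (cylinder R 0).indicator f
  set Φ := potConst d β * lmorrey p q β (cylinder R 0) f
  have hB : ∀ l, 0 < l → potAvg g z l ≤ Φ * ENNReal.ofReal l ^ (-β) := fun l hl =>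
    potAvg_le_lmorrey hp hq β R hf hz hl
  rw [← Set.Ioc_union_Ioi_eq_Ioi hρ'.le]
  refine (lintegral_union_le _ _ _).trans (add_le_add ?_ ?_)
  · have h1 : ∫⁻ l in Set.Ioc 0 (ρ : ℝ), potAvg g z l =
        ∫⁻ l in Set.Ioi (0 : ℝ), (Set.Ioc 0 (ρ : ℝ)).indicator (potAvg g z) l := by
      rw [setLIntegral_indicator measurableSet_Ioc, Set.inter_eq_left.2 Set.Ioc_subset_Ioi_self]
    rw [h1]
    refine lintegral_Ioi_le_of_le_of_le hβ (fun l hl => ?_) fun l hl => ?_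
    · by_cases hlρ : l ≤ ρ
      · rw [Set.indicator_of_mem (show l ∈ Set.Ioc 0 (ρ : ℝ) from ⟨hl, hlρ⟩)]
        refine le_trans (le_of_eq ?_) (potAvg_le_parMax _ z hl)
        unfold potAvg
        congr 1
        refine setLIntegral_congr_fun (measurableSet_parBox _ _) fun w hw => ?_
        exact (Set.indicator_of_mem (parBox_subset_parBox hzρ hl hlρ hw) g).symm
      · rw [Set.indicator_of_notMem fun h => hlρ h.2]
        exact zero_le
    · exact (Set.indicator_le_self _ _ l).trans (hB l hl)
  · refine (setLIntegral_mono' measurableSet_Ioi fun l hl => hB l (hρ'.trans hl)).trans ?_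
    have hm : Measurable fun l : ℝ => ENNReal.ofReal l ^ (-β) := by fun_prop
    rw [lintegral_const_mul _ hm, lintegral_Ioi_rpow_neg hβ hρ', div_eq_mul_one_div,
      ENNReal.ofReal_mul (by positivity), ← ENNReal.ofReal_rpow_of_pos hρ',
      ENNReal.ofReal_coe_nnreal]
    exact le_of_eq (by ring)

/-- It supplies the uniform bound on time slices required by `lmixed_parMax_le`. -/
theorem exists_lintegral_parBox_le (R : ℝ≥0∞) {f : SpaceTime d → ℝ} (hf : Continuous f) {p : ℝ}
    (hp : 0 < p) (z : SpaceTime d) (r : ℝ) : ∃ L : ℝ≥0∞, L ≠ ⊤ ∧ ∀ t, ∫⁻ x,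
      (parBox z r).indicator ((cylinder R 0).indicator fun w => ‖f w‖ₑ) (t, x) ^ p ≤ L := by
  have hcomp : IsCompact (Metric.closedBall z.1 (r ^ 2) ×ˢ Metric.closedBall z.2 r) :=
    (isCompact_closedBall _ _).prod (isCompact_closedBall _ _)
  obtain ⟨B, hB⟩ := hcomp.exists_bound_of_continuousOn hf.continuousOn
  refine ⟨ENNReal.ofReal B ^ p * volume (Metric.ball z.2 r), ENNReal.mul_ne_top
    (ENNReal.rpow_ne_top_of_nonneg hp.le ENNReal.ofReal_ne_top) measure_ball_lt_top.ne,
    fun t => ?_⟩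
  rw [← setLIntegral_const, ← lintegral_indicator measurableSet_ball]
  refine lintegral_mono fun x => ?_
  by_cases h : (t, x) ∈ parBox z r
  · rw [Set.indicator_of_mem h, Set.indicator_of_mem h.2]
    refine ENNReal.rpow_le_rpow ((Set.indicator_le_self _ _ _).trans ?_) hp.le
    rw [← ofReal_norm]
    exact ENNReal.ofReal_le_ofReal (hB _ ⟨Metric.ball_subset_closedBall h.1,
      Metric.ball_subset_closedBall h.2⟩)
  · rw [Set.indicator_of_notMem h, ENNReal.zero_rpow_of_pos hp]
    exact zero_le

/-- This handles the u-term, a constant of order R^{1-β} on the intersection. If ρ ≤ R, then R^{1-β}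
≤ ρ^{1-β}. If R ≤ ρ, the intersection is estimated by C_R, and the total power 1 - β + d/p + 2/q is
nonnegative, so R may be replaced by ρ. -/
theorem rpow_mul_lmixed_inter_cylinder_le {d : ℕ} {p q β : ℝ} (hp : 0 < p) (hq : 0 < q)
    (hβ : 1 < β) (hβ' : β - 1 ≤ d / p + 2 / q) (R ρ : ℝ≥0) (hR : 0 < R) (hρ : 0 < ρ)
    (z : SpaceTime d) :
    (R : ℝ≥0∞) ^ (1 - β) * lmixed p q
        ((cylinder (ρ : ℝ≥0∞) z ∩ cylinder (R : ℝ≥0∞) 0).indicator fun _ => 1) ≤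
      (ρ : ℝ≥0∞) ^ (1 - β) * (unitVol d ^ (1 / p) * (ρ : ℝ≥0∞) ^ (d / p + 2 / q)) := by
  have hR0 : (R : ℝ≥0∞) ≠ 0 := by simpa using hR.ne'
  have hρ0 : (ρ : ℝ≥0∞) ≠ 0 := by simpa using hρ.ne'
  rcases le_total ρ R with h | h
  · refine mul_le_mul' ?_ ?_
    · rw [show 1 - β = -(β - 1) by ring, ENNReal.rpow_neg, ENNReal.rpow_neg, ENNReal.inv_le_inv]
      exact ENNReal.rpow_le_rpow (by exact_mod_cast h) (by linarith)
    · rw [← lmixed_indicator_cylinder hp hq hρ z]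
      exact lmixed_mono hp.le hq.le fun w =>
        Set.indicator_le_indicator_of_subset Set.inter_subset_left (fun _ => zero_le) w
  · calc _ ≤ (R : ℝ≥0∞) ^ (1 - β) * (unitVol d ^ (1 / p) * (R : ℝ≥0∞) ^ (d / p + 2 / q)) := by
          rw [← lmixed_indicator_cylinder hp hq hR (0 : SpaceTime d)]
          refine mul_le_mul' le_rfl (lmixed_mono hp.le hq.le fun w =>
            Set.indicator_le_indicator_of_subset Set.inter_subset_right (fun _ => zero_le) w)
      _ = unitVol d ^ (1 / p) * (R : ℝ≥0∞) ^ (1 - β + (d / p + 2 / q)) := by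
          rw [ENNReal.rpow_add (1 - β) _ hR0 ENNReal.coe_ne_top, mul_left_comm]
      _ ≤ unitVol d ^ (1 / p) * (ρ : ℝ≥0∞) ^ (1 - β + (d / p + 2 / q)) := by
          gcongr
          linarith
      _ = _ := by
          rw [ENNReal.rpow_add (1 - β) _ hρ0 ENNReal.coe_ne_top, mul_left_comm]

/-- The embedding theorem for Morrey norms of functions with values in `[0, ∞]`. -/
theorem lmorrey_spaceGrad_le (d : ℕ) {q₁ q₂ β r₁ r₂ : ℝ} (hq₁ : 1 < q₁) (hq₂ : 1 < q₂)
    (hβ : 1 < β) (hβ' : β ≤ d / q₁ + 2 / q₂)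
    (hr₁ : r₁ * (β - 1) = q₁ * β) (hr₂ : r₂ * (β - 1) = q₂ * β) :
    ∃ K₁ K₃ : ℝ≥0∞, K₁ ≠ ⊤ ∧ K₃ ≠ ⊤ ∧ ∀ R : ℝ≥0∞, 0 < R → ∀ u : SpaceTime d → ℝ,
      ContDiff ℝ (⊤ : ℕ∞) u → HasCompactSupport u →
        lmorrey r₁ r₂ (β - 1) (cylinder R 0) (fun z => ‖spaceGrad u z‖ₑ) ≤
          K₁ * lmorrey q₁ q₂ β (cylinder R 0) (fun z => ‖heatSize u z‖ₑ) +
            K₃ * (R ^ 2)⁻¹ * lmorrey q₁ q₂ β (cylinder R 0) (fun z => ‖u z‖ₑ) := by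
  have hβ0 : 0 < β := by linarith
  have hq10 : 0 < q₁ := by linarith
  have hq20 : 0 < q₂ := by linarith
  set κ := 1 - 1 / β with hκdef
  have hκ : 0 < κ := by rw [hκdef, sub_pos, div_lt_one hβ0]; exact hβ
  have hκβ : κ * β = β - 1 := by rw [hκdef]; field_simp
  have er : ∀ {r q : ℝ}, r * (β - 1) = q * β → κ * r = q := by
    intro r q h
    have : κ * r * β = q * β := by rw [← h, ← hκβ]; ring
    exact mul_right_cancel₀ hβ0.ne' this
  have hκ1 := er hr₁
  have hκ2 := er hr₂
  have hr : ∀ {r q : ℝ}, 1 < q → κ * r = q → 1 ≤ r := by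
    intro r q hq h
    by_contra! hlt
    nlinarith
  have hr1 := hr hq₁ hκ1
  have hr2 := hr hq₂ hκ2
  have hr10 : 0 < r₁ := by linarith
  have hr20 : 0 < r₂ := by linarith
  -- Together with β ≤ d/q₁ + 2/q₂ this gives d/r₁ + 2/r₂ ≥ κβ = β - 1: the index β - 1 is
  -- admissible for the exponents r_i, and m ≥ 0.
  have hs : d / r₁ + 2 / r₂ = κ * (d / q₁ + 2 / q₂) := by
    rw [← hκ1, ← hκ2]; field_simp
  set m := 1 - β + (d / r₁ + 2 / r₂) with hm
  have hs' : β - 1 ≤ d / r₁ + 2 / r₂ := by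
    rw [hs, ← hκβ]; gcongr
  have hm0 : 0 ≤ m := by rw [hm]; linarith
  obtain ⟨Cm, hCm, hmax⟩ := lmixed_parMax_le d hq₁ hq₂
  obtain ⟨Cp, hCp, hpt⟩ := enorm_spaceGrad_le_potential d hq₁.le hq₂.le hβ
  set cβ := ENNReal.ofReal (1 + 1 / (β - 1))
  set c' := ENNReal.ofReal (1 / (β - 1))
  set C₀ := ENNReal.ofReal (2 * 4 ^ (d + 2)) * unitVol d with hC₀
  set Pc := potConst d β
  have hC₀t : C₀ ≠ ⊤ := ENNReal.mul_ne_top ENNReal.ofReal_ne_top unitVol_ne_top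
  have hPct : Pc ≠ ⊤ := potConst_ne_top d β
  refine ⟨Cp * cβ * C₀ ^ κ * Pc ^ (1 / β) * Cm ^ κ * 6 ^ m + Cp * c' * Pc, Cp, ?_, hCp, ?_⟩
  · finiteness
  intro R hR u hu huc
  have hQ := measurableSet_cylinder (d := d) R 0
  have hfm : Measurable fun z => ‖heatSize u z‖ₑ := (continuous_heatSize hu).enorm.measurable
  set Φ := lmorrey q₁ q₂ β (cylinder R 0) fun z => ‖heatSize u z‖ₑ
  set Φu := lmorrey q₁ q₂ β (cylinder R 0) fun z => ‖u z‖ₑ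
  refine iSup₂_le fun ρ hρ => iSup₂_le fun z₀ hz₀ => ?_
  have hρ0 : (ρ : ℝ≥0∞) ≠ 0 := by simpa using hρ.ne'
  have hNe := lmixed_indicator_cylinder (d := d) hr10 hr20 hρ z₀
  have hN0 := lmixed_cylinder_ne_zero (d := d) hr10 hr20 hρ z₀
  have hNt := lmixed_cylinder_ne_top (d := d) hr10 hr20 hρ z₀
  have hCm' := measurableSet_cylinder_coe (d := d) ρ z₀
  set C := cylinder (ρ : ℝ≥0∞) z₀
  set Q := cylinder R (0 : SpaceTime d)
  set g := (parBox z₀ (3 * ρ)).indicator (Q.indicator fun z => ‖heatSize u z‖ₑ) with hg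
  have hgm : Measurable g := (hfm.indicator hQ).indicator (measurableSet_parBox _ _)
  set N := lmixed r₁ r₂ (C.indicator fun _ => 1)
  set A₁ := Cp * cβ * C₀ ^ κ * (Pc * Φ) ^ (1 / β) with hA₁
  set A₂ := Cp * c' * (Pc * Φ) * (ρ : ℝ≥0∞) ^ (1 - β) with hA₂
  set A₃ := Cp * ((R ^ (1 + β))⁻¹ * Φu) with hA₃
  -- Y is the size of the unnormalized norm over C_ρ(z₀) that corresponds to a Morrey norm of order
  -- one; each of the three terms below is bounded by a multiple of it.
  set Y := (ρ : ℝ≥0∞) ^ (1 - β) * N with hY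
  have m1 : Measurable fun z => A₁ * parMax g z ^ κ :=
    ((measurable_parMax hgm).pow_const κ).const_mul _
  have m2 : Measurable fun z => A₂ * C.indicator (fun _ => (1 : ℝ≥0∞)) z :=
    (measurable_const.indicator hCm').const_mul _
  have m3 : Measurable fun z => A₃ * (C ∩ Q).indicator (fun _ => (1 : ℝ≥0∞)) z :=
    (measurable_const.indicator (hCm'.inter hQ)).const_mul _
  have hpoint : ∀ z, C.indicator (Q.indicator fun z => ‖spaceGrad u z‖ₑ) z ≤
      A₁ * parMax g z ^ κ + A₂ * C.indicator (fun _ => 1) z +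
        A₃ * (C ∩ Q).indicator (fun _ => 1) z := by
    intro z
    rw [Set.indicator_indicator]
    by_cases hz : z ∈ C ∩ Q
    · rw [Set.indicator_of_mem hz, Set.indicator_of_mem hz, Set.indicator_of_mem hz.1, mul_one,
        mul_one]
      refine (hpt R hR u hu huc z hz.2).trans ?_
      refine add_le_add ?_ le_rfl
      refine (mul_le_mul' le_rfl
        (lintegral_potAvg_le hq₁.le hq₂.le hβ R hfm hρ hz.2 hz.1)).trans (le_of_eq ?_)
      rw [hA₁, hA₂, ENNReal.mul_rpow_of_nonneg _ _ hκ.le]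
      ring
    · rw [Set.indicator_of_notMem hz]
      exact zero_le
  have hYe : Y = unitVol d ^ (1 / r₁) * (ρ : ℝ≥0∞) ^ m := by
    rw [hY, hNe, hm, ENNReal.rpow_add (1 - β) _ hρ0 ENNReal.coe_ne_top, mul_left_comm]
  have hT1 : A₁ * lmixed r₁ r₂ (fun z => parMax g z ^ κ) ≤
      Cp * cβ * C₀ ^ κ * Pc ^ (1 / β) * Cm ^ κ * 6 ^ m * Φ * Y := by
    rw [lmixed_rpow hκ hκ1 hκ2]
    have hg1 : lmixed q₁ q₂ g ≤ (6 * (ρ : ℝ≥0∞)) ^ (-β) * Φ *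
        (unitVol d ^ (1 / q₁) * (6 * (ρ : ℝ≥0∞)) ^ (d / q₁ + 2 / q₂)) := by
      have := lmixed_parBox_le_lmorrey (f := fun z => ‖heatSize u z‖ₑ) hq10 hq20 β R
        (r := 3 * ρ) (by positivity) hz₀
      have e6 : ((2 * (3 * ρ) : ℝ≥0) : ℝ≥0∞) = 6 * (ρ : ℝ≥0∞) := by
        rw [← mul_assoc]; push_cast; norm_num
      rw [e6] at this
      simpa [hg] using this
    have h60 : 6 * (ρ : ℝ≥0∞) ≠ 0 := mul_ne_zero (by simp) hρ0
    have h6t : 6 * (ρ : ℝ≥0∞) ≠ ⊤ := ENNReal.mul_ne_top (by simp) ENNReal.coe_ne_top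
    -- The power 1/β comes from the optimization and the power κ from the norm of the cut-off g;
    -- together they make the estimate linear in Φ.
    have eΦ : Φ = Φ ^ (1 / β) * Φ ^ κ := by
      rw [← ENNReal.rpow_add_of_nonneg _ _ (by positivity) hκ.le, hκdef, add_sub_cancel,
        ENNReal.rpow_one]
    have eU : (unitVol d ^ (1 / q₁)) ^ κ = unitVol d ^ (1 / r₁) := by
      rw [← ENNReal.rpow_mul, ← hκ1]
      congr 1
      field_simp
    have e6 : ((6 * (ρ : ℝ≥0∞)) ^ (-β)) ^ κ * ((6 * (ρ : ℝ≥0∞)) ^ (d / q₁ + 2 / q₂)) ^ κ =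
        6 ^ m * (ρ : ℝ≥0∞) ^ m := by
      rw [← ENNReal.rpow_mul, ← ENNReal.rpow_mul, ← ENNReal.rpow_add _ _ h60 h6t,
        ← ENNReal.mul_rpow_of_nonneg _ _ hm0]
      congr 1
      rw [hm, hs]
      linarith
    have hL := hmax g hgm (exists_lintegral_parBox_le R (continuous_heatSize hu) hq10 z₀ (3 * ρ))
    calc A₁ * lmixed q₁ q₂ (parMax g) ^ κ
        ≤ A₁ * (Cm * ((6 * (ρ : ℝ≥0∞)) ^ (-β) * Φ *
            (unitVol d ^ (1 / q₁) * (6 * (ρ : ℝ≥0∞)) ^ (d / q₁ + 2 / q₂)))) ^ κ :=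
          mul_le_mul' le_rfl (ENNReal.rpow_le_rpow (hL.trans (mul_le_mul' le_rfl hg1)) hκ.le)
      _ = Cp * cβ * C₀ ^ κ * (Pc ^ (1 / β) * Φ ^ (1 / β)) * (Cm ^ κ *
            (((6 * (ρ : ℝ≥0∞)) ^ (-β)) ^ κ * Φ ^ κ *
              ((unitVol d ^ (1 / q₁)) ^ κ * ((6 * (ρ : ℝ≥0∞)) ^ (d / q₁ + 2 / q₂)) ^ κ))) := by
          rw [hA₁, ENNReal.mul_rpow_of_nonneg Pc _ (by positivity),
            ENNReal.mul_rpow_of_nonneg Cm _ hκ.le, ENNReal.mul_rpow_of_nonneg (_ * Φ) _ hκ.le,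
            ENNReal.mul_rpow_of_nonneg _ Φ hκ.le, ENNReal.mul_rpow_of_nonneg (unitVol d ^ _) _ hκ.le]
      _ = Cp * cβ * C₀ ^ κ * Pc ^ (1 / β) * Cm ^ κ * (Φ ^ (1 / β) * Φ ^ κ) *
            (unitVol d ^ (1 / q₁)) ^ κ * (((6 * (ρ : ℝ≥0∞)) ^ (-β)) ^ κ *
              ((6 * (ρ : ℝ≥0∞)) ^ (d / q₁ + 2 / q₂)) ^ κ) := by
          generalize ((6 * (ρ : ℝ≥0∞)) ^ (-β)) ^ κ = a
          generalize ((6 * (ρ : ℝ≥0∞)) ^ (d / q₁ + 2 / q₂)) ^ κ = b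
          ring
      _ = _ := by
          rw [← eΦ, eU, e6, hYe]
          ring
  have hT2 : A₂ * N = Cp * c' * Pc * Φ * Y := by rw [hA₂, hY]; ring
  have hT3 : A₃ * lmixed r₁ r₂ ((C ∩ Q).indicator fun _ => 1) ≤ Cp * (R ^ 2)⁻¹ * Φu * Y := by
    rcases eq_or_ne R ⊤ with rfl | hRt
    · have : A₃ = 0 := by
        rw [hA₃, ENNReal.top_rpow_of_pos (by linarith), ENNReal.inv_top, zero_mul, mul_zero]
      rw [this, zero_mul]
      exact zero_le
    · lift R to ℝ≥0 using hRt
      have hR0 : 0 < R := by exact_mod_cast hR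
      have hRn : (R : ℝ≥0∞) ≠ 0 := by simpa using hR0.ne'
      have h1 := rpow_mul_lmixed_inter_cylinder_le (d := d) hr10 hr20 hβ hs' R ρ hR0 hρ z₀
      rw [← hNe] at h1
      -- Splitting R^{-1-β} = R^{-2} R^{1-β} isolates the factor of the statement; the remainder is
      -- compared with ρ^{1-β}.
      have e1 : ((R : ℝ≥0∞) ^ (1 + β))⁻¹ = ((R : ℝ≥0∞) ^ 2)⁻¹ * (R : ℝ≥0∞) ^ (1 - β) := by
        rw [← ENNReal.rpow_natCast, ← ENNReal.rpow_neg, ← ENNReal.rpow_neg,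
          ← ENNReal.rpow_add _ _ hRn ENNReal.coe_ne_top]
        congr 1
        push_cast
        ring
      calc A₃ * lmixed r₁ r₂ ((C ∩ Q).indicator fun _ => 1)
          = Cp * ((R : ℝ≥0∞) ^ 2)⁻¹ * Φu * ((R : ℝ≥0∞) ^ (1 - β) *
              lmixed r₁ r₂ ((C ∩ Q).indicator fun _ => 1)) := by rw [hA₃, e1]; ring
        _ ≤ _ := by gcongr
  have hX : lmixed r₁ r₂ (C.indicator (Q.indicator fun z => ‖spaceGrad u z‖ₑ)) ≤
      ((Cp * cβ * C₀ ^ κ * Pc ^ (1 / β) * Cm ^ κ * 6 ^ m + Cp * c' * Pc) * Φ +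
        Cp * (R ^ 2)⁻¹ * Φu) * Y := by
    calc _ ≤ lmixed r₁ r₂ (fun z => A₁ * parMax g z ^ κ + A₂ * C.indicator (fun _ => 1) z +
          A₃ * (C ∩ Q).indicator (fun _ => 1) z) := lmixed_mono hr10.le hr20.le hpoint
      _ ≤ lmixed r₁ r₂ (fun z => A₁ * parMax g z ^ κ) +
            lmixed r₁ r₂ (fun z => A₂ * C.indicator (fun _ => 1) z) +
            lmixed r₁ r₂ (fun z => A₃ * (C ∩ Q).indicator (fun _ => 1) z) :=
          (lmixed_add_le hr1 hr2 (m1.add m2) m3).trans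
            (add_le_add (lmixed_add_le hr1 hr2 m1 m2) le_rfl)
      _ = A₁ * lmixed r₁ r₂ (fun z => parMax g z ^ κ) + A₂ * N +
            A₃ * lmixed r₁ r₂ ((C ∩ Q).indicator fun _ => 1) := by
          rw [lmixed_const_mul hr10 hr20 ((measurable_parMax hgm).pow_const κ),
            lmixed_const_mul hr10 hr20 (measurable_const.indicator hCm'),
            lmixed_const_mul hr10 hr20 (measurable_const.indicator (hCm'.inter hQ))]
      _ ≤ Cp * cβ * C₀ ^ κ * Pc ^ (1 / β) * Cm ^ κ * 6 ^ m * Φ * Y + Cp * c' * Pc * Φ * Y +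
            Cp * (R ^ 2)⁻¹ * Φu * Y := by
          rw [hT2]
          exact add_le_add (add_le_add hT1 le_rfl) hT3
      _ = _ := by ring
  have hYinv : (ρ : ℝ≥0∞) ^ (β - 1) * (N⁻¹ * Y) = 1 := by
    rw [hY, mul_left_comm N⁻¹, ENNReal.inv_mul_cancel hN0 hNt, mul_one,
      ← ENNReal.rpow_add _ _ hρ0 ENNReal.coe_ne_top]
    simp
  calc (ρ : ℝ≥0∞) ^ (β - 1) * (N⁻¹ *
        lmixed r₁ r₂ (C.indicator (Q.indicator fun z => ‖spaceGrad u z‖ₑ)))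
      ≤ (ρ : ℝ≥0∞) ^ (β - 1) * (N⁻¹ *
        (((Cp * cβ * C₀ ^ κ * Pc ^ (1 / β) * Cm ^ κ * 6 ^ m + Cp * c' * Pc) * Φ +
        Cp * (R ^ 2)⁻¹ * Φu) * Y)) := by gcongr
    _ = ((Cp * cβ * C₀ ^ κ * Pc ^ (1 / β) * Cm ^ κ * 6 ^ m + Cp * c' * Pc) * Φ +
        Cp * (R ^ 2)⁻¹ * Φu) * ((ρ : ℝ≥0∞) ^ (β - 1) * (N⁻¹ * Y)) := by
        generalize ((Cp * cβ * C₀ ^ κ * Pc ^ (1 / β) * Cm ^ κ * 6 ^ m + Cp * c' * Pc) * Φ +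
          Cp * (R ^ 2)⁻¹ * Φu) = a
        ring
    _ = _ := by rw [hYinv, mul_one]

end ParabolicMorrey

end

theorem theorem5p11 (d : ℕ) (hd : 1 ≤ d) (q₁ q₂ β r₁ r₂ : ℝ) (hq₁ : 1 < q₁) (hq₂ : 1 < q₂)
    (hβ : 1 < β) (hβ' : β ≤ d / q₁ + 2 / q₂)
    (hr₁ : r₁ * (β - 1) = q₁ * β) (hr₂ : r₂ * (β - 1) = q₂ * β) :
    ∃ N : ℝ≥0, ∀ R : ℝ≥0∞, 0 < R → ∀ u : ParabolicMorrey.SpaceTime d → ℝ,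
      ContDiff ℝ (⊤ : ℕ∞) u → HasCompactSupport u →
        ParabolicMorrey.morreyNorm r₁ r₂ (β - 1) (ParabolicMorrey.cylinder R 0)
            (ParabolicMorrey.spaceGrad u) ≤
          N * ParabolicMorrey.morreyNorm q₁ q₂ β (ParabolicMorrey.cylinder R 0)
              (fun z => |ParabolicMorrey.timeDeriv u z| + ‖ParabolicMorrey.spaceHess u z‖) +
            N * (R ^ 2)⁻¹ *
              ParabolicMorrey.morreyNorm q₁ q₂ β (ParabolicMorrey.cylinder R 0) u := by
  obtain ⟨K₁, K₃, h1, h3, h⟩ := ParabolicMorrey.lmorrey_spaceGrad_le d hq₁ hq₂ hβ hβ' hr₁ hr₂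
  refine ⟨(K₁ + K₃).toNNReal, fun R hR u hu huc => ?_⟩
  rw [ParabolicMorrey.morreyNorm_eq_lmorrey, ParabolicMorrey.morreyNorm_eq_lmorrey,
    ParabolicMorrey.morreyNorm_eq_lmorrey, ENNReal.coe_toNNReal (ENNReal.add_ne_top.2 ⟨h1, h3⟩)]
  refine (h R hR u hu huc).trans ?_
  gcongr
  · exact le_self_add
  · exact le_add_self
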